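/- Notation. Write $e(x)=e^{2\pi i x}$, $q=e(\tau)$ for $\tau\in\mathfrak H$, $\beta(x,y)=\sum_i x_iy_i$ and $\beta(x)=\tfrac12\beta(x,x)$. For $r\in\{1,3,5,7\}$ let $D_r=\{x\in\mathbb Z^r: x_1+\dots+x_r\in 2\mathbb Z\}$, let $D_r^\sharp=\{x\in\mathbb Q^r:\beta(x,y)\in\mathbb Z\ \forall y\in D_r\}$, let $v_1=\tfrac12(1,\dots,1)\in D_r^\sharp$ and $$\theta_{r,1}(\tau,z)=\sum_{y\in v_1+D_r}e(\tau\beta(y)+\beta(y,z)).$$ For $\kappa\in\mathbb Z$, $J^{cusp}_{\kappa,D_r}$ denotes the space of Jacobi cusp forms of weight $\kappa$ and index $D_r$: holomorphic $\phi:\mathfrak H\times\mathbb C^r\to\mathbb C$ such that (i) $\phi\bigl(\tfrac{a\tau+b}{c\tau+d},\tfrac{z}{c\tau+d}\bigr)\,e\bigl(\tfrac{-c\beta(z)}{c\tau+d}\bigr)(c\tau+d)^{-\kappa}=\phi(\tau,z)$ for all $\left(\begin{smallmatrix}a&b\\c&d\end{smallmatrix}\right)\in\mathrm{SL}(2,\mathbb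 Z)$; (ii) $\phi(\tau,z+\lambda\tau+\mu)\,e(\tau\beta(\lambda)+\beta(\lambda,z))=\phi(\tau,z)$ for all $\lambda,\mu\in D_r$; (iii) $\phi(\tau,z)=\sum_{n'\in\mathbb Z,\,r'\in D_r^\sharp}c(n',r')\,e(n'\tau+\beta(r',z))$ with $c(n',r')=0$ unless $n'-\beta(r')>0$. Put $c(n',r')=0$ if $(n',r')\notin\mathbb Z\times D_r^\sharp$, and put $$h_1(\tau)=\sum_{n'\in\mathbb Z}c(n',v_1)\,e\bigl((n'-\tfrac r8)\tau\bigr).$$ Let $\eta$ be the Dedekind eta function and $M_w(1)$ the space of modular forms of weight $w$ on $\mathrm{SL}(2,\mathbb Z)$. Hecke operators. Let $p$ be an odd prime. For $\phi\in J^{cusp}_{\kappa,D_r}$ as above, $\phi|T^J(p)$ is the function with Fourier coefficients, for $(n',r')\in\mathbb Z\times D_r^\sharp$, $$c^*(n',r')=c(p^2n',pr')+p^{\kappa-r-2}\Bigl(\bigl(\tfrac{-1}p\bigr)p\Bigr)^{\frac{r+1}2}\Bigl(\frac{2[D_r^\sharp:D_r]}p\Bigr)\Bigl(\frac{n'-\beta(r')}p\Bigr)c(n',r')$$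 $$\qquad+\,p^{2\kappa-r-2}\sum_{\lambda\in D_r/pD_r}c\Bigl(\frac{n'-\beta(r',\lambda)+\beta(\lambda)}{p^2},\frac{r'-\lambda}p\Bigr).$$ For $f=\sum_{n\ge1}a(n)q^{n/8}$ of weight $k+\frac12$ in $\eta^{3(8-r)}M_{k-12+\frac{3r+1}2}(1)$, the twisted Hecke operator is $$f|\tilde T(p^2)=\Bigl(\frac{-4}p\Bigr)\sum_{n\ge1}\Bigl\{a(p^2n)+\Bigl(\frac{(-1)^kn}p\Bigr)p^{k-1}a(n)+p^{2k-1}a(n/p^2)\Bigr\}q^{n/8},$$ where $a(n/p^2)=0$ if $p^2\nmid n$. The symbol $(\frac{x}{p})$ is the Legendre symbol, extended multiplicatively to rational numbers $x$ with denominator prime to $p$. Proposition 5.2. Let $r\in\{1,3,5,7\}$ and let $k\in\mathbb Z$ be such that $k+\frac{r+1}2$ is odd. Then every $\phi\in J^{cusp}_{k+\frac{r+1}2,D_r}$ satisfies $$\phi(\tau,z)=h_1(\tau)\bigl(\theta_{r,1}(\tau,z)-\theta_{r,1}(\tau,-z)\bigr),$$ and $\phi\mapsto h_1$ defines an isomorphism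 of complex vector spaces $$\mathcal J:\ J^{cusp}_{k+\frac{r+1}2,D_r}\ \xrightarrow{\ \cong\ }\ \eta^{3(8-r)}M_{k-12+\frac{3r+1}2}(1).$$ It is an isomorphism of Hecke modules: for every odd prime $p$ and every $\phi\in J^{cusp}_{k+\frac{r+1}2,D_r}$ the series defining $\phi|T^J(p)$ and $\mathcal J(\phi)|\tilde T(p^2)$ converge absolutely, $\phi|T^J(p)$ again lies in $J^{cusp}_{k+\frac{r+1}2,D_r}$, and $$\mathcal J(\phi|T^J(p))=\mathcal J(\phi)|\tilde T(p^2).$$ -/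

import Mathlib

open UpperHalfPlane

noncomputable section

namespace LatticeJacobi

/-- `e(x) = exp(2 π i x)`. -/
def e (x : ℂ) : ℂ := Complex.exp (2 * Real.pi * Complex.I * x)

/-! ### Lattices

A lattice of rank `n` is a full-rank additive subgroup `L` of `ℚ^n = L ⊗ ℚ`, with the Euclidean
bilinear form `β(x, y) = ∑ x_i y_i`; moreover `L ⊗ ℂ = ℂ^n`. We write `β(x) = β(x, x) / 2`. -/

variable {n : ℕ}

/-- The vector of `ℂ^n` attached to a vector of `ℚ^n`. -/
def toC (x : Fin n → ℚ) : Fin n → ℂ := fun i => (x i : ℂ)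

/-- `β(x) = β(x, x) / 2` for a rational vector `x`. -/
def qf (x : Fin n → ℚ) : ℚ := (x ⬝ᵥ x) / 2

/-- `β(z) = β(z, z) / 2` for a complex vector `z`. -/
def qfC (z : Fin n → ℂ) : ℂ := (z ⬝ᵥ z) / 2

/-- The dual lattice `L^♯ = {x : β(x, y) ∈ ℤ for all y ∈ L}`. -/
def dual (L : AddSubgroup (Fin n → ℚ)) : AddSubgroup (Fin n → ℚ) where
  carrier := {x | ∀ y ∈ L, ∃ m : ℤ, x ⬝ᵥ y = m}
  zero_mem' := fun y _ => ⟨0, by simp⟩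
  add_mem' := by
    intro a b ha hb y hy
    obtain ⟨m, hm⟩ := ha y hy
    obtain ⟨l, hl⟩ := hb y hy
    exact ⟨m + l, by rw [add_dotProduct, hm, hl]; push_cast; rfl⟩
  neg_mem' := by
    intro a ha y hy
    obtain ⟨m, hm⟩ := ha y hy
    exact ⟨-m, by rw [neg_dotProduct, hm]; push_cast; rfl⟩

/-- The root lattice `D_r = {x ∈ ℤ^r : x_1 + ... + x_r even}`. -/
def latticeD (r : ℕ) : AddSubgroup (Fin r → ℚ) where
  carrier := {x | ∃ m : Fin r → ℤ, (∀ i, x i = m i) ∧ Even (∑ i, m i)}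
  zero_mem' := ⟨0, by simp, by simp⟩
  add_mem' := by
    rintro a b ⟨m, hm, hme⟩ ⟨l, hl, hle⟩
    refine ⟨m + l, fun i => by simp [hm i, hl i], ?_⟩
    simpa [Finset.sum_add_distrib] using hme.add hle
  neg_mem' := by
    rintro a ⟨m, hm, hme⟩
    refine ⟨-m, fun i => by simp [hm i], ?_⟩
    simpa using hme

/-- `v_1 = (e_1 + ... + e_r) / 2`. -/
def v1 (r : ℕ) : Fin r → ℚ := fun _ => 1 / 2

/-- The theta function `θ_{L,x}(τ, z) = ∑_{y ∈ x + L} e(τ β(y) + β(y, z))`. -/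
def theta (L : AddSubgroup (Fin n → ℚ)) (x : Fin n → ℚ) (τ : ℍ) (z : Fin n → ℂ) : ℂ :=
  ∑' y : L, e ((τ : ℂ) * (qf (x + (y : Fin n → ℚ)) : ℂ) + toC (x + (y : Fin n → ℚ)) ⬝ᵥ z)

/-! ### Jacobi forms of lattice index -/

/-- `φ` has the (absolutely convergent) Fourier expansion
`φ(τ, z) = ∑_{m ∈ ℤ} ∑_{x ∈ L^♯} c(m, x) e(m τ + β(x, z))`. The coefficient function is
extended by zero to all of `ℚ × ℚ^n`. -/
structure HasFourierExpansion (L : AddSubgroup (Fin n → ℚ)) (φ : ℍ → (Fin n → ℂ) → ℂ)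
    (c : ℚ → (Fin n → ℚ) → ℂ) : Prop where
  support : ∀ m x, c m x ≠ 0 → (∃ l : ℤ, m = l) ∧ x ∈ dual L
  hasSum : ∀ (τ : ℍ) (z : Fin n → ℂ),
    HasSum (fun q : ℤ × dual L =>
      c (q.1 : ℚ) q.2 * e ((q.1 : ℂ) * (τ : ℂ) + toC (q.2 : Fin n → ℚ) ⬝ᵥ z)) (φ τ z)

open scoped MatrixGroups in
/-- Jacobi forms of weight `k` and index `L`. -/
structure IsJacobiForm (k : ℤ) (L : AddSubgroup (Fin n → ℚ)) (φ : ℍ → (Fin n → ℂ) → ℂ) :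
    Prop where
  holo : DifferentiableOn ℂ (fun w : ℂ × (Fin n → ℂ) => φ (ofComplex w.1) w.2)
    {w | 0 < w.1.im}
  modular : ∀ (A : SL(2, ℤ)) (τ : ℍ) (z : Fin n → ℂ),
    φ (A • τ) ((((A 1 0 : ℤ) : ℂ) * (τ : ℂ) + ((A 1 1 : ℤ) : ℂ))⁻¹ • z)
      * e (-((A 1 0 : ℤ) : ℂ) * qfC z / (((A 1 0 : ℤ) : ℂ) * (τ : ℂ) + ((A 1 1 : ℤ) : ℂ)))
      * (((A 1 0 : ℤ) : ℂ) * (τ : ℂ) + ((A 1 1 : ℤ) : ℂ)) ^ (-k) = φ τ z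
  elliptic : ∀ x ∈ L, ∀ y ∈ L, ∀ (τ : ℍ) (z : Fin n → ℂ),
    φ τ (z + (τ : ℂ) • toC x + toC y) * e ((τ : ℂ) * (qf x : ℂ) + toC x ⬝ᵥ z) = φ τ z
  fourier : ∃ c, HasFourierExpansion L φ c ∧ ∀ m x, c m x ≠ 0 → 0 ≤ m - qf x

/-- Jacobi cusp forms of weight `k` and index `L`. -/
structure IsJacobiCuspForm (k : ℤ) (L : AddSubgroup (Fin n → ℚ)) (φ : ℍ → (Fin n → ℂ) → ℂ) :
    Prop extends IsJacobiForm k L φ where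
  cusp : ∃ c, HasFourierExpansion L φ c ∧ ∀ m x, c m x ≠ 0 → 0 < m - qf x

theorem HasFourierExpansion.zero (L : AddSubgroup (Fin n → ℚ)) :
    HasFourierExpansion L 0 0 :=
  ⟨fun m x h => absurd rfl h, fun τ z => by simp⟩

theorem HasFourierExpansion.add {L : AddSubgroup (Fin n → ℚ)} {φ ψ : ℍ → (Fin n → ℂ) → ℂ}
    {c d : ℚ → (Fin n → ℚ) → ℂ} (hc : HasFourierExpansion L φ c)
    (hd : HasFourierExpansion L ψ d) : HasFourierExpansion L (φ + ψ) (c + d) := by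
  refine ⟨fun m x h => ?_, fun τ z => ?_⟩
  · by_cases h0 : c m x = 0
    · exact hd.support m x (by simpa [h0] using h)
    · exact hc.support m x h0
  · simpa [add_mul] using (hc.hasSum τ z).add (hd.hasSum τ z)

theorem HasFourierExpansion.smul {L : AddSubgroup (Fin n → ℚ)} {φ : ℍ → (Fin n → ℂ) → ℂ}
    {c : ℚ → (Fin n → ℚ) → ℂ} (a : ℂ) (hc : HasFourierExpansion L φ c) :
    HasFourierExpansion L (a • φ) (a • c) := by
  refine ⟨fun m x h => hc.support m x fun h0 => h (by simp [h0]), fun τ z => ?_⟩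
  simpa [mul_assoc] using (hc.hasSum τ z).mul_left a

/-- The space `J^{cusp}_{k,L}`. -/
def jacobiCusp (k : ℤ) (L : AddSubgroup (Fin n → ℚ)) :
    Submodule ℂ (ℍ → (Fin n → ℂ) → ℂ) where
  carrier := {φ | IsJacobiCuspForm k L φ}
  zero_mem' :=
    { holo := differentiableOn_const 0
      modular := fun A τ z => by simp
      elliptic := fun x _ y _ τ z => by simp
      fourier := ⟨0, HasFourierExpansion.zero L, fun m x h => absurd rfl h⟩
      cusp := ⟨0, HasFourierExpansion.zero L, fun m x h => absurd rfl h⟩ }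
  add_mem' := by
    intro φ ψ hφ hψ
    refine { holo := hφ.holo.add hψ.holo, modular := ?_, elliptic := ?_, fourier := ?_, cusp := ?_ }
    · intro A τ z
      simpa [add_mul] using congrArg₂ (· + ·) (hφ.modular A τ z) (hψ.modular A τ z)
    · intro x hx y hy τ z
      simpa [add_mul] using congrArg₂ (· + ·) (hφ.elliptic x hx y hy τ z)
        (hψ.elliptic x hx y hy τ z)
    · obtain ⟨c, hc, hc'⟩ := hφ.fourier
      obtain ⟨d, hd, hd'⟩ := hψ.fourier
      refine ⟨c + d, hc.add hd, fun m x h => ?_⟩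
      by_cases h0 : c m x = 0
      · exact hd' m x (by simpa [h0] using h)
      · exact hc' m x h0
    · obtain ⟨c, hc, hc'⟩ := hφ.cusp
      obtain ⟨d, hd, hd'⟩ := hψ.cusp
      refine ⟨c + d, hc.add hd, fun m x h => ?_⟩
      by_cases h0 : c m x = 0
      · exact hd' m x (by simpa [h0] using h)
      · exact hc' m x h0
  smul_mem' := by
    intro a φ hφ
    refine { holo := hφ.holo.const_smul a, modular := ?_, elliptic := ?_, fourier := ?_, cusp := ?_ }
    · intro A τ z
      simpa [mul_assoc] using congrArg (a * ·) (hφ.modular A τ z)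
    · intro x hx y hy τ z
      simpa [mul_assoc] using congrArg (a * ·) (hφ.elliptic x hx y hy τ z)
    · obtain ⟨c, hc, hc'⟩ := hφ.fourier
      exact ⟨a • c, hc.smul a, fun m x h => hc' m x fun h0 => h (by simp [h0])⟩
    · obtain ⟨c, hc, hc'⟩ := hφ.cusp
      exact ⟨a • c, hc.smul a, fun m x h => hc' m x fun h0 => h (by simp [h0])⟩

open scoped Classical in
/-- The Fourier coefficients `c(m, x)` of `φ`, extended by zero outside `ℤ × L^♯`. They are
uniquely determined by the (everywhere absolutely convergent) expansion. -/
def coeff (L : AddSubgroup (Fin n → ℚ)) (φ : ℍ → (Fin n → ℂ) → ℂ) : ℚ → (Fin n → ℚ) → ℂ :=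
  if h : ∃ c, HasFourierExpansion L φ c then h.choose else 0

/-- The theta coefficient `h_x(τ) = ∑_{m ∈ ℤ} c(m, x) e((m - β(x)) τ)` of `φ`. -/
def thetaCoeff (L : AddSubgroup (Fin n → ℚ)) (φ : ℍ → (Fin n → ℂ) → ℂ) (x : Fin n → ℚ) :
    ℍ → ℂ :=
  fun τ => ∑' m : ℤ, coeff L φ m x * e (((m - qf x : ℚ) : ℂ) * (τ : ℂ))

/-! ### Hecke operators -/

/-- The Legendre symbol `(x / p)` of a rational number `x` whose denominator is prime to `p`. -/
def legendreQ (p : ℕ) [Fact p.Prime] (x : ℚ) : ℤ :=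
  legendreSym p x.num * legendreSym p x.den

/-- The Fourier coefficients `c^*(m, x)` of `φ | T^J(p^2)`, for a Jacobi form `φ` of weight `k`
whose index is an even lattice `L` of odd rank `n`, and a prime `p` not dividing `2 [L^♯ : L]`.
The summands over `λ ∈ L / pL` do not depend on the choice of representatives. -/
def heckeCoeff (k : ℤ) (L : AddSubgroup (Fin n → ℚ)) (p : ℕ) [Fact p.Prime]
    (φ : ℍ → (Fin n → ℂ) → ℂ) (m : ℚ) (x : Fin n → ℚ) : ℂ :=
  coeff L φ ((p : ℚ) ^ 2 * m) ((p : ℚ) • x)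
  + (p : ℂ) ^ (k - n - 2) * coeff L φ m x
      * (((legendreSym p (-1) : ℂ) * (p : ℂ)) ^ ((n + 1) / 2)
        * (legendreSym p (2 * (L.relIndex (dual L) : ℤ)) : ℂ)
        * (legendreQ p (m - qf x) : ℂ))
  + (p : ℂ) ^ (2 * k - n - 2)
      * ∑ᶠ l : L ⧸ (zsmulAddGroupHom (p : ℤ) : L →+ L).range,
          coeff L φ ((m - x ⬝ᵥ (l.out : Fin n → ℚ) + qf (l.out : Fin n → ℚ)) / (p : ℚ) ^ 2)
            ((p : ℚ)⁻¹ • (x - (l.out : Fin n → ℚ)))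

open scoped Classical in
/-- The coefficient function `c^*`, restricted to `ℤ × L^♯` and extended by zero. -/
def heckeCoeffZ (k : ℤ) (L : AddSubgroup (Fin n → ℚ)) (p : ℕ) [Fact p.Prime]
    (φ : ℍ → (Fin n → ℂ) → ℂ) (m : ℚ) (x : Fin n → ℚ) : ℂ :=
  if (∃ l : ℤ, m = l) ∧ x ∈ dual L then heckeCoeff k L p φ m x else 0

/-- `φ | T^J(p^2)`, the function with Fourier coefficients `c^*(m, x)`, `(m, x) ∈ ℤ × L^♯`. -/
def heckeJ (k : ℤ) (L : AddSubgroup (Fin n → ℚ)) (p : ℕ) [Fact p.Prime]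
    (φ : ℍ → (Fin n → ℂ) → ℂ) : ℍ → (Fin n → ℂ) → ℂ :=
  fun τ z => ∑' q : ℤ × dual L,
    heckeCoeffZ k L p φ (q.1 : ℚ) q.2
      * e ((q.1 : ℂ) * (τ : ℂ) + toC (q.2 : Fin n → ℚ) ⬝ᵥ z)

/-- The space `η^s M_w(1)` of functions on the upper half plane. -/
def etaModularForms (s : ℕ) (w : ℤ) : Submodule ℂ (ℍ → ℂ) where
  carrier := {f | ∃ g : ModularForm (CongruenceSubgroup.Gamma 1) w,
    ∀ τ : ℍ, f τ = ModularForm.eta (τ : ℂ) ^ s * g τ}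
  zero_mem' := ⟨0, fun τ => by simp⟩
  add_mem' := by
    rintro f f' ⟨g, hg⟩ ⟨g', hg'⟩
    exact ⟨g + g', fun τ => by simp [hg τ, hg' τ, mul_add]⟩
  smul_mem' := by
    rintro a f ⟨g, hg⟩
    exact ⟨a • g, fun τ => by simp [hg τ]; ring⟩

/-- The coefficients `c(m)` of the expansion `f(τ) = ∑_{m ≥ 0} c(m) q^{m/8}`. -/
def coeff8 (f : ℍ → ℂ) (m : ℕ) : ℂ := (qExpansion 8 f).coeff m

/-- The coefficients of `f | T̃(p^2)`, for a form `f` of `η`-type of weight `k + 1/2`, where `T̃`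
is the twisted Hecke operator. -/
def twistedHeckeCoeff (k : ℤ) (p : ℕ) [Fact p.Prime] (f : ℍ → ℂ) (m : ℕ) : ℂ :=
  (legendreSym p (-4) : ℂ) *
    (coeff8 f (p ^ 2 * m)
      + (legendreSym p ((-1) ^ k.natAbs * (m : ℤ)) : ℂ) * (p : ℂ) ^ (k - 1) * coeff8 f m
      + (p : ℂ) ^ (2 * k - 1) * (if p ^ 2 ∣ m then coeff8 f (m / p ^ 2) else 0))

/-- `m`-th term of the series `∑_{m ≥ 1} c^*(m) q^{m/8}`, with index shifted to start at `0`. -/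
def twistedHeckeTerm (k : ℤ) (p : ℕ) [Fact p.Prime] (f : ℍ → ℂ) (τ : ℍ) (m : ℕ) : ℂ :=
  twistedHeckeCoeff k p f (m + 1) * e (((m + 1 : ℕ) : ℂ) / 8 * (τ : ℂ))

/-- `f | T̃(p^2)`, the twisted Hecke operator in weight `k + 1/2`. -/
def twistedHecke (k : ℤ) (p : ℕ) [Fact p.Prime] (f : ℍ → ℂ) : ℍ → ℂ :=
  fun τ => ∑' m : ℕ, twistedHeckeTerm k p f τ m

end LatticeJacobi

end

open LatticeJacobi

/-! Write ϑ for the odd Jacobi theta function `oddTheta`. For odd r the difference of the two theta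
series is the product `prodTheta` of the ϑ(τ, z_i): among half-odd vectors n/2 the character ∏
χ₄(n_i) is 1 on v₁ + D_r and -1 on -v₁ + D_r (`theta_sub_theta_neg`).

The elliptic law makes a coefficient c(m, x) depend only on m - β(x) and on x mod D_r, and -I in
SL(2, ℤ) makes it odd in x when the weight is odd. An integral x satisfies 2x ∈ D_r, so its class is
its own negative and its coefficients vanish; the classes ±v₁ remain and carry opposite
coefficients. Hence φ = h₁ · `prodTheta` (`IsJacobiCuspForm.coeff_eq_thetaCoefficients`).

As `prodTheta` is not identically zero in z, φ transforms as a Jacobi form exactly when h₁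
transforms inversely to ϑ^r; this is `IsThetaDual`. The function η³ has the multiplier of ϑ in
weight 3/2 (`nuS_eq_eta`), so η^{3(8-r)} = η²⁴/η^{3r} has the multiplier of h₁ and the quotient is
modular of level one. The exponents n/8 of h₁ satisfy n ≡ -r mod 8, so n ≥ 8 - r, the order of
η^{3(8-r)}; thus the quotient is bounded at infinity, and conversely the cusp condition is automatic
(`IsThetaDual.mem`, `isThetaDual_of_mem`).

On Fourier coefficients the Hecke identity is a computation: at most one coset of D_r/pD_r
contributes, the discriminant is 4, and the signs agree because the weight is odd
(`finsum_thetaCoefficients`, `middle_constant`, `heckeCoeff_mul_prodTheta`). What remains is that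
the image of h₁ is again theta dual. It is written as a sum of h₁((τ + 8b)/p²), twisted translates
h₁(τ + 8b/p) and h₁(p²τ). Under S the terms with b a unit mod p² are permuted, the terms with p
exactly dividing b are exchanged with the twisted translates, and b = 0 is exchanged with h₁(p²τ)
(`heckeSum_S`).

The multipliers in these exchanges are found without an explicit formula for the theta multiplier.
Averaging a function built from ϑ(τ', ·) over p-torsion translates yields a scalar times ϑ(τ, ·),
computed by orthogonality or a Gauss sum; averaging commutes with S, so comparing the scalars on
both sides determines the factor (`torsionAverage_S`, `torsionAverage_isogeny`,
`torsionAverage_translate`). -/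

open UpperHalfPlane

noncomputable section

namespace LatticeJacobi

/-! ### The exponential -/

theorem e_add (x y : ℂ) : e (x + y) = e x * e y := by
  rw [e, e, e, ← Complex.exp_add]; congr 1; ring

theorem e_zero : e 0 = 1 := by simp [e]

theorem e_ne_zero (x : ℂ) : e x ≠ 0 := Complex.exp_ne_zero _

theorem e_int (n : ℤ) : e n = 1 := by
  rw [e, mul_comm]; exact Complex.exp_int_mul_two_pi_mul_I n

theorem e_neg (x : ℂ) : e (-x) = (e x)⁻¹ := by
  rw [e, e, ← Complex.exp_neg]; congr 1; ring

theorem e_nat_mul (n : ℕ) (x : ℂ) : e (n * x) = e x ^ n := by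
  rw [e, e, ← Complex.exp_nat_mul]; congr 1; ring

theorem e_sum {ι : Type*} (s : Finset ι) (f : ι → ℂ) : e (∑ i ∈ s, f i) = ∏ i ∈ s, e (f i) := by
  simp only [e, Finset.mul_sum, Complex.exp_sum]

theorem norm_e (x : ℂ) : ‖e x‖ = Real.exp (-2 * Real.pi * x.im) := by
  rw [e, Complex.norm_exp]; congr 1; simp

theorem e_eq_of_sub_int {x y : ℂ} (n : ℤ) (h : x - y = n) : e x = e y := by
  rw [show x = y + n by rw [← h]; ring, e_add, e_int, mul_one]

theorem differentiable_e : Differentiable ℂ e := by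
  unfold e; fun_prop

theorem e_half : e (1 / 2) = -1 := by
  rw [e, show 2 * (Real.pi : ℂ) * Complex.I * (1 / 2) = Real.pi * Complex.I by ring,
    Complex.exp_pi_mul_I]

theorem e_int_half (n : ℤ) : e (n / 2) = (-1) ^ n := by
  rw [← e_half, e, e, ← Complex.exp_int_mul]; congr 1; ring

theorem e_neg_quarter : e (-(1 / 4)) = -Complex.I := by
  rw [e, show 2 * (Real.pi : ℂ) * Complex.I * (-(1 / 4)) = -(Real.pi / 2 * Complex.I) by ring,
    Complex.exp_neg, Complex.exp_pi_div_two_mul_I, Complex.inv_I]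

/-! ### The character modulo four -/

/-- The nontrivial Dirichlet character modulo `4`, with complex values. -/
def chi4 (n : ℤ) : ℂ := ((ZMod.χ₄ (n : ZMod 4) : ℤ) : ℂ)

theorem chi4_mul (m n : ℤ) : chi4 (m * n) = chi4 m * chi4 n := by
  rw [chi4, chi4, chi4, Int.cast_mul, map_mul, Int.cast_mul]

theorem chi4_even {n : ℤ} (h : Even n) : chi4 n = 0 := by
  have : ZMod.χ₄ (n : ZMod 4) = 0 := by
    rw [ZMod.χ₄_int_eq_if_mod_four, if_pos (Int.even_iff.mp h)]
  simp [chi4, this]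

theorem chi4_add_two (n : ℤ) : chi4 (n + 2) = -chi4 n := by
  have : ∀ a : ZMod 4, ZMod.χ₄ (a + 2) = - ZMod.χ₄ a := by decide
  have h := this (n : ZMod 4)
  simp only [chi4]
  push_cast
  rw [h]; push_cast; rfl

theorem chi4_neg (n : ℤ) : chi4 (-n) = -chi4 n := by
  have : ∀ a : ZMod 4, ZMod.χ₄ (-a) = - ZMod.χ₄ a := by decide
  have h := this (n : ZMod 4)
  simp only [chi4]
  push_cast
  rw [h]; push_cast; rfl

theorem chi4_add_two_mul (n m : ℤ) : chi4 (n + 2 * m) = (-1) ^ m * chi4 n := by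
  induction m using Int.induction_on with
  | zero => simp
  | succ i ih =>
    rw [show n + 2 * ((i : ℤ) + 1) = (n + 2 * i) + 2 by ring, chi4_add_two, ih,
      zpow_add_one₀ (by norm_num)]; ring
  | pred i ih =>
    have := chi4_add_two (n + 2 * (-(i : ℤ) - 1))
    rw [show n + 2 * (-(i : ℤ) - 1) + 2 = n + 2 * -(i : ℤ) by ring, ih] at this
    rw [zpow_sub_one₀ (by norm_num), ← neg_eq_iff_eq_neg.mpr this]; norm_num

theorem chi4_one : chi4 1 = 1 := by simp [chi4]

theorem chi4_two_mul_add_one (m : ℤ) : chi4 (2 * m + 1) = (-1) ^ m := by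
  rw [add_comm, chi4_add_two_mul, chi4_one, mul_one]

theorem neg_one_zpow_mul_self (m : ℤ) : ((-1 : ℂ) ^ m) * (-1) ^ m = 1 := by
  rw [← mul_zpow]; norm_num

theorem chi4_sq_of_odd {n : ℤ} (h : Odd n) : chi4 n * chi4 n = 1 := by
  obtain ⟨m, rfl⟩ := h
  rw [chi4_two_mul_add_one, neg_one_zpow_mul_self]

theorem odd_of_chi4_ne_zero {n : ℤ} (h : chi4 n ≠ 0) : Odd n := by
  by_contra h'
  exact h (chi4_even (Int.not_odd_iff_even.mp h'))

theorem chi4_ne_zero {n : ℤ} (h : Odd n) : chi4 n ≠ 0 := fun h0 => by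
  simpa [h0] using chi4_sq_of_odd h

theorem norm_chi4_le (n : ℤ) : ‖chi4 n‖ ≤ 1 := by
  rcases Int.even_or_odd n with h | h
  · simp [chi4_even h]
  · obtain ⟨m, rfl⟩ := h
    simp [chi4_two_mul_add_one]

theorem odd_sq_sub_one {n : ℤ} (h : Odd n) : ∃ m : ℤ, n ^ 2 = 8 * m + 1 := by
  have := Int.sq_mod_four_eq_one_of_odd h
  obtain ⟨j, rfl⟩ := h
  obtain ⟨l, hl⟩ := Int.even_mul_succ_self j
  exact ⟨l, by linear_combination 4 * hl⟩

/-! ### The odd Jacobi theta function -/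

/-- The terms of the odd Jacobi theta function. -/
def oddThetaTerm (τ z : ℂ) (n : ℤ) : ℂ := chi4 n * e ((n : ℂ) ^ 2 / 8 * τ + n / 2 * z)

/-- The odd Jacobi theta function `∑ (-4 / n) e(n² τ / 8 + n z / 2)`. -/
def oddTheta (τ z : ℂ) : ℂ := ∑' n : ℤ, oddThetaTerm τ z n

theorem summable_oddThetaTerm {τ : ℂ} (hτ : 0 < τ.im) (z : ℂ) : Summable (oddThetaTerm τ z) := by
  have h := (summable_jacobiTheta₂_term_iff (z / 2) (τ / 4)).mpr (by simpa using hτ)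
  refine Summable.of_norm_bounded h.norm fun n => ?_
  rw [oddThetaTerm, norm_mul]
  refine (mul_le_of_le_one_left (norm_nonneg _) (norm_chi4_le n)).trans_eq ?_
  rw [e, jacobiTheta₂_term]
  congr 2; ring

theorem hasSum_oddTheta {τ : ℂ} (hτ : 0 < τ.im) (z : ℂ) :
    HasSum (oddThetaTerm τ z) (oddTheta τ z) := (summable_oddThetaTerm hτ z).hasSum

/-- Only odd n contribute; put n = 2m + 1 and absorb the sign (-1)^m into the shift by 1/2. This
transfers the functional equation and differentiability of `jacobiTheta₂`. -/
theorem oddTheta_eq_jacobiTheta₂ {τ : ℂ} (hτ : 0 < τ.im) (z : ℂ) :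
    oddTheta τ z = e (τ / 8 + z / 2) * jacobiTheta₂ (z + τ / 2 + 1 / 2) τ := by
  have h1 := (hasSum_jacobiTheta₂_term (z + τ / 2 + 1 / 2) hτ).mul_left (e (τ / 8 + z / 2))
  have hinj : Function.Injective (fun m : ℤ => 2 * m + 1) := fun a b h => by simpa using h
  refine ((hinj.hasSum_iff (f := oddThetaTerm τ z) ?_).mp ?_).tsum_eq
  · intro n hn
    have : Even n := by
      by_contra h
      obtain ⟨m, hm⟩ := Int.not_even_iff_odd.mp h
      exact hn ⟨m, hm.symm⟩
    simp [oddThetaTerm, chi4_even this]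
  · refine h1.congr_fun fun m => ?_
    rw [Function.comp_apply, oddThetaTerm, chi4_two_mul_add_one, ← e_int_half, jacobiTheta₂_term,
      e, e, e, ← Complex.exp_add, ← Complex.exp_add]
    congr 1; push_cast; ring

/-- The automorphy factor of the odd Jacobi theta function under `S`. -/
def nuS (τ : ℂ) : ℂ := -Complex.I * (-Complex.I * τ) ^ (1 / 2 : ℂ)

theorem oddTheta_S {τ : ℂ} (hτ : 0 < τ.im) (z : ℂ) :
    oddTheta (-1 / τ) (z / τ) * e (-z ^ 2 / (2 * τ)) = nuS τ * oddTheta τ z := by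
  have hτ0 : τ ≠ 0 := fun h => by simp [h] at hτ
  have hτ' : 0 < (-1 / τ).im := by
    rw [neg_div, Complex.neg_im, one_div, Complex.inv_im, neg_div, neg_neg]
    exact div_pos hτ (Complex.normSq_pos.mpr hτ0)
  have hroot : (-Complex.I * τ) ^ (1 / 2 : ℂ) ≠ 0 := by
    simp [Complex.cpow_eq_zero_iff, hτ0]
  rw [oddTheta_eq_jacobiTheta₂ hτ, oddTheta_eq_jacobiTheta₂ hτ',
    jacobiTheta₂_functional_equation (z + τ / 2 + 1 / 2) τ]
  -- Inversion exchanges the half periods τ/2 and 1/2 up to sign; one quasi-period shift by -1/τ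
  -- restores the characteristic.
  have h2 := jacobiTheta₂_add_left' ((z + τ / 2 + 1 / 2) / τ) (-1 / τ)
  rw [show (z + τ / 2 + 1 / 2) / τ + -1 / τ = z / τ + -1 / τ / 2 + 1 / 2 by field_simp; ring] at h2
  rw [h2, nuS]
  set t := jacobiTheta₂ ((z + τ / 2 + 1 / 2) / τ) (-1 / τ)
  generalize (-Complex.I * τ) ^ (1 / 2 : ℂ) = R at hroot ⊢
  rw [← e_neg_quarter]
  have h3 : e (-1 / τ / 8 + z / τ / 2) * Complex.exp (-Real.pi * Complex.I *
      (-1 / τ + 2 * ((z + τ / 2 + 1 / 2) / τ))) * e (-z ^ 2 / (2 * τ)) =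
      e (-(1 / 4)) * e (τ / 8 + z / 2) *
        Complex.exp (-Real.pi * Complex.I * (z + τ / 2 + 1 / 2) ^ 2 / τ) := by
    simp only [e, ← Complex.exp_add]
    congr 1
    field_simp
    ring
  calc _ = e (-1 / τ / 8 + z / τ / 2) * Complex.exp (-Real.pi * Complex.I *
      (-1 / τ + 2 * ((z + τ / 2 + 1 / 2) / τ))) * e (-z ^ 2 / (2 * τ)) * t := by ring
    _ = e (-(1 / 4)) * e (τ / 8 + z / 2) *
        Complex.exp (-Real.pi * Complex.I * (z + τ / 2 + 1 / 2) ^ 2 / τ) * t * (R * (1 / R)) := by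
      rw [h3, mul_one_div_cancel hroot, mul_one]
    _ = _ := by ring

theorem nuS_ne_zero {τ : ℂ} (hτ : 0 < τ.im) : nuS τ ≠ 0 := by
  have hτ0 : τ ≠ 0 := fun h => by simp [h] at hτ
  simp [nuS, Complex.cpow_eq_zero_iff, hτ0]

theorem oddTheta_add_one (τ z : ℂ) : oddTheta (τ + 1) z = e (1 / 8) * oddTheta τ z := by
  rw [oddTheta, oddTheta, ← tsum_mul_left]
  congr 1; ext n
  rcases Int.even_or_odd n with h | h
  · simp [oddThetaTerm, chi4_even h]
  · obtain ⟨m, hm⟩ := odd_sq_sub_one h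
    have hm' : (n : ℂ) ^ 2 = 8 * m + 1 := by exact_mod_cast congrArg (Int.cast : ℤ → ℂ) hm
    rw [oddThetaTerm, oddThetaTerm, hm', mul_left_comm, ← e_add]
    congr 1
    exact e_eq_of_sub_int m (by ring)

/-- Shift n by 2l and complete the square: `chi4` contributes (-1)^l, and e(nm/2) = (-1)^m for odd
n. -/
theorem oddTheta_add_lattice (τ z : ℂ) (l m : ℤ) :
    oddTheta τ (z + l * τ + m) * e ((l : ℂ) ^ 2 / 2 * τ + l * z) = (-1) ^ (l + m) * oddTheta τ z := by
  rw [oddTheta, oddTheta, ← tsum_mul_left, ← tsum_mul_right,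
    ← (Equiv.addRight (2 * l)).tsum_eq (fun n => (-1) ^ (l + m) * oddThetaTerm τ z n)]
  congr 1; ext n
  rcases Int.even_or_odd n with h | h
  · simp [oddThetaTerm, chi4_even h, chi4_even (h.add (even_two_mul l))]
  · obtain ⟨j, rfl⟩ := h
    simp only [Equiv.coe_addRight, oddThetaTerm, chi4_add_two_mul, mul_assoc, ← e_add]
    rw [zpow_add₀ (by norm_num : (-1 : ℂ) ≠ 0)]
    rw [show (-1 : ℂ) ^ l * (-1) ^ m * ((-1) ^ l * (chi4 (2 * j + 1) *
      e (((2 * j + 1 + 2 * l : ℤ) : ℂ) ^ 2 / 8 * τ + ((2 * j + 1 + 2 * l : ℤ) : ℂ) / 2 * z))) =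
      ((-1 : ℂ) ^ l * (-1) ^ l) * (chi4 (2 * j + 1) * ((-1) ^ m *
      e (((2 * j + 1 + 2 * l : ℤ) : ℂ) ^ 2 / 8 * τ + ((2 * j + 1 + 2 * l : ℤ) : ℂ) / 2 * z))) by ring,
      neg_one_zpow_mul_self, one_mul, ← e_int_half, ← e_add]
    congr 1
    refine e_eq_of_sub_int (j * m) ?_
    push_cast; ring

theorem oddTheta_neg (τ z : ℂ) : oddTheta τ (-z) = -oddTheta τ z := by
  rw [oddTheta, oddTheta, ← tsum_neg, ← (Equiv.neg ℤ).tsum_eq (fun n => -oddThetaTerm τ z n)]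
  congr 1; ext n
  simp only [Equiv.neg_apply, oddThetaTerm, chi4_neg, neg_mul, neg_neg]
  congr 2; push_cast; ring

theorem differentiableAt_oddTheta {w : ℂ × ℂ} (hw : 0 < w.1.im) :
    DifferentiableAt ℂ (fun w : ℂ × ℂ => oddTheta w.1 w.2) w := by
  have hev : (fun w : ℂ × ℂ => oddTheta w.1 w.2) =ᶠ[nhds w] fun w =>
      e (w.1 / 8 + w.2 / 2) * jacobiTheta₂ (w.2 + w.1 / 2 + 1 / 2) w.1 := by
    have : IsOpen {w : ℂ × ℂ | 0 < w.1.im} :=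
      isOpen_lt continuous_const (Complex.continuous_im.comp continuous_fst)
    filter_upwards [this.mem_nhds hw] with v hv using oddTheta_eq_jacobiTheta₂ hv v.2
  refine DifferentiableAt.congr_of_eventuallyEq ?_ hev
  refine DifferentiableAt.mul ((differentiable_e _).comp w (by fun_prop)) ?_
  exact DifferentiableAt.comp (g := fun v : ℂ × ℂ => jacobiTheta₂ v.1 v.2)
    (f := fun w : ℂ × ℂ => (w.2 + w.1 / 2 + 1 / 2, w.1)) w
    (hasFDerivAt_jacobiTheta₂ _ hw).differentiableAt (by fun_prop)

/-! ### Uniqueness of Fourier expansions -/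

open UnitAddTorus in
theorem mFourier_coe {d : Type*} [Fintype d] (w : d → ℤ) (t : d → ℝ) :
    mFourier w (fun j => (t j : UnitAddCircle)) = e (∑ j, (w j : ℂ) * t j) := by
  rw [e_sum]
  simp only [mFourier, ContinuousMap.coe_mk]
  refine Finset.prod_congr rfl fun j _ => ?_
  rw [fourier_coe_apply, e]
  congr 1; push_cast; ring

open UnitAddTorus MeasureTheory in
/-- The coefficients of an absolutely convergent trigonometric series with vanishing sum vanish. -/
theorem fourier_coeff_eq_zero {ι d : Type*} [Fintype d] {w : ι → d → ℤ}
    (hw : Function.Injective w) {c : ι → ℂ} (hc : Summable c)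
    (h0 : ∀ t : d → ℝ, HasSum (fun i => c i * e (∑ j, (w i j : ℂ) * t j)) 0) : c = 0 := by
  -- Summable coefficients give convergence in the sup norm, so continuous functionals may be
  -- applied term by term.
  have hs : Summable (fun i => c i • mFourier (w i)) := by
    refine Summable.of_norm ?_
    simpa only [norm_smul, mFourier_norm, mul_one] using hc.norm
  obtain ⟨s, hs⟩ := hs
  have hs0 : s = 0 := by
    ext x
    obtain ⟨t, rfl⟩ : ∃ t : d → ℝ, x = fun j => (t j : UnitAddCircle) := by
      choose t ht using fun j => QuotientAddGroup.mk_surjective (x j)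
      exact ⟨t, funext fun j => (ht j).symm⟩
    have h1 := hs.mapL (ContinuousMap.evalCLM ℂ (fun j => (t j : UnitAddCircle)))
    have h2 := h0 t
    simp only [← mFourier_coe] at h2
    exact h1.unique h2
  subst hs0
  classical
  ext i
  have : IsProbabilityMeasure (@volume UnitAddCircle instMeasureSpaceUnitAddCircle) :=
    inferInstanceAs (IsProbabilityMeasure AddCircle.haarAddCircle)
  have : IsProbabilityMeasure (@volume (UnitAddTorus d)
      (@MeasureSpace.pi d _ (fun _ => UnitAddCircle) fun _ => instMeasureSpaceUnitAddCircle)) :=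
    inferInstanceAs (IsProbabilityMeasure (Measure.pi fun _ : d => AddCircle.haarAddCircle))
  -- L² pairing with the i-th monomial; orthonormality and the injectivity of `w` isolate c i.
  let L : C(UnitAddTorus d, ℂ) →L[ℂ] ℂ := (innerSL ℂ (mFourierLp 2 (w i))).comp
    (ContinuousMap.toLp (E := ℂ) 2 _ ℂ)
  have h1 := L.hasSum hs
  have horth := orthonormal_iff_ite.mp (orthonormal_mFourier (d := d))
  have h2 : HasSum (fun j => if j = i then c i else 0) 0 := by
    simp only [map_smul, map_zero] at h1
    refine h1.congr_fun fun j => ?_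
    change _ = c j • inner ℂ (mFourierLp 2 (w i)) (mFourierLp 2 (w j))
    rw [horth]
    by_cases hj : j = i
    · subst hj; simp
    · have : w i ≠ w j := fun h => hj (hw h).symm
      simp [hj, this]
  exact (hasSum_ite_eq i (c i)).unique h2

/-! ### Products of series -/

theorem hasSum_pi_prod {r : ℕ} {f : Fin r → ℤ → ℂ} {s : Fin r → ℂ}
    (h : ∀ i, HasSum (f i) (s i)) :
    HasSum (fun n : Fin r → ℤ => ∏ i, f i (n i)) (∏ i, s i) := by
  induction r with
  | zero => simp
  | succ r ih =>
    have h1 := ih fun i => h i.succ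
    have hsum := summable_mul_of_summable_norm (h 0).summable.norm h1.summable.norm
    have h2 := HasSum.mul (h 0) h1 hsum
    rw [← Fin.prod_univ_succ (fun i => s i)] at h2
    refine (Equiv.hasSum_iff (f := fun n : Fin (r + 1) → ℤ => ∏ i, f i (n i))
      (Fin.consEquiv fun _ : Fin (r + 1) => ℤ)).mp (h2.congr_fun fun p => ?_)
    simp [Fin.prod_univ_succ]

/-! ### The theta function of `D_r` -/

/-- The half-integral vector `n / 2`. -/
def half {r : ℕ} (n : Fin r → ℤ) : Fin r → ℚ := fun i => (n i : ℚ) / 2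

/-- The character `∏ (-4 / n_i)`. -/
def chiVec {r : ℕ} (n : Fin r → ℤ) : ℂ := ∏ i, chi4 (n i)

/-- The product of the odd theta functions in the variables `z_i`. -/
def prodTheta {r : ℕ} (τ : ℂ) (z : Fin r → ℂ) : ℂ := ∏ i, oddTheta τ (z i)

/-- The terms of `prodTheta`. -/
def prodThetaTerm {r : ℕ} (τ : ℂ) (z : Fin r → ℂ) (n : Fin r → ℤ) : ℂ :=
  chiVec n * e (τ * (qf (half n) : ℂ) + toC (half n) ⬝ᵥ z)

theorem half_injective {r : ℕ} : Function.Injective (half (r := r)) := fun a b h => by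
  ext i
  have := congrFun h i
  simp only [half] at this
  exact_mod_cast (div_left_inj' (by norm_num : (2 : ℚ) ≠ 0)).mp this

theorem half_neg {r : ℕ} (n : Fin r → ℤ) : half (-n) = -half n := by
  ext i; simp [half]; ring

theorem qf_half {r : ℕ} (n : Fin r → ℤ) : qf (half n) = ∑ i, (n i : ℚ) ^ 2 / 8 := by
  simp only [qf, dotProduct, half, Finset.sum_div]
  exact Finset.sum_congr rfl fun i _ => by ring

theorem qf_neg {r : ℕ} (x : Fin r → ℚ) : qf (-x) = qf x := by simp [qf]

theorem qf_add {r : ℕ} (x y : Fin r → ℚ) : qf (x + y) = qf x + x ⬝ᵥ y + qf y := by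
  simp only [qf, add_dotProduct, dotProduct_add, dotProduct_comm y x]; ring

theorem toC_neg {r : ℕ} (x : Fin r → ℚ) : toC (-x) = -toC x := by
  ext i; simp [toC]

theorem toC_add {r : ℕ} (x y : Fin r → ℚ) : toC (x + y) = toC x + toC y := by
  ext i; simp [toC]

theorem toC_dotProduct {r : ℕ} (x y : Fin r → ℚ) : toC x ⬝ᵥ toC y = ((x ⬝ᵥ y : ℚ) : ℂ) := by
  simp [toC, dotProduct]

theorem hasSum_prodTheta {r : ℕ} {τ : ℂ} (hτ : 0 < τ.im) (z : Fin r → ℂ) :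
    HasSum (prodThetaTerm τ z) (prodTheta τ z) := by
  refine (hasSum_pi_prod fun i => hasSum_oddTheta hτ (z i)).congr_fun fun n => ?_
  simp only [oddThetaTerm, Finset.prod_mul_distrib, ← e_sum, prodThetaTerm, chiVec, qf_half]
  congr 2
  rw [Finset.sum_add_distrib]
  congr 1
  · push_cast; rw [Finset.mul_sum]
    exact Finset.sum_congr rfl fun i _ => by ring
  · simp [toC, half, dotProduct]

theorem chiVec_neg {r : ℕ} (hr : Odd r) (n : Fin r → ℤ) : chiVec (-n) = -chiVec n := by
  simp only [chiVec, Pi.neg_apply, chi4_neg]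
  rw [Finset.prod_neg]; simp [hr.neg_one_pow]

theorem odd_of_chiVec_ne_zero {r : ℕ} {n : Fin r → ℤ} (h : chiVec n ≠ 0) (i : Fin r) :
    Odd (n i) :=
  odd_of_chi4_ne_zero fun h0 => h (Finset.prod_eq_zero (Finset.mem_univ i) h0)

theorem chiVec_two_mul_add_one {r : ℕ} (m : Fin r → ℤ) :
    chiVec (fun i => 2 * m i + 1) = (-1) ^ (∑ i, m i) := by
  simp only [chiVec, chi4_two_mul_add_one]
  induction (Finset.univ : Finset (Fin r)) using Finset.induction_on with
  | empty => simp
  | insert a s ha ih => rw [Finset.prod_insert ha, Finset.sum_insert ha, ih,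
      zpow_add₀ (by norm_num)]

theorem exists_of_odd {r : ℕ} {n : Fin r → ℤ} (h : ∀ i, Odd (n i)) :
    ∃ m : Fin r → ℤ, n = fun i => 2 * m i + 1 := by
  choose m hm using h
  exact ⟨m, funext hm⟩

theorem neg_one_zpow_eq_one_iff (m : ℤ) : (-1 : ℂ) ^ m = 1 ↔ Even m := by
  refine ⟨fun h => ?_, fun h => h.neg_one_zpow⟩
  by_contra h'
  rw [(Int.not_even_iff_odd.mp h').neg_one_zpow] at h
  norm_num at h

theorem half_two_mul_add_one {r : ℕ} (m : Fin r → ℤ) :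
    half (fun i => 2 * m i + 1) = v1 r + fun i => (m i : ℚ) := by
  ext i; simp [half, v1]; ring

/-- For n = 2m + 1 the character is (-1)^{∑ m_i}, while n/2 - v₁ = m lies in D_r exactly when ∑ m_i
is even. -/
theorem chiVec_eq_one_iff {r : ℕ} (n : Fin r → ℤ) :
    chiVec n = 1 ↔ ∃ y ∈ latticeD r, half n = v1 r + y := by
  constructor
  · intro h
    obtain ⟨m, rfl⟩ := exists_of_odd (n := n) fun i => odd_of_chiVec_ne_zero (by rw [h]; simp) i
    rw [chiVec_two_mul_add_one, neg_one_zpow_eq_one_iff] at h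
    exact ⟨fun i => m i, ⟨m, fun _ => rfl, h⟩, half_two_mul_add_one m⟩
  · rintro ⟨y, ⟨m, hm, hme⟩, hy⟩
    have : n = fun i => 2 * m i + 1 := by
      apply half_injective
      rw [hy, half_two_mul_add_one]
      ext i; simp [hm i]
    rw [this, chiVec_two_mul_add_one, hme.neg_one_zpow]

theorem chiVec_trichotomy {r : ℕ} (n : Fin r → ℤ) :
    chiVec n = 0 ∨ chiVec n = 1 ∨ chiVec n = -1 := by
  by_cases h : chiVec n = 0
  · exact Or.inl h
  obtain ⟨m, rfl⟩ := exists_of_odd (n := n) fun i => odd_of_chiVec_ne_zero h i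
  rw [chiVec_two_mul_add_one]
  rcases Int.even_or_odd (∑ i, m i) with h | h <;> simp [h.neg_one_zpow]

theorem hasSum_theta_iff {r : ℕ} (τ : ℍ) (z : Fin r → ℂ) (s : ℂ) :
    HasSum (fun y : latticeD r => e ((τ : ℂ) * (qf (v1 r + (y : Fin r → ℚ)) : ℂ)
      + toC (v1 r + (y : Fin r → ℚ)) ⬝ᵥ z)) s ↔
    HasSum (fun n : Fin r → ℤ => if chiVec n = 1 then
      e ((τ : ℂ) * (qf (half n) : ℂ) + toC (half n) ⬝ᵥ z) else 0) s := by
  classical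
  have hex : ∀ y : latticeD r, ∃ n : Fin r → ℤ, half n = v1 r + (y : Fin r → ℚ) := by
    rintro ⟨y, m, hm, -⟩
    refine ⟨fun i => 2 * m i + 1, ?_⟩
    rw [half_two_mul_add_one]; ext i; simp [hm i]
  choose g hg using hex
  have hinj : Function.Injective g := fun a b h => by
    have := (hg a).symm.trans ((congrArg half h).trans (hg b))
    exact Subtype.ext (add_left_cancel this)
  rw [← hinj.hasSum_iff]
  · refine iff_of_eq (congrArg (HasSum · s) ?_) 
    ext y
    rw [Function.comp_apply, if_pos ((chiVec_eq_one_iff _).mpr ⟨y, y.2, hg y⟩), hg]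
  · intro n hn
    refine if_neg fun h => hn ?_
    obtain ⟨y, hy, h⟩ := (chiVec_eq_one_iff n).mp h
    exact ⟨⟨y, hy⟩, half_injective ((hg _).trans h.symm)⟩

/-- Replacing z by -z replaces n by -n, which flips the character since r is odd. The two series
therefore supply the terms with character 1 and -1 of the expanded product of the ϑ(τ, z_i). -/
theorem theta_sub_theta_neg {r : ℕ} (hr : Odd r) (τ : ℍ) (z : Fin r → ℂ) :
    theta (latticeD r) (v1 r) τ z - theta (latticeD r) (v1 r) τ (-z) = prodTheta (τ : ℂ) z := by
  have hs : ∀ z : Fin r → ℂ, HasSum (fun n : Fin r → ℤ => if chiVec n = 1 then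
      e ((τ : ℂ) * (qf (half n) : ℂ) + toC (half n) ⬝ᵥ z) else 0)
      (theta (latticeD r) (v1 r) τ z) := by
    intro z
    refine (hasSum_theta_iff τ z _).mp (Summable.hasSum ?_)
    obtain ⟨s, hs⟩ : Summable (fun n : Fin r → ℤ => if chiVec n = 1 then
      e ((τ : ℂ) * (qf (half n) : ℂ) + toC (half n) ⬝ᵥ z) else 0) := by
      refine Summable.of_norm_bounded (hasSum_prodTheta τ.im_pos z).summable.norm fun n => ?_
      split_ifs with h
      · simp [prodThetaTerm, h]
      · simp
    exact ((hasSum_theta_iff τ z s).mpr hs).summable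
  have h2 := ((Equiv.neg (Fin r → ℤ)).hasSum_iff).mpr (hs (-z))
  refine ((hs z).sub h2).unique ((hasSum_prodTheta τ.im_pos z).congr_fun fun n => ?_)
  simp only [Function.comp_apply, Equiv.neg_apply, chiVec_neg hr, half_neg, toC_neg, qf_neg,
    neg_dotProduct_neg, prodThetaTerm]
  rcases chiVec_trichotomy n with h | h | h <;> norm_num [h]

/-! ### The dual lattice of `D_r` -/

theorem half_mem_dual_of_odd {r : ℕ} {n : Fin r → ℤ} (h : ∀ i, Odd (n i)) :
    half n ∈ dual (latticeD r) := by
  rintro y ⟨m, hm, l, hl⟩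
  obtain ⟨j, rfl⟩ := exists_of_odd h
  refine ⟨∑ i, j i * m i + l, ?_⟩
  have hl' : (∑ i, (m i : ℚ)) = l + l := by exact_mod_cast congrArg (Int.cast : ℤ → ℚ) hl
  rw [half_two_mul_add_one, add_dotProduct]
  simp only [dotProduct, v1, hm, ← Finset.mul_sum, hl']
  push_cast; ring

theorem dual_cases {r : ℕ} {x : Fin r → ℚ} (hx : x ∈ dual (latticeD r)) :
    (∃ n : Fin r → ℤ, x = half n ∧ ∀ i, Odd (n i)) ∨ ∃ n : Fin r → ℤ, x = fun i => (n i : ℚ) := by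
  have h1 : ∀ i, ∃ m : ℤ, 2 * x i = m := by
    intro i
    -- Pairing with 2e_i makes x half-integral; pairing with e_i + e_j below forces all doubled
    -- coordinates to have the same parity.
    obtain ⟨m, hm⟩ := hx (Pi.single i 2) ⟨Pi.single i 2, fun j => by
      by_cases h : j = i
      · subst h; simp
      · simp [h], by simp⟩
    exact ⟨m, by rw [← hm]; simp [mul_comm]⟩
  choose n hn using h1
  have hxn : x = half n := by ext i; simp only [half, ← hn]; ring
  by_cases hodd : ∀ i, Odd (n i)
  · exact Or.inl ⟨n, hxn, hodd⟩
  right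
  push Not at hodd
  obtain ⟨i, hi⟩ := hodd
  have hi := Int.not_odd_iff_even.mp hi
  have h2 : ∀ j, Even (n j) := by
    intro j
    by_cases hij : j = i
    · exact hij ▸ hi
    obtain ⟨m, hm⟩ := hx (Pi.single i 1 + Pi.single j 1)
      ⟨Pi.single i 1 + Pi.single j 1, fun l => by
        simp only [Pi.add_apply, Pi.single_apply]; push_cast; rfl, by
        simp [Finset.sum_add_distrib]⟩
    rw [dotProduct_add, dotProduct_single_one, dotProduct_single_one] at hm
    have : n i + n j = 2 * m := by
      have : (n i + n j : ℚ) = 2 * m := by rw [← hn, ← hn, ← hm]; ring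
      exact_mod_cast this
    rw [show n j = 2 * m - n i by rw [← this]; ring]
    exact (even_two_mul m).sub hi
  choose m hm using h2
  refine ⟨m, ?_⟩
  ext i
  rw [hxn, half, hm]; push_cast; ring

theorem exists_half_of_mem_dual {r : ℕ} {x : Fin r → ℚ} (hx : x ∈ dual (latticeD r)) :
    ∃ n : Fin r → ℤ, x = half n := by
  rcases dual_cases hx with ⟨n, rfl, -⟩ | ⟨n, rfl⟩
  · exact ⟨n, rfl⟩
  · exact ⟨fun i => 2 * n i, by ext i; simp [half]⟩

/-! ### Uniqueness of the coefficients of Jacobi forms -/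

/-- Restrict to τ = t₀ + i and z = 2t with t₀, t real. Since the dual lattice lies in ½ℤ^r, the
factor 2 makes all frequencies integral and injectively indexed, and uniqueness on the torus
applies. -/
theorem HasFourierExpansion.unique {r : ℕ} {φ : ℍ → (Fin r → ℂ) → ℂ}
    {c d : ℚ → (Fin r → ℚ) → ℂ} (hc : HasFourierExpansion (latticeD r) φ c)
    (hd : HasFourierExpansion (latticeD r) φ d) : c = d := by
  choose w hw using fun x : dual (latticeD r) => exists_half_of_mem_dual x.2
  let W : ℤ × dual (latticeD r) → Option (Fin r) → ℤ := fun q o => o.elim q.1 (w q.2)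
  have hW : Function.Injective W := by
    intro p q h
    refine Prod.ext (congrFun h none) (Subtype.ext ?_)
    rw [hw p.2, hw q.2]
    congr 1
    ext i
    exact congrFun h (some i)
  have key : (fun q : ℤ × dual (latticeD r) => (c (q.1 : ℚ) q.2 - d (q.1 : ℚ) q.2)
      * e ((q.1 : ℂ) * Complex.I)) = 0 := by
    refine fourier_coeff_eq_zero hW ?_ fun t => ?_
    · have := ((hc.hasSum UpperHalfPlane.I 0).sub (hd.hasSum UpperHalfPlane.I 0)).summable
      refine this.congr fun q => ?_
      simp [sub_mul]
    · have hτ : 0 < ((t none : ℂ) + Complex.I).im := by simp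
      have := (hc.hasSum ⟨_, hτ⟩ fun i => 2 * t (some i)).sub
        (hd.hasSum ⟨_, hτ⟩ fun i => 2 * t (some i))
      rw [sub_self] at this
      refine this.congr_fun fun q => ?_
      rw [← sub_mul, mul_assoc, ← e_add]
      congr 2
      rw [Fintype.sum_option]
      simp only [W, Option.elim, dotProduct, toC]
      rw [hw q.2]
      simp only [half]
      push_cast
      have hsum : ∑ j, (w q.2 j : ℂ) / 2 * (2 * (t (some j) : ℂ)) =
        ∑ j, (w q.2 j : ℂ) * (t (some j) : ℂ) := Finset.sum_congr rfl fun i _ => by ring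
      rw [hsum]
      ring
  ext m x
  by_cases h : (∃ l : ℤ, m = l) ∧ x ∈ dual (latticeD r)
  · obtain ⟨⟨l, rfl⟩, hx⟩ := h
    have := congrFun key (l, ⟨x, hx⟩)
    simpa [e_ne_zero, sub_eq_zero] using this
  · have h1 : c m x = 0 := by_contra fun h1 => h (hc.support m x h1)
    have h2 : d m x = 0 := by_contra fun h1 => h (hd.support m x h1)
    rw [h1, h2]

/-- `coeff` is an arbitrary choice of expansion; uniqueness lets any known expansion compute it. -/
theorem coeff_eq {r : ℕ} {φ : ℍ → (Fin r → ℂ) → ℂ}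
    {c : ℚ → (Fin r → ℚ) → ℂ} (hc : HasFourierExpansion (latticeD r) φ c) :
    coeff (latticeD r) φ = c := by
  have h : ∃ c, HasFourierExpansion (latticeD r) φ c := ⟨c, hc⟩
  rw [coeff, dif_pos h]
  exact h.choose_spec.unique hc

/-! ### Series in `q^{1/8}` -/

theorem qParam_eight_pow (τ : ℍ) (n : ℕ) :
    Function.Periodic.qParam 8 (τ : ℂ) ^ n = e ((n : ℂ) / 8 * τ) := by
  rw [Function.Periodic.qParam, ← Complex.exp_nat_mul, e]
  congr 1; push_cast; ring

theorem qSeries_coeff_eq_zero {a : ℕ → ℂ}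
    (h : ∀ τ : ℍ, HasSum (fun n : ℕ => a n * e ((n : ℂ) / 8 * τ)) 0) (n : ℕ) : a n = 0 := by
  have key : (fun n : ℕ => a n * e ((n : ℂ) * Complex.I)) = 0 := by
    refine fourier_coeff_eq_zero (w := fun (n : ℕ) (_ : Unit) => (n : ℤ))
      (c := fun n : ℕ => a n * e ((n : ℂ) * Complex.I))
      (fun a b h => by simpa using congrFun h ()) ?_ fun t => ?_
    · have hI : 0 < (8 * Complex.I).im := by simp
      refine (h ⟨_, hI⟩).summable.congr fun n => ?_
      congr 2
      change (n : ℂ) / 8 * (8 * Complex.I) = _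
      ring
    · have hI : 0 < (8 * ((t () : ℂ) + Complex.I)).im := by simp
      refine (h ⟨_, hI⟩).congr_fun fun n => ?_
      rw [mul_assoc, ← e_add]
      congr 2
      change _ = (n : ℂ) / 8 * (8 * ((t () : ℂ) + Complex.I))
      simp; ring
  have := congrFun key n
  simpa [e_ne_zero] using this

theorem qSeries_coeff_unique {a b : ℕ → ℂ} {f : ℍ → ℂ}
    (ha : ∀ τ : ℍ, HasSum (fun n : ℕ => a n * e ((n : ℂ) / 8 * τ)) (f τ))
    (hb : ∀ τ : ℍ, HasSum (fun n : ℕ => b n * e ((n : ℂ) / 8 * τ)) (f τ)) : a = b := by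
  ext n
  refine sub_eq_zero.mp (qSeries_coeff_eq_zero (a := fun n => a n - b n) (fun τ => ?_) n)
  have := (ha τ).sub (hb τ)
  rw [sub_self] at this
  exact this.congr_fun fun n => by ring

theorem isBoundedAtImInfty_of_hasSum {a : ℕ → ℂ} {f : ℍ → ℂ}
    (ha : ∀ τ : ℍ, HasSum (fun n : ℕ => a n * e ((n : ℂ) / 8 * τ)) (f τ)) :
    IsBoundedAtImInfty f := by
  refine isBoundedAtImInfty_of_hasSum_qExpansion (h := 8) (c := a) (by norm_num) fun τ => ?_
  simpa only [qParam_eight_pow, smul_eq_mul] using ha τ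

theorem differentiableOn_of_hasSum {a : ℕ → ℂ} {f : ℍ → ℂ}
    (ha : ∀ τ : ℍ, HasSum (fun n : ℕ => a n * e ((n : ℂ) / 8 * τ)) (f τ)) :
    DifferentiableOn ℂ (f ∘ ofComplex) {z | 0 < z.im} := by
  intro z hz
  have hz' : 0 < z.im := hz
  -- The series at the point i·Im(z)/2 dominates the series on the half plane Im w > Im(z)/2 around
  -- z.
  have hy : 0 < ((z.im / 2 : ℝ) * Complex.I).im := by simpa using hz'
  have hU : IsOpen {w : ℂ | z.im / 2 < w.im} := isOpen_lt continuous_const Complex.continuous_im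
  have hd : DifferentiableOn ℂ (fun w => ∑' n : ℕ, a n * e ((n : ℂ) / 8 * w))
      {w : ℂ | z.im / 2 < w.im} := by
    refine Complex.differentiableOn_tsum_of_summable_norm (ha ⟨_, hy⟩).summable.norm
      (fun n => ?_) hU fun n w hw => ?_
    · exact ((differentiable_e.comp (by fun_prop : Differentiable ℂ
        fun w : ℂ => (n : ℂ) / 8 * w)).const_mul (a n)).differentiableOn
    · rw [norm_mul, norm_mul, norm_e, norm_e]
      refine mul_le_mul_of_nonneg_left (Real.exp_le_exp.mpr ?_) (norm_nonneg _)
      have h1 : ((n : ℂ) / 8 * w).im = n / 8 * w.im := by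
        rw [show (n : ℂ) / 8 = ((n / 8 : ℝ) : ℂ) by push_cast; rfl, Complex.im_ofReal_mul]
      have h2 : ((n : ℂ) / 8 * ((z.im / 2 : ℝ) * Complex.I)).im = n / 8 * (z.im / 2) := by
        rw [show (n : ℂ) / 8 = ((n / 8 : ℝ) : ℂ) by push_cast; rfl, Complex.im_ofReal_mul]
        simp
      change -2 * Real.pi * ((n : ℂ) / 8 * w).im ≤
        -2 * Real.pi * ((n : ℂ) / 8 * ((z.im / 2 : ℝ) * Complex.I)).im
      rw [h1, h2, neg_mul, neg_mul, neg_mul, neg_le_neg_iff]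
      have hw' : z.im / 2 ≤ w.im := le_of_lt hw
      gcongr
  have hzU : z ∈ {w : ℂ | z.im / 2 < w.im} := by
    change z.im / 2 < z.im
    linarith
  refine DifferentiableAt.differentiableWithinAt ?_
  refine (hd.differentiableAt (hU.mem_nhds hzU)).congr_of_eventuallyEq ?_
  filter_upwards [(isOpen_lt continuous_const Complex.continuous_im).mem_nhds hz'] with w hw
  have hw : 0 < w.im := hw
  rw [Function.comp_apply, ofComplex_apply_of_im_pos hw]
  exact (ha ⟨w, hw⟩).tsum_eq.symm

/-! ### Functions dual to the theta function of `D_r` -/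

/-- Holomorphic functions on the upper half plane, bounded at infinity, whose product with
`prodTheta` in `r` variables transforms like a Jacobi form of weight `κ`. -/
structure IsThetaDual (r : ℕ) (κ : ℤ) (f : ℍ → ℂ) : Prop where
  holo : DifferentiableOn ℂ (f ∘ ofComplex) {z | 0 < z.im}
  map_T : ∀ τ : ℍ, f (ModularGroup.T • τ) = e (-(r : ℂ) / 8) * f τ
  map_S : ∀ τ : ℍ, f (ModularGroup.S • τ) * nuS τ ^ r = (τ : ℂ) ^ κ * f τ
  bdd : IsBoundedAtImInfty f

theorem coe_T_smul (τ : ℍ) : ((ModularGroup.T • τ : ℍ) : ℂ) = τ + 1 := by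
  rw [modular_T_smul, coe_vadd, add_comm]; simp

theorem coe_S_smul (τ : ℍ) : ((ModularGroup.S • τ : ℍ) : ℂ) = -1 / τ := by
  rw [modular_S_smul]
  change (-(τ : ℂ))⁻¹ = _
  rw [inv_neg, neg_div, one_div]

theorem denom_T (τ : ℍ) : denom ModularGroup.T τ = 1 := by
  rw [ModularGroup.denom_apply]; simp [ModularGroup.T]

theorem map_vadd_nat {f : ℍ → ℂ} {c : ℂ} (h : ∀ τ : ℍ, f (ModularGroup.T • τ) = c * f τ)
    (n : ℕ) (τ : ℍ) : f ((n : ℝ) +ᵥ τ) = c ^ n * f τ := by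
  induction n with
  | zero => simp
  | succ n ih =>
    rw [show ((n + 1 : ℕ) : ℝ) = 1 + n by push_cast; ring, add_vadd, ← modular_T_smul, h, ih]
    ring

theorem IsThetaDual.map_add_eight {r : ℕ} {κ : ℤ} {f : ℍ → ℂ} (hf : IsThetaDual r κ f) (τ : ℍ) :
    f ((8 : ℝ) +ᵥ τ) = f τ := by
  have := map_vadd_nat hf.map_T 8 τ
  rw [← e_nat_mul] at this
  rw [show ((8 : ℕ) : ℂ) * (-(r : ℂ) / 8) = ((-r : ℤ) : ℂ) by push_cast; ring, e_int, one_mul]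
    at this
  exact_mod_cast this

theorem IsThetaDual.periodic {r : ℕ} {κ : ℤ} {f : ℍ → ℂ} (hf : IsThetaDual r κ f) :
    Function.Periodic (f ∘ ofComplex) (8 : ℝ) := by
  intro w
  by_cases! hw : 0 < w.im
  · have h8 : 0 < (w + (8 : ℝ)).im := by simpa using hw
    simp only [Function.comp_apply, ofComplex_apply_of_im_pos h8, ofComplex_apply_of_im_pos hw]
    rw [← hf.map_add_eight ⟨w, hw⟩]
    congr 1
    ext
    simp [add_comm]
  · have h8 : (w + (8 : ℝ)).im ≤ 0 := by simpa using hw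
    rw [Function.comp_apply, Function.comp_apply, ofComplex_apply_of_im_nonpos h8,
      ofComplex_apply_of_im_nonpos hw]

theorem IsThetaDual.hasSum {r : ℕ} {κ : ℤ} {f : ℍ → ℂ} (hf : IsThetaDual r κ f) (τ : ℍ) :
    HasSum (fun n : ℕ => coeff8 f n * e ((n : ℂ) / 8 * τ)) (f τ) := by
  have := hasSum_qExpansion (h := 8) (by norm_num) hf.periodic
    (UpperHalfPlane.mdifferentiable_iff.mpr hf.holo) hf.bdd τ
  simpa only [qParam_eight_pow, smul_eq_mul, coeff8] using this

theorem dvd_of_e_eq {n r : ℕ} (h : e ((n : ℂ) / 8) = e (-(r : ℂ) / 8)) : 8 ∣ n + r := by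
  have h1 : e (((n + r : ℕ) : ℂ) / 8) = 1 := by
    rw [show ((n + r : ℕ) : ℂ) / 8 = n / 8 + r / 8 by push_cast; ring, e_add, h, ← e_add]
    rw [show -(r : ℂ) / 8 + r / 8 = 0 by ring, e_zero]
  rw [e, Complex.exp_eq_one_iff] at h1
  obtain ⟨m, hm⟩ := h1
  have hpi : (2 * Real.pi * Complex.I : ℂ) ≠ 0 := by simp [Real.pi_ne_zero]
  have h2 : ((n + r : ℕ) : ℂ) = 8 * m := by
    have : (2 * Real.pi * Complex.I : ℂ) * (((n + r : ℕ) : ℂ) / 8) =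
      (2 * Real.pi * Complex.I : ℂ) * m := by rw [hm]; ring
    have := mul_left_cancel₀ hpi this
    rw [← this]; ring
  have h3 : ((n + r : ℕ) : ℤ) = 8 * m := by exact_mod_cast h2
  omega

/-- Compare the q^{1/8}-expansions of both sides of the T-law: T multiplies the n-th coefficient by
e(n/8), which must equal e(-r/8). -/
theorem IsThetaDual.dvd_of_coeff8_ne_zero {r : ℕ} {κ : ℤ} {f : ℍ → ℂ} (hf : IsThetaDual r κ f)
    {n : ℕ} (hn : coeff8 f n ≠ 0) : 8 ∣ n + r := by
  have h1 : (fun n : ℕ => coeff8 f n * e ((n : ℂ) / 8)) =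
      fun n : ℕ => e (-(r : ℂ) / 8) * coeff8 f n := by
    refine qSeries_coeff_unique (f := fun τ => f (ModularGroup.T • τ)) (fun τ => ?_) fun τ => ?_
    · refine (hf.hasSum (ModularGroup.T • τ)).congr_fun fun n => ?_
      rw [mul_assoc, ← e_add, coe_T_smul]
      congr 2; ring
    · rw [hf.map_T]
      exact ((hf.hasSum τ).mul_left _).congr_fun fun n => by ring
  have h2 := congrFun h1 n
  simp only [mul_comm (coeff8 f n)] at h2
  exact dvd_of_e_eq (mul_right_cancel₀ hn h2)

/-! ### Comparison of the theta multiplier with powers of η. -/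

theorem nuS_eq_eta {τ : ℂ} (hτ : 0 < τ.im) :
    ModularForm.eta (-1 / τ) ^ 3 = nuS τ * τ * ModularForm.eta τ ^ 3 := by
  have hτ0 : τ ≠ 0 := fun h => by simp [h] at hτ
  have h1 : ModularForm.eta (-1 / τ) = (Complex.sqrt Complex.I)⁻¹ *
    (Complex.sqrt τ * ModularForm.eta τ) := ModularForm.eta_comp_eq_csqrt_I_inv hτ
  have h2 : Complex.sqrt τ = Complex.sqrt Complex.I * (-Complex.I * τ) ^ (1 / 2 : ℂ) := by
    have hx : (-Complex.I * τ) ≠ 0 := by simp [hτ0]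
    have hre : 0 < (-Complex.I * τ).re := by simpa using hτ
    have harg := Complex.abs_arg_lt_pi_div_two_iff.mpr (Or.inl hre)
    rw [abs_lt] at harg
    -- The principal branches match: -iτ has positive real part, so its argument plus π/2 stays in
    -- (-π, π].
    have hlog : Complex.log τ = Complex.log Complex.I + Complex.log (-Complex.I * τ) := by
      rw [← Complex.log_mul Complex.I_ne_zero hx]
      · congr 1; rw [← mul_assoc]; simp
      · rw [Complex.arg_I]; constructor <;> linarith [Real.pi_pos]
    rw [Complex.sqrt, Complex.sqrt, Complex.cpow_def_of_ne_zero hτ0,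
      Complex.cpow_def_of_ne_zero Complex.I_ne_zero, Complex.cpow_def_of_ne_zero hx,
      ← Complex.exp_add, hlog]
    congr 1; ring
  have h3 : ((-Complex.I * τ) ^ (1 / 2 : ℂ)) ^ 2 = -Complex.I * τ := by
    rw [← Complex.cpow_nat_mul]; norm_num
  have h4 : Complex.sqrt Complex.I ≠ 0 := by simp [Complex.sqrt, Complex.cpow_eq_zero_iff]
  rw [h1, h2, nuS]
  generalize (-Complex.I * τ) ^ (1 / 2 : ℂ) = R at h3 ⊢
  rw [show (Complex.sqrt Complex.I)⁻¹ * (Complex.sqrt Complex.I * R * ModularForm.eta τ) =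
    R * ModularForm.eta τ by field_simp]
  linear_combination R * ModularForm.eta τ ^ 3 * h3

theorem eta_add_one (τ : ℂ) : ModularForm.eta (τ + 1) = e (1 / 24) * ModularForm.eta τ := by
  have h1 : Function.Periodic.qParam 1 (τ + 1) = Function.Periodic.qParam 1 τ := by
    rw [Function.Periodic.qParam, Function.Periodic.qParam, Complex.ofReal_one, div_one, div_one,
      mul_add, mul_one, Complex.exp_periodic]
  have h2 : Function.Periodic.qParam 24 (τ + 1) = e (1 / 24) * Function.Periodic.qParam 24 τ := by
    rw [Function.Periodic.qParam, Function.Periodic.qParam, e, ← Complex.exp_add]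
    congr 1; push_cast; ring
  simp only [ModularForm.eta, ModularForm.eta_q, h1, h2]
  ring

theorem isBoundedAtImInfty_eta_pow (s : ℕ) :
    IsBoundedAtImInfty fun τ : ℍ => ModularForm.eta τ ^ s := by
  obtain ⟨A, hA⟩ := isZeroAtImInfty_iff.mp ModularForm.discriminant_isZeroAtImInfty 1 one_pos
  refine isBoundedAtImInfty_iff.mpr ⟨1, A, fun τ hτ => ?_⟩
  have := hA τ hτ
  rw [ModularForm.discriminant, norm_pow] at this
  rw [norm_pow]
  exact pow_le_one₀ (norm_nonneg _) ((pow_le_one_iff_of_nonneg (norm_nonneg _) (by norm_num)).mp this)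

/-- Algebra of η^{3(8-r)} · η^{3r} = Δ, with a = η(-1/τ), b = η(τ), x = ν_S(τ): the factor x^r of
ϑ^r cancels against that of η^{3(8-r)}, leaving weight κ = w + 12 - r. -/
theorem weight_identity {r : ℕ} (hr8 : r < 8) {κ w : ℤ} (hw : w = κ + r - 12) {τ a b x g y : ℂ}
    (hτ : τ ≠ 0) (hb : b ≠ 0) (hx : a ^ 3 = x * τ * b ^ 3)
    (hx8 : a ^ 24 = τ ^ 12 * b ^ 24) (hg : y = τ ^ w * g) :
    a ^ (3 * (8 - r)) * y * x ^ r = τ ^ κ * (b ^ (3 * (8 - r)) * g) := by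
  have h24 : 24 = 3 * (8 - r) + 3 * r := by omega
  have h1 : a ^ (3 * (8 - r)) * x ^ r * (τ ^ r * b ^ (3 * r)) =
      τ ^ 12 * b ^ (3 * (8 - r)) * b ^ (3 * r) := by
    rw [mul_assoc (τ ^ 12), ← pow_add b, ← h24, ← hx8, h24, pow_add a, pow_mul a 3 r, hx]
    ring
  have hb' : b ^ (3 * r) ≠ 0 := pow_ne_zero _ hb
  have h2 : τ ^ κ * τ ^ r = τ ^ w * τ ^ 12 := by
    rw [← zpow_natCast τ r, ← zpow_natCast τ 12, ← zpow_add₀ hτ, ← zpow_add₀ hτ, hw]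
    congr 1; push_cast; ring
  refine mul_right_cancel₀ (mul_ne_zero (pow_ne_zero r hτ) hb') ?_
  rw [hg]
  linear_combination τ ^ w * g * h1 - b ^ (3 * (8 - r)) * g * b ^ (3 * r) * h2

theorem eta_twentyfour_S (τ : ℍ) :
    ModularForm.eta (-1 / τ) ^ 24 = (τ : ℂ) ^ 12 * ModularForm.eta τ ^ 24 := by
  have h3 : nuS τ ^ 8 = (τ : ℂ) ^ 4 := by
    have : ((-Complex.I * τ) ^ (1 / 2 : ℂ)) ^ 2 = -Complex.I * τ := by
      rw [← Complex.cpow_nat_mul]; norm_num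
    rw [nuS, mul_pow, show ((-Complex.I * τ : ℂ) ^ (1 / 2 : ℂ)) ^ 8 =
      (((-Complex.I * τ) ^ (1 / 2 : ℂ)) ^ 2) ^ 4 by ring, this]
    simp only [neg_mul, mul_pow, Even.neg_pow (by decide : Even 8), Even.neg_pow (by decide : Even 4)]
    rw [show Complex.I ^ 8 = (Complex.I ^ 4) ^ 2 by ring, Complex.I_pow_four]; ring
  have := congrArg (· ^ 8) (nuS_eq_eta τ.im_pos)
  simp only [mul_pow, h3, ← pow_mul] at this
  rw [this]; ring

theorem eta_pow_add_one {r : ℕ} (hr8 : r < 8) (τ : ℂ) : ModularForm.eta (τ + 1) ^ (3 * (8 - r)) =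
    e (-(r : ℂ) / 8) * ModularForm.eta τ ^ (3 * (8 - r)) := by
  rw [eta_add_one, mul_pow, ← e_nat_mul]
  congr 1
  refine e_eq_of_sub_int 1 ?_
  rw [Nat.cast_mul, Nat.cast_sub hr8.le]
  push_cast; ring

theorem isThetaDual_of_mem {r : ℕ} (hr8 : r < 8) {κ w : ℤ} (hw : w = κ + r - 12) {f : ℍ → ℂ}
    (hf : f ∈ etaModularForms (3 * (8 - r)) w) : IsThetaDual r κ f := by
  obtain ⟨g, hg⟩ := hf
  have hfg : f = fun τ : ℍ => ModularForm.eta τ ^ (3 * (8 - r)) * g τ := funext hg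
  have hmod : ∀ (γ : Matrix.SpecialLinearGroup (Fin 2) ℤ) (τ : ℍ),
      g (γ • τ) = (denom γ τ) ^ w * g τ := fun γ τ =>
    SlashInvariantForm.slash_action_eqn_SL'' g (CongruenceSubgroup.mem_Gamma_one γ) τ
  refine ⟨?_, fun τ => ?_, fun τ => ?_, ?_⟩
  · have hgd := UpperHalfPlane.mdifferentiable_iff.mp (ModularFormClass.holo g)
    refine DifferentiableOn.congr (f := fun z => ModularForm.eta z ^ (3 * (8 - r)) *
      (g ∘ ofComplex) z) (DifferentiableOn.mul (fun z hz => ?_) hgd) fun z hz => ?_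
    · exact ((ModularForm.differentiableAt_eta_of_mem_upperHalfPlaneSet hz).pow
        _).differentiableWithinAt
    · rw [hfg]
      simp [ofComplex_apply_of_im_pos hz]
  · rw [hfg]
    simp only [coe_T_smul, eta_pow_add_one hr8, hmod, denom_T, one_zpow]
    ring
  · rw [hfg]
    simp only [coe_S_smul]
    exact weight_identity hr8 hw τ.ne_zero (ModularForm.eta_ne_zero τ.im_pos)
      (nuS_eq_eta τ.im_pos) (eta_twentyfour_S τ) (by rw [hmod, ModularGroup.denom_S])
  · rw [hfg]
    exact (isBoundedAtImInfty_eta_pow _).mul (ModularFormClass.bdd_at_infty g)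

/-- A function with a `q^{1/8}`-expansion of order at least `N` is bounded by `η^{3N}`. -/
theorem isBoundedAtImInfty_div_eta {a : ℕ → ℂ} {f : ℍ → ℂ} {N : ℕ}
    (ha : ∀ τ : ℍ, HasSum (fun n : ℕ => a n * e ((n : ℂ) / 8 * τ)) (f τ))
    (hN : ∀ n < N, a n = 0) :
    IsBoundedAtImInfty fun τ : ℍ => f τ / ModularForm.eta τ ^ (3 * N) := by
  have h1 : IsBoundedAtImInfty fun τ : ℍ => f τ * e (-((N : ℂ) / 8 * τ)) := by
    refine isBoundedAtImInfty_of_hasSum (a := fun n => a (n + N)) fun τ => ?_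
    have := (hasSum_nat_add_iff' N).mpr ((ha τ).mul_right (e (-((N : ℂ) / 8 * τ))))
    rw [Finset.sum_eq_zero fun n hn => by rw [hN n (Finset.mem_range.mp hn)]; simp, sub_zero] at this
    refine this.congr_fun fun n => ?_
    rw [mul_assoc, ← e_add]
    congr 2; push_cast; ring
  obtain ⟨C, hC⟩ := Asymptotics.isBigO_iff.mp ModularForm.exp_isBigO_discriminant
  have h2 : (fun τ : ℍ => e ((N : ℂ) / 8 * τ)) =O[atImInfty]
      fun τ : ℍ => ModularForm.eta τ ^ (3 * N) := by
    refine Asymptotics.IsBigO.of_bound (max 1 C ^ N) ?_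
    filter_upwards [hC] with τ hτ
    have hM : (1 : ℝ) ≤ max 1 C := le_max_left _ _
    have hτ' : ‖e τ‖ ≤ max 1 C * ‖ModularForm.eta τ‖ ^ 24 := by
      rw [norm_e]
      refine (le_abs_self _).trans (hτ.trans ?_)
      rw [ModularForm.discriminant, norm_pow]
      gcongr
      exact le_max_right _ _
    -- Eighth powers turn q^{N/8} and η^{3N} into q^N and Δ^N. The constant is enlarged to `max 1 C`
    -- so that it does not exceed its own powers.
    refine le_of_pow_le_pow_left₀ (n := 8) (by norm_num) (by positivity) ?_
    calc ‖e ((N : ℂ) / 8 * τ)‖ ^ 8 = ‖e τ‖ ^ N := by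
          rw [← norm_pow, ← norm_pow, ← e_nat_mul, ← e_nat_mul]
          congr 2; push_cast; ring
      _ ≤ (max 1 C * ‖ModularForm.eta τ‖ ^ 24) ^ N := by gcongr
      _ = max 1 C ^ N * ‖ModularForm.eta τ‖ ^ (24 * N) := by rw [mul_pow, ← pow_mul]
      _ ≤ (max 1 C ^ N) ^ 8 * ‖ModularForm.eta τ‖ ^ (24 * N) := by
          gcongr
          exact le_self_pow₀ (one_le_pow₀ hM) (by norm_num)
      _ = _ := by rw [norm_pow]; ring
  have h1' : (fun τ : ℍ => f τ * e (-((N : ℂ) / 8 * τ))) =O[atImInfty] fun _ => (1 : ℂ) :=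
    h1.trans (Asymptotics.IsBigO.of_bound 1 (by simp))
  have h3 := (Asymptotics.IsBigO.mul h1' h2).mul
    (Asymptotics.isBigO_refl (fun τ : ℍ => (ModularForm.eta τ ^ (3 * N))⁻¹) atImInfty)
  refine (h3.congr_left fun τ => ?_).trans (Asymptotics.IsBigO.of_bound 1 ?_)
  · rw [e_neg, inv_mul_cancel_right₀ (e_ne_zero _), div_eq_mul_inv]
  · refine Filter.Eventually.of_forall fun τ => ?_
    have : ModularForm.eta (τ : ℂ) ≠ 0 := ModularForm.eta_ne_zero τ.im_pos
    simp [this]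

/-- The quotient by η^{3(8-r)} is invariant under S and T, hence under SL(2, ℤ). It is holomorphic
because η has no zeros, and bounded because f vanishes to at least the order of the denominator. -/
theorem IsThetaDual.mem {r : ℕ} (hr0 : 0 < r) (hr8 : r < 8) {κ w : ℤ} (hw : w = κ + r - 12) {f : ℍ → ℂ}
    (hf : IsThetaDual r κ f) : f ∈ etaModularForms (3 * (8 - r)) w := by
  have hη : ∀ τ : ℍ, ModularForm.eta (τ : ℂ) ≠ 0 := fun τ => ModularForm.eta_ne_zero τ.im_pos
  let g : ℍ → ℂ := fun τ => f τ / ModularForm.eta τ ^ (3 * (8 - r))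
  have hT : SlashAction.map w ModularGroup.T g = g := by
    ext τ
    rw [ModularForm.SL_slash_apply, denom_T, one_zpow, mul_one]
    simp only [g, coe_T_smul, eta_pow_add_one hr8, hf.map_T]
    rw [mul_div_mul_left _ _ (e_ne_zero _)]
  have hS : SlashAction.map w ModularGroup.S g = g := by
    ext τ
    rw [ModularForm.SL_slash_apply, ModularGroup.denom_S]
    have h1 := hf.map_S τ
    have hτ := τ.ne_zero
    have hν := nuS_ne_zero τ.im_pos
    have h2 := weight_identity hr8 hw hτ (hη τ) (nuS_eq_eta τ.im_pos) (eta_twentyfour_S τ)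
      (g := g τ) rfl
    have h3 : ModularForm.eta τ ^ (3 * (8 - r)) * g τ = f τ := mul_div_cancel₀ _ (pow_ne_zero _ (hη τ))
    rw [h3, ← h1] at h2
    have h4 := mul_right_cancel₀ (pow_ne_zero r hν) h2
    simp only [g]
    rw [← h4, coe_S_smul, mul_div_cancel_left₀, mul_comm, ← mul_assoc, ← zpow_add₀ hτ]
    · simp [g]
    · rw [← coe_S_smul]
      exact pow_ne_zero _ (hη _)
  have hinv := SlashInvariantForm.slash_action_generators_SL2Z hS hT
  have hbdd : IsBoundedAtImInfty g := by
    -- For n < 8 - r one has 0 < n + r < 8, so 8 cannot divide n + r and the n-th coefficient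
    -- vanishes.
    refine isBoundedAtImInfty_div_eta hf.hasSum fun n hn => ?_
    by_contra h
    have := hf.dvd_of_coeff8_ne_zero h
    omega
  refine ⟨{ toFun := g, slash_action_eq' := ?_, holo' := ?_, bdd_at_cusps' := ?_ }, fun τ => ?_⟩
  · rintro A ⟨A, -, rfl⟩
    exact hinv A
  · refine UpperHalfPlane.mdifferentiable_iff.mpr ?_
    refine DifferentiableOn.congr (f := fun z => (f ∘ ofComplex) z /
      ModularForm.eta z ^ (3 * (8 - r)))
      (hf.holo.div (fun z hz => ?_) fun z hz => ?_) fun z hz => ?_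
    · exact ((ModularForm.differentiableAt_eta_of_mem_upperHalfPlaneSet hz).pow
        _).differentiableWithinAt
    · exact pow_ne_zero _ (ModularForm.eta_ne_zero hz)
    · change g (ofComplex z) = _
      simp [g, ofComplex_apply_of_im_pos hz]
  · intro c hc
    rw [Subgroup.IsArithmetic.isCusp_iff_isCusp_SL2Z] at hc
    rw [OnePoint.isBoundedAt_iff_forall_SL2Z hc]
    intro γ _
    rw [hinv]
    exact hbdd
  · exact (mul_div_cancel₀ _ (pow_ne_zero _ (hη τ))).symm

/-! ### Automorphy factors -/

open scoped MatrixGroups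

/-- The factor of automorphy `c τ + d`. -/
def aut (γ : SL(2, ℤ)) (τ : ℂ) : ℂ := ((γ 1 0 : ℤ) : ℂ) * τ + ((γ 1 1 : ℤ) : ℂ)

/-- The exponential factor `e(-c z² / (2 (c τ + d)))`. -/
def autExp (γ : SL(2, ℤ)) (τ z : ℂ) : ℂ := e (-((γ 1 0 : ℤ) : ℂ) * z ^ 2 / (2 * aut γ τ))

theorem aut_ne_zero (γ : SL(2, ℤ)) (τ : ℍ) : aut γ τ ≠ 0 := denom_ne_zero γ τ

theorem coe_smul_eq (γ : SL(2, ℤ)) (τ : ℍ) :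
    ((γ • τ : ℍ) : ℂ) = (((γ 0 0 : ℤ) : ℂ) * τ + ((γ 0 1 : ℤ) : ℂ)) / aut γ τ := by
  rw [coe_specialLinearGroup_apply]; simp [aut]

theorem aut_mul (γ δ : SL(2, ℤ)) (τ : ℍ) :
    aut (γ * δ) τ = aut γ (δ • τ : ℍ) * aut δ τ := by
  have h := aut_ne_zero δ τ
  rw [aut, aut, coe_smul_eq, add_mul, mul_assoc, div_mul_cancel₀ _ h]
  simp only [aut, Matrix.SpecialLinearGroup.coe_mul, Matrix.mul_apply, Fin.sum_univ_two]
  push_cast; ring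

/-- Cocycle relation for the exponential factor. It comes down to an identity between the lower rows
of γ, δ and γδ that uses det δ = 1. -/
theorem autExp_mul (γ δ : SL(2, ℤ)) (τ : ℍ) (z : ℂ) :
    autExp (γ * δ) τ z = autExp γ (δ • τ : ℍ) (z / aut δ τ) * autExp δ τ z := by
  rw [autExp, autExp, autExp, ← e_add, aut_mul]
  congr 1
  have h1 := aut_ne_zero δ τ
  have h2 := aut_ne_zero γ (δ • τ)
  have hdet : ((δ 0 0 : ℤ) : ℂ) * ((δ 1 1 : ℤ) : ℂ) - ((δ 0 1 : ℤ) : ℂ) * ((δ 1 0 : ℤ) : ℂ) = 1 := by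
    have := δ.det_coe
    rw [Matrix.det_fin_two] at this
    exact_mod_cast this
  have key : (((γ * δ) 1 0 : ℤ) : ℂ) * aut δ τ = ((γ 1 0 : ℤ) : ℂ) +
      ((δ 1 0 : ℤ) : ℂ) * (aut γ (δ • τ : ℍ) * aut δ τ) := by
    rw [← aut_mul]
    simp only [aut, Matrix.SpecialLinearGroup.coe_mul, Matrix.mul_apply, Fin.sum_univ_two]
    push_cast
    linear_combination ((γ 1 0 : ℤ) : ℂ) * hdet
  field_simp
  linear_combination -z ^ 2 * key

/-- Under every element of `SL(2, ℤ)` the odd theta function is multiplied by an automorphy factor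
whose `r`-th power cancels the one of a theta dual function. -/
theorem IsThetaDual.exists_factor {r : ℕ} {κ : ℤ} {f : ℍ → ℂ} (hf : IsThetaDual r κ f)
    (γ : SL(2, ℤ)) : ∃ ν : ℍ → ℂ, ∀ τ : ℍ, ν τ ≠ 0 ∧
      (∀ z, oddTheta (γ • τ : ℍ) (z / aut γ τ) * autExp γ τ z = ν τ * oddTheta τ z) ∧
      f (γ • τ) * ν τ ^ r = aut γ τ ^ κ * f τ := by
  have hγ : γ ∈ Subgroup.closure {ModularGroup.S, ModularGroup.T} := by
    rw [SpecialLinearGroup.SL2Z_generators]; trivial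
  -- One ν serves both laws: S and T supply it, and products and inverses preserve the pair by the
  -- cocycle relations.
  induction hγ using Subgroup.closure_induction with
  | mem γ h =>
    rcases h with rfl | rfl
    · refine ⟨fun τ => nuS τ, fun τ => ⟨nuS_ne_zero τ.im_pos, fun z => ?_, ?_⟩⟩
      · rw [coe_S_smul, ← oddTheta_S τ.im_pos]
        simp [autExp, aut, ModularGroup.S]
      · rw [hf.map_S]; simp [aut, ModularGroup.S]
    · refine ⟨fun _ => e (1 / 8), fun τ => ⟨e_ne_zero _, fun z => ?_, ?_⟩⟩
      · rw [coe_T_smul, ← oddTheta_add_one]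
        simp [autExp, aut, ModularGroup.T, e_zero]
      · rw [hf.map_T, ← e_nat_mul, mul_right_comm, ← e_add]
        rw [show -(r : ℂ) / 8 + r * (1 / 8) = 0 by ring, e_zero]
        simp [aut, ModularGroup.T]
  | one => exact ⟨fun _ => 1, fun τ => ⟨one_ne_zero, fun z => by simp [aut, autExp, e_zero],
      by simp [aut]⟩⟩
  | mul γ δ _ _ hγ hδ =>
    obtain ⟨ν, hν⟩ := hγ
    obtain ⟨μ, hμ⟩ := hδ
    refine ⟨fun τ => ν (δ • τ) * μ τ, fun τ => ⟨mul_ne_zero (hν _).1 (hμ _).1, fun z => ?_, ?_⟩⟩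
    · rw [mul_smul, autExp_mul, aut_mul, mul_comm (aut γ _), ← div_div, ← mul_assoc,
        (hν (δ • τ)).2.1, mul_assoc, (hμ τ).2.1, mul_assoc]
    · rw [mul_smul, mul_pow, ← mul_assoc, (hν (δ • τ)).2.2, mul_assoc, (hμ τ).2.2, aut_mul,
        mul_zpow, mul_assoc]
  | inv γ _ hγ =>
    obtain ⟨ν, hν⟩ := hγ
    refine ⟨fun τ => (ν (γ⁻¹ • τ))⁻¹, fun τ => ⟨inv_ne_zero (hν _).1, fun z => ?_, ?_⟩⟩
    · obtain ⟨h0, h1, -⟩ := hν (γ⁻¹ • τ)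
      have h2 := h1 (z / aut γ⁻¹ τ)
      have h3 := autExp_mul γ γ⁻¹ τ z
      have h4 := aut_mul γ γ⁻¹ τ
      rw [mul_inv_cancel] at h3 h4
      have h5 : (1 : ℂ) = aut γ⁻¹ τ * aut γ (γ⁻¹ • τ : ℍ) := by
        rw [mul_comm, ← h4]; simp [aut]
      have h6 : autExp 1 τ z = 1 := by simp [autExp, e_zero]
      rw [smul_inv_smul, div_div, ← h5, div_one] at h2
      rw [h6] at h3
      field_simp
      linear_combination (-(oddTheta τ z)) * h3 - autExp γ⁻¹ τ z * h2
    · obtain ⟨h0, -, h1⟩ := hν (γ⁻¹ • τ)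
      have h4 := aut_mul γ γ⁻¹ τ
      rw [mul_inv_cancel] at h4
      have h5 : aut γ (γ⁻¹ • τ : ℍ) * aut γ⁻¹ τ = 1 := by rw [← h4]; simp [aut]
      rw [smul_inv_smul] at h1
      have h6 : aut γ (γ⁻¹ • τ : ℍ) ^ κ * aut γ⁻¹ τ ^ κ = 1 := by rw [← mul_zpow, h5, one_zpow]
      have h7 := pow_ne_zero r h0
      rw [inv_pow]
      field_simp
      linear_combination (-f (γ⁻¹ • τ)) * h6 - aut γ⁻¹ τ ^ κ * h1

/-- As a trigonometric series in z it has a nonzero coefficient at n = 1. This permits cancelling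
theta factors pointwise in τ. -/
theorem exists_oddTheta_ne_zero (τ : ℍ) : ∃ z, oddTheta τ z ≠ 0 := by
  by_contra! h
  have key : (fun n : ℤ => chi4 n * e ((n : ℂ) ^ 2 / 8 * τ)) = 0 := by
    refine fourier_coeff_eq_zero (w := fun (n : ℤ) (_ : Unit) => n)
      (c := fun n : ℤ => chi4 n * e ((n : ℂ) ^ 2 / 8 * τ))
      (fun a b h => by simpa using congrFun h ()) ?_ fun t => ?_
    · refine (summable_oddThetaTerm τ.im_pos 0).congr fun n => ?_
      simp [oddThetaTerm]
    · rw [← h (2 * t ())]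
      refine (hasSum_oddTheta τ.im_pos (2 * t ())).congr_fun fun n => ?_
      rw [mul_assoc, ← e_add, oddThetaTerm]
      congr 2
      simp; ring
  simpa [chi4_one, e_ne_zero] using congrFun key 1

theorem exists_prodTheta_ne_zero {r : ℕ} (τ : ℍ) : ∃ z : Fin r → ℂ, prodTheta (τ : ℂ) z ≠ 0 := by
  obtain ⟨z, hz⟩ := exists_oddTheta_ne_zero τ
  exact ⟨fun _ => z, Finset.prod_ne_zero_iff.mpr fun _ _ => hz⟩

theorem prodTheta_smul {r : ℕ} {γ : SL(2, ℤ)} {τ : ℍ} {ν : ℂ}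
    (h : ∀ z, oddTheta (γ • τ : ℍ) (z / aut γ τ) * autExp γ τ z = ν * oddTheta τ z)
    (z : Fin r → ℂ) :
    prodTheta (γ • τ : ℍ) ((aut γ τ)⁻¹ • z) * e (-((γ 1 0 : ℤ) : ℂ) * qfC z / aut γ τ) =
      ν ^ r * prodTheta τ z := by
  have h1 : e (-((γ 1 0 : ℤ) : ℂ) * qfC z / aut γ τ) = ∏ i, autExp γ τ (z i) := by
    simp only [autExp, ← e_sum]
    congr 1
    simp only [qfC, dotProduct, Finset.sum_div, Finset.mul_sum]
    refine Finset.sum_congr rfl fun i _ => ?_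
    have := aut_ne_zero γ τ
    field_simp
  rw [h1, prodTheta, prodTheta, ← Finset.prod_mul_distrib]
  have h2 : ν ^ r = ∏ _i : Fin r, ν := by simp
  rw [h2, ← Finset.prod_mul_distrib]
  refine Finset.prod_congr rfl fun i _ => ?_
  rw [← h, Pi.smul_apply, smul_eq_mul, inv_mul_eq_div]

/-- The signs (-1)^{l_i + m_i} of the one-variable laws multiply to 1 because both coordinate sums
are even. -/
theorem prodTheta_add_lattice {r : ℕ} (τ : ℂ) (z : Fin r → ℂ) {x y : Fin r → ℚ}
    (hx : x ∈ latticeD r) (hy : y ∈ latticeD r) :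
    prodTheta τ (z + τ • toC x + toC y) * e (τ * (qf x : ℂ) + toC x ⬝ᵥ z) = prodTheta τ z := by
  obtain ⟨l, hl, hle⟩ := hx
  obtain ⟨m, hm, hme⟩ := hy
  have h1 : e (τ * (qf x : ℂ) + toC x ⬝ᵥ z) = ∏ i, e ((l i : ℂ) ^ 2 / 2 * τ + l i * z i) := by
    rw [← e_sum, Finset.sum_add_distrib]
    simp only [qf, dotProduct, toC, hl]
    congr 2
    push_cast
    rw [Finset.sum_div, Finset.mul_sum]
    exact Finset.sum_congr rfl fun i _ => by ring
  have h2 : ∏ i, (-1 : ℂ) ^ (l i + m i) = 1 := by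
    have := chiVec_two_mul_add_one (l + m)
    simp only [chiVec, chi4_two_mul_add_one, Pi.add_apply] at this
    rw [this, Finset.sum_add_distrib]
    exact (hle.add hme).neg_one_zpow
  rw [h1, prodTheta, ← Finset.prod_mul_distrib, ← one_mul (prodTheta τ z), ← h2, prodTheta,
    ← Finset.prod_mul_distrib]
  refine Finset.prod_congr rfl fun i _ => ?_
  rw [← oddTheta_add_lattice]
  congr 2
  simp [toC, hl i, hm i, mul_comm]

/-! ### Fourier expansions of products with theta functions -/

open scoped Classical in
/-- The extension by zero of `chiVec` to rational vectors. -/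
def chiQ {r : ℕ} (x : Fin r → ℚ) : ℂ :=
  if h : ∃ n : Fin r → ℤ, x = half n then chiVec h.choose else 0

open scoped Classical in
/-- The extension by zero of a sequence to the rational numbers. -/
def ratExt (a : ℕ → ℂ) (D : ℚ) : ℂ := if h : ∃ n : ℕ, D = n then a h.choose else 0

theorem chiQ_half {r : ℕ} (n : Fin r → ℤ) : chiQ (half n) = chiVec n := by
  have h : ∃ m : Fin r → ℤ, half n = half m := ⟨n, rfl⟩
  rw [chiQ, dif_pos h, ← half_injective h.choose_spec]

theorem ratExt_natCast (a : ℕ → ℂ) (n : ℕ) : ratExt a n = a n := by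
  have h : ∃ m : ℕ, (n : ℚ) = m := ⟨n, rfl⟩
  rw [ratExt, dif_pos h, ← Nat.cast_injective h.choose_spec]

theorem exists_of_chiQ_ne_zero {r : ℕ} {x : Fin r → ℚ} (h : chiQ x ≠ 0) :
    ∃ n : Fin r → ℤ, x = half n ∧ ∀ i, Odd (n i) := by
  by_cases hx : ∃ n : Fin r → ℤ, x = half n
  · obtain ⟨n, rfl⟩ := hx
    rw [chiQ_half] at h
    exact ⟨n, rfl, odd_of_chiVec_ne_zero h⟩
  · rw [chiQ, dif_neg hx] at h
    exact absurd rfl h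

theorem exists_of_ratExt_ne_zero {a : ℕ → ℂ} {D : ℚ} (h : ratExt a D ≠ 0) :
    ∃ n : ℕ, D = n ∧ a n ≠ 0 := by
  by_cases hx : ∃ n : ℕ, D = n
  · obtain ⟨n, rfl⟩ := hx
    rw [ratExt_natCast] at h
    exact ⟨n, rfl, h⟩
  · rw [ratExt, dif_neg hx] at h
    exact absurd rfl h

theorem qf_half_odd {r : ℕ} {n : Fin r → ℤ} (hn : ∀ i, Odd (n i)) :
    ∃ l : ℤ, qf (half n) = l + (r : ℚ) / 8 := by
  choose l hl using fun i => odd_sq_sub_one (hn i)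
  refine ⟨∑ i, l i, ?_⟩
  have : ∀ i, (n i : ℚ) ^ 2 / 8 = l i + 1 / 8 := fun i => by
    have : (n i : ℚ) ^ 2 = 8 * l i + 1 := by exact_mod_cast hl i
    rw [this]; ring
  rw [qf_half, Finset.sum_congr rfl fun i _ => this i, Finset.sum_add_distrib]
  simp; ring

/-- The coefficients of the product of `∑ a(n) q^{n/8}` with `prodTheta`. -/
def thetaCoefficients (r : ℕ) (a : ℕ → ℂ) (m : ℚ) (x : Fin r → ℚ) : ℂ :=
  chiQ x * ratExt a (8 * (m - qf x))

theorem exists_of_thetaCoefficients_ne_zero {r : ℕ} {a : ℕ → ℂ} {m : ℚ} {x : Fin r → ℚ}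
    (h : thetaCoefficients r a m x ≠ 0) : ∃ (N : ℕ) (n : Fin r → ℤ), m = (N : ℚ) / 8 + qf (half n) ∧
      x = half n ∧ a N ≠ 0 ∧ ∀ i, Odd (n i) := by
  obtain ⟨n, rfl, hn⟩ := exists_of_chiQ_ne_zero (left_ne_zero_of_mul h)
  obtain ⟨N, hN, ha⟩ := exists_of_ratExt_ne_zero (right_ne_zero_of_mul h)
  exact ⟨N, n, by linarith, rfl, ha, hn⟩

/-- Odd squares are 1 mod 8, so β(n/2) ≡ r/8 mod 1, which N/8 compensates. -/
theorem exists_int_of_odd {r N : ℕ} (hN : 8 ∣ N + r) {n : Fin r → ℤ} (hn : ∀ i, Odd (n i)) :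
    ∃ l : ℤ, (N : ℚ) / 8 + qf (half n) = l := by
  obtain ⟨l, hl⟩ := qf_half_odd hn
  obtain ⟨j, hj⟩ := hN
  refine ⟨j + l, ?_⟩
  have : (N + r : ℚ) = 8 * j := by exact_mod_cast hj
  rw [hl]; push_cast; linarith

theorem thetaCoefficients_support {r : ℕ} {a : ℕ → ℂ} (ha : ∀ n, a n ≠ 0 → 8 ∣ n + r) {m : ℚ}
    {x : Fin r → ℚ} (h : thetaCoefficients r a m x ≠ 0) :
    (∃ l : ℤ, m = l) ∧ x ∈ dual (latticeD r) := by
  obtain ⟨N, n, rfl, rfl, hN, hn⟩ := exists_of_thetaCoefficients_ne_zero h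
  exact ⟨exists_int_of_odd (ha N hN) hn, half_mem_dual_of_odd hn⟩

/-- Here m - β(x) = N/8 with 8 ∣ N + r, and 0 < r < 8 excludes N = 0. So every such product
satisfies the cusp condition. -/
theorem thetaCoefficients_pos {r : ℕ} (hr0 : 0 < r) (hr8 : r < 8) {a : ℕ → ℂ}
    (ha : ∀ n, a n ≠ 0 → 8 ∣ n + r) {m : ℚ} {x : Fin r → ℚ}
    (h : thetaCoefficients r a m x ≠ 0) : 0 < m - qf x := by
  obtain ⟨N, n, rfl, rfl, hN, hn⟩ := exists_of_thetaCoefficients_ne_zero h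
  have h1 := ha N hN
  have h2 : 0 < N := by omega
  have h3 : (0 : ℚ) < N := by exact_mod_cast h2
  linarith

/-- Multiply the two absolutely convergent series and reindex the nonzero terms by (N, n) ↦ (N/8 +
β(n/2), n/2), a bijection onto the nonzero terms on the Jacobi side. -/
theorem hasFourierExpansion_mul_prodTheta {r : ℕ} {a : ℕ → ℂ} (ha8 : ∀ n, a n ≠ 0 → 8 ∣ n + r)
    {f : ℍ → ℂ} (ha : ∀ τ : ℍ, HasSum (fun n : ℕ => a n * e ((n : ℂ) / 8 * τ)) (f τ)) :
    HasFourierExpansion (latticeD r) (fun τ z => f τ * prodTheta τ z) (thetaCoefficients r a) := by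
  refine ⟨fun m x h => thetaCoefficients_support ha8 h, fun τ z => ?_⟩
  have hθ := hasSum_prodTheta τ.im_pos z
  have hsum := summable_mul_of_summable_norm (ha τ).summable.norm hθ.summable.norm
  have h1 := HasSum.mul (ha τ) hθ hsum
  set g := fun p : ℕ × (Fin r → ℤ) => a p.1 * e ((p.1 : ℂ) / 8 * τ) * prodThetaTerm τ z p.2 with hg
  have hsupp : ∀ p : Function.support g, a p.1.1 ≠ 0 ∧ ∀ i, Odd (p.1.2 i) := by
    rintro ⟨⟨N, n⟩, hp⟩
    have hp : a N * e ((N : ℂ) / 8 * τ) * prodThetaTerm τ z n ≠ 0 := hp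
    exact ⟨left_ne_zero_of_mul (left_ne_zero_of_mul hp),
      odd_of_chiVec_ne_zero (left_ne_zero_of_mul (right_ne_zero_of_mul hp))⟩
  choose l hl using fun p : Function.support g =>
    exists_int_of_odd (ha8 _ (hsupp p).1) (hsupp p).2
  let i : Function.support g → ℤ × dual (latticeD r) :=
    fun p => (l p, ⟨half p.1.2, half_mem_dual_of_odd (hsupp p).2⟩)
  have hval : ∀ p : Function.support g,
      thetaCoefficients r a (l p) (half p.1.2) = chiVec p.1.2 * a p.1.1 := by
    intro p
    rw [thetaCoefficients, ← hl, chiQ_half, add_sub_cancel_right,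
      mul_div_cancel₀ _ (by norm_num), ratExt_natCast]
  refine (hasSum_iff_hasSum_of_ne_zero_bij i ?_ ?_ ?_).mpr h1
  · intro p q hpq
    have h2 : half p.1.2 = half q.1.2 := congrArg (fun t => (t.2 : Fin r → ℚ)) hpq
    have h3 : l p = l q := congrArg Prod.fst hpq
    refine Subtype.ext (Prod.ext ?_ (half_injective h2))
    have h4 := hl p
    rw [h3, ← hl q, h2, add_left_inj] at h4
    exact_mod_cast (div_left_inj' (by norm_num : (8 : ℚ) ≠ 0)).mp h4
  · rintro ⟨m, x, hx⟩ hq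
    obtain ⟨N, n, hm, rfl, hN, hn⟩ := exists_of_thetaCoefficients_ne_zero (left_ne_zero_of_mul hq)
    have hgne : (N, n) ∈ Function.support g := by
      refine mul_ne_zero (mul_ne_zero hN (e_ne_zero _)) (mul_ne_zero ?_ (e_ne_zero _))
      exact Finset.prod_ne_zero_iff.mpr fun i _ => chi4_ne_zero (hn i)
    refine ⟨⟨(N, n), hgne⟩, Prod.ext ?_ rfl⟩
    have := hl ⟨(N, n), hgne⟩
    rw [← hm] at this
    exact_mod_cast this.symm
  · intro p
    simp only [i, hval, hg, prodThetaTerm]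
    have h5 : ((l p : ℤ) : ℂ) = (p.1.1 : ℂ) / 8 + (qf (half p.1.2) : ℂ) := by
      have := congrArg (Rat.cast : ℚ → ℂ) (hl p)
      push_cast at this
      exact this.symm
    rw [h5, show ((p.1.1 : ℂ) / 8 + (qf (half p.1.2) : ℂ)) * (τ : ℂ) + toC (half p.1.2) ⬝ᵥ z =
      (p.1.1 : ℂ) / 8 * τ + (τ * (qf (half p.1.2) : ℂ) + toC (half p.1.2) ⬝ᵥ z) by ring, e_add]
    ring

/-- The product of a theta dual function with `prodTheta` is a Jacobi cusp form. -/
theorem IsThetaDual.isJacobiCuspForm {r : ℕ} (hr0 : 0 < r) (hr8 : r < 8) {κ : ℤ} {f : ℍ → ℂ}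
    (hf : IsThetaDual r κ f) :
    IsJacobiCuspForm κ (latticeD r) fun τ z => f τ * prodTheta τ z := by
  have ha8 := fun n => hf.dvd_of_coeff8_ne_zero (n := n)
  have hF := hasFourierExpansion_mul_prodTheta ha8 hf.hasSum
  refine { holo := ?_, modular := ?_, elliptic := ?_, fourier := ?_, cusp := ?_ }
  · have h1 : DifferentiableOn ℂ (fun w : ℂ × (Fin r → ℂ) => (f ∘ ofComplex) w.1 *
        prodTheta w.1 w.2) {w | 0 < w.1.im} := by
      refine DifferentiableOn.mul (hf.holo.comp differentiableOn_fst fun w hw => hw) ?_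
      intro w hw
      refine DifferentiableAt.differentiableWithinAt ?_
      have : ∀ i ∈ Finset.univ, DifferentiableAt ℂ
          (fun w : ℂ × (Fin r → ℂ) => oddTheta w.1 (w.2 i)) w := fun i _ =>
        DifferentiableAt.comp (g := fun v : ℂ × ℂ => oddTheta v.1 v.2)
          (f := fun w : ℂ × (Fin r → ℂ) => (w.1, w.2 i)) w
          (differentiableAt_oddTheta hw) (by fun_prop)
      exact (HasFDerivAt.finsetProd (u := Finset.univ)
        (g := fun i (w : ℂ × (Fin r → ℂ)) => oddTheta w.1 (w.2 i))
        fun i hi => (this i hi).hasFDerivAt).differentiableAt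
    refine h1.congr fun w hw => ?_
    simp [ofComplex_apply_of_im_pos hw]
  · intro A τ z
    obtain ⟨ν, hν⟩ := hf.exists_factor A
    obtain ⟨hν0, h1, h2⟩ := hν τ
    have h3 := prodTheta_smul h1 z
    change f (A • τ) * prodTheta (A • τ : ℍ) ((aut A τ)⁻¹ • z) *
      e (-((A 1 0 : ℤ) : ℂ) * qfC z / aut A τ) * aut A τ ^ (-κ) = f τ * prodTheta τ z
    have h4 : aut A τ ^ κ * aut A τ ^ (-κ) = 1 := by
      rw [← zpow_add₀ (aut_ne_zero A τ)]; simp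
    linear_combination f (A • τ) * aut A τ ^ (-κ) * h3 + prodTheta τ z * aut A τ ^ (-κ) * h2 +
      f τ * prodTheta τ z * h4
  · intro x hx y hy τ z
    rw [mul_assoc, prodTheta_add_lattice _ _ hx hy]
  · exact ⟨_, hF, fun m x h => (thetaCoefficients_pos hr0 hr8 ha8 h).le⟩
  · exact ⟨_, hF, fun m x h => thetaCoefficients_pos hr0 hr8 ha8 h⟩

open scoped MatrixGroups

/-! ### Symmetries of the Fourier coefficients -/

theorem exists_dotProduct_eq {r : ℕ} {x y : Fin r → ℚ} (hx : x ∈ dual (latticeD r))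
    (hy : y ∈ latticeD r) : ∃ m : ℤ, x ⬝ᵥ y = m := hx y hy

/-- D_r is an even lattice: m_i² ≡ m_i mod 2, so ∑ m_i² is even along with ∑ m_i. -/
theorem exists_qf_eq {r : ℕ} {x : Fin r → ℚ} (hx : x ∈ latticeD r) : ∃ m : ℤ, qf x = m := by
  obtain ⟨m, hm, hme⟩ := hx
  have h1 : Even (∑ i, (m i ^ 2 - m i)) :=
    Finset.even_sum _ fun i _ => by
      rw [show m i ^ 2 - m i = m i * (m i - 1) by ring]; exact Int.even_mul_pred_self _
  rw [Finset.sum_sub_distrib] at h1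
  obtain ⟨l, hl⟩ := (Int.even_sub.mp h1).mpr hme
  refine ⟨l, ?_⟩
  have : (∑ i, (m i : ℚ) ^ 2) = l + l := by exact_mod_cast congrArg (Int.cast : ℤ → ℚ) hl
  simp only [qf, dotProduct, hm, ← sq, this]
  ring

theorem latticeD_le_dual (r : ℕ) : latticeD r ≤ dual (latticeD r) := by
  rintro x ⟨m, hm, -⟩ y ⟨l, hl, -⟩
  exact ⟨∑ i, m i * l i, by simp [dotProduct, hm, hl]⟩

/-- Translation by a lattice vector acting on the indices of the Fourier coefficients. -/
def translateIndex {r : ℕ} {v : Fin r → ℚ} (hv : v ∈ latticeD r) :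
    ℤ × dual (latticeD r) ≃ ℤ × dual (latticeD r) where
  toFun q := (q.1 + (exists_dotProduct_eq q.2.2 hv).choose + (exists_qf_eq hv).choose,
    q.2 + ⟨v, latticeD_le_dual r hv⟩)
  invFun q := (q.1 - (exists_dotProduct_eq q.2.2 hv).choose + (exists_qf_eq hv).choose,
    q.2 - ⟨v, latticeD_le_dual r hv⟩)
  left_inv q := by
    refine Prod.ext ?_ (by simp)
    have h1 := (exists_dotProduct_eq q.2.2 hv).choose_spec
    have h2 := (exists_dotProduct_eq (q.2 + ⟨v, latticeD_le_dual r hv⟩ :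
      dual (latticeD r)).2 hv).choose_spec
    have h3 := (exists_qf_eq hv).choose_spec
    simp only
    qify
    rw [← h1, ← h2, ← h3]
    simp only [AddSubgroup.coe_add, add_dotProduct, qf]
    ring
  right_inv q := by
    refine Prod.ext ?_ (by simp)
    have h1 := (exists_dotProduct_eq q.2.2 hv).choose_spec
    have h2 := (exists_dotProduct_eq (q.2 - ⟨v, latticeD_le_dual r hv⟩ :
      dual (latticeD r)).2 hv).choose_spec
    have h3 := (exists_qf_eq hv).choose_spec
    simp only
    qify
    rw [← h1, ← h2, ← h3]
    simp only [AddSubgroup.coe_sub, sub_dotProduct, qf]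
    ring

theorem translateIndex_fst {r : ℕ} {v : Fin r → ℚ} (hv : v ∈ latticeD r)
    (q : ℤ × dual (latticeD r)) :
    ((translateIndex hv q).1 : ℚ) = q.1 + (q.2 : Fin r → ℚ) ⬝ᵥ v + qf v := by
  rw [(exists_dotProduct_eq q.2.2 hv).choose_spec, (exists_qf_eq hv).choose_spec]
  simp [translateIndex]

theorem translateIndex_snd {r : ℕ} {v : Fin r → ℚ} (hv : v ∈ latticeD r)
    (q : ℤ × dual (latticeD r)) :
    ((translateIndex hv q).2 : Fin r → ℚ) = (q.2 : Fin r → ℚ) + v := rfl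

section

variable {r : ℕ} {κ : ℤ} {φ : ℍ → (Fin r → ℂ) → ℂ} {c : ℚ → (Fin r → ℚ) → ℂ}

/-- The Fourier coefficients only depend on `m - β(x)` and on `x` modulo the lattice. -/
theorem IsJacobiForm.coeff_translate (hφ : IsJacobiForm κ (latticeD r) φ)
    (hc : HasFourierExpansion (latticeD r) φ c) {v : Fin r → ℚ} (hv : v ∈ latticeD r)
    (m : ℚ) (x : Fin r → ℚ) : c (m - x ⬝ᵥ v + qf v) (x - v) = c m x := by
  have h : HasFourierExpansion (latticeD r) φ fun m x => c (m - x ⬝ᵥ v + qf v) (x - v) := by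
    refine ⟨fun m x h => ?_, fun τ z => ?_⟩
    · obtain ⟨⟨l, hl⟩, h2⟩ := hc.support _ _ h
      have h3 : x ∈ dual (latticeD r) := by
        simpa using (dual (latticeD r)).add_mem h2 (latticeD_le_dual r hv)
      refine ⟨?_, h3⟩
      obtain ⟨i, hi⟩ := h3 v hv
      obtain ⟨j, hj⟩ := exists_qf_eq hv
      exact ⟨l + i - j, by push_cast; rw [← hl, ← hi, ← hj]; ring⟩
    -- Apply the elliptic law with (λ, μ) = (v, 0), reindex by `translateIndex`, and conclude by
    -- uniqueness of the expansion.
    · have h1 := hφ.elliptic v hv 0 (latticeD r).zero_mem τ z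
      have h2 := (hc.hasSum τ (z + (τ : ℂ) • toC v + toC 0)).mul_right
        (e ((τ : ℂ) * (qf v : ℂ) + toC v ⬝ᵥ z))
      rw [h1] at h2
      refine ((translateIndex hv).hasSum_iff).mp (h2.congr_fun fun q => ?_)
      rw [Function.comp_apply, translateIndex_fst, translateIndex_snd]
      have hq : ((translateIndex hv q).1 : ℂ) = (q.1 : ℂ) + toC (q.2 : Fin r → ℚ) ⬝ᵥ toC v
          + (qf v : ℂ) := by
        have := congrArg (Rat.cast : ℚ → ℂ) (translateIndex_fst hv q)
        rw [toC_dotProduct]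
        push_cast at this ⊢
        exact this
      rw [hq, mul_assoc, ← e_add]
      congr 2
      · simp only [add_dotProduct, qf]; ring
      · simp
      · have h0 : toC (0 : Fin r → ℚ) = 0 := by ext i; simp [toC]
        simp only [toC_add, add_dotProduct, dotProduct_add, dotProduct_smul, smul_eq_mul, h0,
          dotProduct_zero]
        ring
  exact congrFun (congrFun (h.unique hc) m) x

/-- The Fourier coefficients of Jacobi forms of odd weight are odd. -/
theorem IsJacobiForm.coeff_neg (hκ : Odd κ) (hφ : IsJacobiForm κ (latticeD r) φ)
    (hc : HasFourierExpansion (latticeD r) φ c) (m : ℚ) (x : Fin r → ℚ) : c m (-x) = -c m x := by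
  have h : HasFourierExpansion (latticeD r) φ fun m x => -c m (-x) := by
    refine ⟨fun m x h => ?_, fun τ z => ?_⟩
    · obtain ⟨h1, h2⟩ := hc.support _ _ (neg_ne_zero.mp h)
      exact ⟨h1, by simpa using (dual (latticeD r)).neg_mem h2⟩
    · have h1 : φ τ (-z) = -φ τ z := by
        have := hφ.modular (-1) τ z
        simp only [Matrix.SpecialLinearGroup.coe_neg, Matrix.SpecialLinearGroup.coe_one] at this
        rw [← this]
        have hodd : (-1 : ℂ) ^ (-κ) = -1 := hκ.neg.neg_one_zpow
        simp [e_zero, hodd]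
      have h2 := (hc.hasSum τ (-z)).neg
      rw [h1, neg_neg] at h2
      let E : ℤ × dual (latticeD r) ≃ ℤ × dual (latticeD r) :=
        (Equiv.refl ℤ).prodCongr (Equiv.neg _)
      refine (E.hasSum_iff).mp (h2.congr_fun fun q => ?_)
      simp [E, toC_neg]
  have : -c m (-x) = c m x := congrFun (congrFun (h.unique hc) m) x
  rw [← this, neg_neg]

theorem qf_v1 (r : ℕ) : qf (v1 r) = (r : ℚ) / 8 := by
  simp [qf, v1, dotProduct]; ring

/-- The Fourier coefficients of a Jacobi cusp form of odd weight come from a single theta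
coefficient. -/
theorem IsJacobiCuspForm.coeff_eq_thetaCoefficients (hr : Odd r) (hκ : Odd κ)
    (hφ : IsJacobiCuspForm κ (latticeD r) φ)
    (hc : HasFourierExpansion (latticeD r) φ c) (hpos : ∀ m x, c m x ≠ 0 → 0 < m - qf x) :
    c = thetaCoefficients r fun N => c (((N : ℚ) + r) / 8) (v1 r) := by
  set a : ℕ → ℂ := fun N => c (((N : ℚ) + r) / 8) (v1 r) with ha
  have ha8 : ∀ N, a N ≠ 0 → 8 ∣ N + r := by
    intro N hN
    obtain ⟨⟨l, hl⟩, -⟩ := hc.support _ _ hN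
    have : ((N + r : ℕ) : ℤ) = 8 * l := by
      have : ((N : ℚ) + r) = 8 * l := by linarith
      exact_mod_cast this
    omega
  -- A vector in v₁ + D_r is translated to v₁. Where 8(m - β(x)) is not a natural number both sides
  -- vanish: the support and the cusp condition kill the left one, the extension by zero the right
  -- one.
  have hone : ∀ (m : ℚ) (n : Fin r → ℤ), chiVec n = 1 → c m (half n) =
      thetaCoefficients r a m (half n) := by
    intro m n hn
    obtain ⟨y, hy, hny⟩ := (chiVec_eq_one_iff n).mp hn
    rw [← hφ.toIsJacobiForm.coeff_translate hc hy, thetaCoefficients, chiQ_half, hn, one_mul]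
    have h1 : half n - y = v1 r := by rw [hny]; simp
    have h2 : m - half n ⬝ᵥ y + qf y = m - qf (half n) + (r : ℚ) / 8 := by
      rw [hny, qf_add, add_dotProduct, qf_v1]
      simp only [qf]; ring
    rw [h1, h2]
    set D := m - qf (half n)
    by_cases hD : ∃ N : ℕ, 8 * D = N
    · obtain ⟨N, hN⟩ := hD
      rw [hN, ratExt_natCast, ha]
      congr 1
      linarith
    · have hR : ratExt a (8 * D) = 0 := by
        by_contra h
        obtain ⟨N, hN, -⟩ := exists_of_ratExt_ne_zero h
        exact hD ⟨N, hN⟩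
      rw [hR]
      by_contra h
      obtain ⟨⟨l, hl⟩, -⟩ := hc.support _ _ h
      have h3 := hpos _ _ h
      rw [qf_v1] at h3
      have h4 : 8 * D = ((8 * l - r : ℤ) : ℚ) := by push_cast; linarith
      have h5 : 0 < 8 * l - (r : ℤ) := by
        have : (0 : ℚ) < ((8 * l - r : ℤ) : ℚ) := by rw [← h4]; linarith
        exact_mod_cast this
      refine hD ⟨(8 * l - (r : ℤ)).toNat, ?_⟩
      rw [h4]
      have := Int.toNat_of_nonneg h5.le
      exact_mod_cast this.symm
  ext m x
  by_cases hmx : x ∈ dual (latticeD r)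
  · rcases dual_cases hmx with ⟨n, rfl, hn⟩ | ⟨n, rfl⟩
    · rcases chiVec_trichotomy n with h | h | h
      · exact absurd h (Finset.prod_ne_zero_iff.mpr fun i _ => chi4_ne_zero (hn i))
      · exact hone m n h
      · have h1 : chiVec (-n) = 1 := by rw [chiVec_neg hr, h, neg_neg]
        have h2 := hone m (-n) h1
        rw [half_neg, hφ.toIsJacobiForm.coeff_neg hκ hc, thetaCoefficients, ← half_neg,
          chiQ_half, h1, half_neg, qf_neg] at h2
        rw [thetaCoefficients, chiQ_half, h]
        linear_combination -h2
    · have h0 : c m (fun i => (n i : ℚ)) = 0 := by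
        -- Translation by 2x ∈ D_r carries x to -x and fixes m, so c(m, -x) = c(m, x); oddness then
        -- forces c(m, x) = 0.
        have h1 : (fun i => 2 * (n i : ℚ)) ∈ latticeD r :=
          ⟨fun i => 2 * n i, fun i => by push_cast; rfl, by
            rw [← Finset.mul_sum]; exact even_two_mul _⟩
        have h2 := hφ.toIsJacobiForm.coeff_translate hc h1 m fun i => (n i : ℚ)
        have h3 : (fun i => (n i : ℚ)) - (fun i => 2 * (n i : ℚ)) = -fun i => (n i : ℚ) := by
          ext i; simp; ring
        have h4 : m - (fun i => (n i : ℚ)) ⬝ᵥ (fun i => 2 * (n i : ℚ)) +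
            qf (fun i => 2 * (n i : ℚ)) = m := by
          simp only [qf, dotProduct, Finset.sum_div]
          rw [sub_add, ← Finset.sum_sub_distrib, Finset.sum_eq_zero fun i _ => by ring, sub_zero]
        rw [h3, h4, hφ.toIsJacobiForm.coeff_neg hκ hc] at h2
        have h5 : (2 : ℂ) * c m (fun i => (n i : ℚ)) = 0 := by linear_combination -h2
        simpa using h5
      have h1 : chiQ (fun i => (n i : ℚ)) = 0 := by
        rw [show (fun i => (n i : ℚ)) = half fun i => 2 * n i by ext i; simp [half], chiQ_half]
        exact Finset.prod_eq_zero (Finset.mem_univ (⟨0, hr.pos⟩ : Fin r))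
          (chi4_even (even_two_mul _))
      rw [h0, thetaCoefficients, h1, zero_mul]
  · have h1 : c m x = 0 := by
      by_contra h
      exact hmx (hc.support _ _ h).2
    have h2 : thetaCoefficients r a m x = 0 := by
      by_contra h
      exact hmx (thetaCoefficients_support ha8 h).2
    rw [h1, h2]

theorem v1_mem_dual (r : ℕ) : v1 r ∈ dual (latticeD r) := by
  have := half_mem_dual_of_odd (r := r) (n := fun _ => 1) fun _ => odd_one
  convert this using 1
  ext i; simp [half, v1]

/-- A subseries of the expansion at z = 0, namely x = v₁ and m = (N + r)/8, up to the constant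
factor e(-rτ/8). -/
theorem HasFourierExpansion.summable_v1 (hc : HasFourierExpansion (latticeD r) φ c) (τ : ℍ) :
    Summable fun N : ℕ => c (((N : ℚ) + r) / 8) (v1 r) * e ((N : ℂ) / 8 * τ) := by
  have h1 := (hc.hasSum τ 0).summable
  have h2 : ∀ N : {N : ℕ // 8 ∣ N + r}, ∃ l : ℕ, N.1 + r = 8 * l := fun N => N.2
  choose l hl using h2
  let ι : {N : ℕ // 8 ∣ N + r} → ℤ × dual (latticeD r) := fun N => (l N, ⟨v1 r, v1_mem_dual r⟩)
  have hι : Function.Injective ι := by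
    intro a b h
    have h3 : (l a : ℤ) = l b := congrArg Prod.fst h
    have := hl a
    have := hl b
    refine Subtype.ext ?_
    omega
  have h3 := (h1.comp_injective hι).mul_right (e (-((r : ℂ) / 8 * τ)))
  refine (Function.Injective.summable_iff Subtype.val_injective ?_).mp (h3.congr fun N => ?_)
  · intro N hN
    by_cases h : c (((N : ℚ) + r) / 8) (v1 r) = 0
    · simp [h]
    · obtain ⟨⟨j, hj⟩, -⟩ := hc.support _ _ h
      refine absurd ⟨⟨N, ?_⟩, rfl⟩ hN
      have : ((N + r : ℕ) : ℤ) = 8 * j := by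
        have : ((N : ℚ) + r) = 8 * j := by linarith
        exact_mod_cast this
      omega
  · have h4 : (((N.1 : ℚ) + r) / 8) = ((l N : ℕ) : ℚ) := by
      have : ((N.1 : ℚ) + r) = 8 * (l N : ℕ) := by exact_mod_cast hl N
      rw [this]; ring
    have h5 : (N.1 : ℂ) + r = 8 * (l N : ℕ) := by exact_mod_cast hl N
    simp only [Function.comp_apply, ι, h4, Int.cast_natCast, dotProduct_zero, add_zero]
    rw [mul_assoc, ← e_add]
    congr 2
    linear_combination (-(τ : ℂ) / 8) * h5

theorem qSeries_map_T {a : ℕ → ℂ} {f : ℍ → ℂ} (ha8 : ∀ n, a n ≠ 0 → 8 ∣ n + r)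
    (ha : ∀ τ : ℍ, HasSum (fun n : ℕ => a n * e ((n : ℂ) / 8 * τ)) (f τ)) (τ : ℍ) :
    f (ModularGroup.T • τ) = e (-(r : ℂ) / 8) * f τ := by
  refine (ha _).unique (((ha τ).mul_left _).congr_fun fun n => ?_)
  by_cases h : a n = 0
  · simp [h]
  obtain ⟨l, hl⟩ := ha8 n h
  have hl' : (n : ℂ) + r = 8 * l := by exact_mod_cast hl
  rw [coe_T_smul, mul_left_comm, ← e_add]
  congr 1
  refine e_eq_of_sub_int l ?_
  push_cast
  linear_combination (1 / 8) * hl'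

/-- A function with a suitable `q^{1/8}`-expansion whose product with `prodTheta` transforms like a
Jacobi form under `S` is theta dual. -/
theorem isThetaDual_of_hasSum {a : ℕ → ℂ} {f : ℍ → ℂ} (ha8 : ∀ n, a n ≠ 0 → 8 ∣ n + r)
    (ha : ∀ τ : ℍ, HasSum (fun n : ℕ => a n * e ((n : ℂ) / 8 * τ)) (f τ))
    (hS : ∀ τ : ℍ, f (ModularGroup.S • τ) * nuS τ ^ r = (τ : ℂ) ^ κ * f τ) :
    IsThetaDual r κ f :=
  ⟨differentiableOn_of_hasSum ha, qSeries_map_T ha8 ha, hS, isBoundedAtImInfty_of_hasSum ha⟩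

/-- Every Jacobi cusp form of odd weight is the product of a theta dual function with
`prodTheta`. -/
theorem IsJacobiCuspForm.exists_isThetaDual (hr : Odd r) (hκ : Odd κ)
    (hφ : IsJacobiCuspForm κ (latticeD r) φ) :
    ∃ f : ℍ → ℂ, IsThetaDual r κ f ∧ φ = fun τ z => f τ * prodTheta τ z := by
  obtain ⟨c, hc, hpos⟩ := hφ.cusp
  have hca := hφ.coeff_eq_thetaCoefficients hr hκ hc hpos
  set a : ℕ → ℂ := fun N => c (((N : ℚ) + r) / 8) (v1 r)
  have ha8 : ∀ N, a N ≠ 0 → 8 ∣ N + r := by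
    intro N hN
    obtain ⟨⟨l, hl⟩, -⟩ := hc.support _ _ hN
    have : ((N + r : ℕ) : ℤ) = 8 * l := by
      have : ((N : ℚ) + r) = 8 * l := by linarith
      exact_mod_cast this
    omega
  let f : ℍ → ℂ := fun τ => ∑' N : ℕ, a N * e ((N : ℂ) / 8 * τ)
  have hf : ∀ τ : ℍ, HasSum (fun n : ℕ => a n * e ((n : ℂ) / 8 * τ)) (f τ) := fun τ =>
    (hc.summable_v1 τ).hasSum
  have hprod : φ = fun τ z => f τ * prodTheta τ z := by
    ext τ z
    have h1 := (hasFourierExpansion_mul_prodTheta ha8 hf).hasSum τ z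
    rw [← hca] at h1
    exact (hc.hasSum τ z).unique h1
  refine ⟨f, isThetaDual_of_hasSum ha8 hf fun τ => ?_, hprod⟩
  -- The S-law for f follows by dividing the S-law of φ by that of `prodTheta` at a point z where
  -- the latter is nonzero.
  obtain ⟨z, hz⟩ := exists_prodTheta_ne_zero (r := r) τ
  have h1 := hφ.modular ModularGroup.S τ z
  have h2 := prodTheta_smul (γ := ModularGroup.S) (τ := τ) (ν := nuS τ) (fun z => by
    rw [coe_S_smul, ← oddTheta_S τ.im_pos]
    simp [autExp, aut, ModularGroup.S]) z
  have haut : aut ModularGroup.S τ = τ := by simp [aut, ModularGroup.S]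
  change φ (ModularGroup.S • τ) ((aut ModularGroup.S τ)⁻¹ • z) *
      e (-((ModularGroup.S 1 0 : ℤ) : ℂ) * qfC z / aut ModularGroup.S τ) *
      aut ModularGroup.S τ ^ (-κ) = φ τ z at h1
  rw [haut] at h1 h2
  rw [hprod] at h1
  have h4 : (τ : ℂ) ^ κ * (τ : ℂ) ^ (-κ) = 1 := by
    rw [← zpow_add₀ τ.ne_zero]; simp
  refine mul_right_cancel₀ hz ?_
  simp only at h1
  linear_combination (τ : ℂ) ^ κ * h1 - f (ModularGroup.S • τ) * h2 -
    f (ModularGroup.S • τ) * prodTheta (ModularGroup.S • τ : ℍ) ((τ : ℂ)⁻¹ • z) *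
      e (-((ModularGroup.S 1 0 : ℤ) : ℂ) * qfC z / τ) * h4

theorem thetaCoeff_mul_prodTheta {a : ℕ → ℂ} (ha8 : ∀ n, a n ≠ 0 → 8 ∣ n + r)
    {f : ℍ → ℂ} (ha : ∀ τ : ℍ, HasSum (fun n : ℕ => a n * e ((n : ℂ) / 8 * τ)) (f τ)) :
    thetaCoeff (latticeD r) (fun τ z => f τ * prodTheta τ z) (v1 r) = f := by
  ext τ
  rw [thetaCoeff, coeff_eq (hasFourierExpansion_mul_prodTheta ha8 ha)]
  have hv : chiQ (v1 r) = 1 := by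
    rw [show v1 r = half fun _ => 1 by ext i; simp [half, v1], chiQ_half]
    simp [chiVec, chi4_one]
  refine HasSum.tsum_eq ?_
  set g := fun n : ℕ => a n * e ((n : ℂ) / 8 * τ) with hg
  have hsupp : ∀ p : Function.support g, ∃ l : ℕ, p.1 + r = 8 * l := fun p =>
    ha8 _ (left_ne_zero_of_mul p.2)
  choose l hl using hsupp
  have hl' : ∀ p, ((l p : ℤ) : ℚ) - qf (v1 r) = (p.1 : ℚ) / 8 := by
    intro p
    have : (p.1 : ℚ) + r = 8 * l p := by exact_mod_cast hl p
    rw [qf_v1]; push_cast; linarith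
  refine (hasSum_iff_hasSum_of_ne_zero_bij (fun p => (l p : ℤ)) ?_ ?_ ?_).mpr (ha τ)
  · intro p q hpq
    have h0 : (l p : ℤ) = l q := hpq
    have h1 : l p = l q := by exact_mod_cast h0
    have := hl p
    have := hl q
    exact Subtype.ext (by omega)
  · intro m hm
    have h1 := right_ne_zero_of_mul (left_ne_zero_of_mul hm)
    obtain ⟨N, hN, haN⟩ := exists_of_ratExt_ne_zero h1
    refine ⟨⟨N, mul_ne_zero haN (e_ne_zero _)⟩, ?_⟩
    have h2 := hl' ⟨N, mul_ne_zero haN (e_ne_zero _)⟩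
    have h3 : (m : ℚ) = ((l ⟨N, mul_ne_zero haN (e_ne_zero _)⟩ : ℤ) : ℚ) := by
      simp only at h2; linarith
    exact_mod_cast h3.symm
  · intro p
    simp only [thetaCoefficients, hv, hl', hg]
    rw [mul_div_cancel₀ _ (by norm_num : (8 : ℚ) ≠ 0), ratExt_natCast]
    push_cast
    ring

end

/-- Multiplication by `prodTheta`, as a linear map to Jacobi cusp forms. -/
def mulTheta {r : ℕ} (hr0 : 0 < r) (hr8 : r < 8) {κ w : ℤ} (hw : w = κ + r - 12) :
    etaModularForms (3 * (8 - r)) w →ₗ[ℂ] jacobiCusp κ (latticeD r) where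
  toFun f := ⟨fun τ z => (f : ℍ → ℂ) τ * prodTheta τ z,
    (isThetaDual_of_mem hr8 hw f.2).isJacobiCuspForm hr0 hr8⟩
  map_add' f g := by ext τ z; simp [add_mul]
  map_smul' a f := by ext τ z; simp [mul_assoc]

theorem mulTheta_bijective {r : ℕ} (hr : Odd r) (hr8 : r < 8) {κ w : ℤ} (hκ : Odd κ)
    (hw : w = κ + r - 12) : Function.Bijective (mulTheta hr.pos hr8 hw) := by
  constructor
  · intro f g h
    ext τ
    obtain ⟨z, hz⟩ := exists_prodTheta_ne_zero (r := r) τ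
    have := congrFun (congrFun (congrArg Subtype.val h) τ) z
    exact mul_right_cancel₀ hz this
  · rintro ⟨φ, hφ⟩
    obtain ⟨f, hf, rfl⟩ := IsJacobiCuspForm.exists_isThetaDual hr hκ hφ
    exact ⟨⟨f, hf.mem hr.pos hr8 hw⟩, rfl⟩

/-- The isomorphism between Jacobi cusp forms and theta dual functions. -/
def thetaEquiv {r : ℕ} (hr : Odd r) (hr8 : r < 8) {κ w : ℤ} (hκ : Odd κ)
    (hw : w = κ + r - 12) :
    jacobiCusp κ (latticeD r) ≃ₗ[ℂ] etaModularForms (3 * (8 - r)) w :=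
  (LinearEquiv.ofBijective _ (mulTheta_bijective hr hr8 hκ hw)).symm

theorem thetaEquiv_mul_prodTheta {r : ℕ} (hr : Odd r) (hr8 : r < 8) {κ w : ℤ} (hκ : Odd κ)
    (hw : w = κ + r - 12) (φ : jacobiCusp κ (latticeD r)) :
    (φ : ℍ → (Fin r → ℂ) → ℂ) = fun τ z =>
      (thetaEquiv hr hr8 hκ hw φ : ℍ → ℂ) τ * prodTheta τ z := by
  have := (LinearEquiv.ofBijective _ (mulTheta_bijective hr hr8 hκ hw)).apply_symm_apply φ
  exact (congrArg Subtype.val this).symm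

/-! ### Quadratic Gauss sums -/

theorem stdAddChar_intCast (N : ℕ) [NeZero N] (j : ℤ) :
    ZMod.stdAddChar (j : ZMod N) = e ((j : ℂ) / N) := by
  rw [ZMod.stdAddChar_coe, e]; congr 1; ring

section Gauss

variable (p : ℕ) [hp : Fact p.Prime]

/-- The quadratic character modulo `p`, with complex values. -/
def quadChar : MulChar (ZMod p) ℂ := (quadraticChar (ZMod p)).ringHomComp (Int.castRingHom ℂ)

/-- The quadratic Gauss sum modulo `p`. -/
def quadGauss : ℂ := gaussSum (quadChar p) ZMod.stdAddChar

theorem quadChar_intCast (a : ℤ) : quadChar p a = (legendreSym p a : ℂ) := rfl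

variable {p}

theorem ringChar_zmod_ne_two (h2 : p ≠ 2) : ringChar (ZMod p) ≠ 2 := by
  rwa [ZMod.ringChar_zmod_n]

theorem quadChar_mul_self {a : ZMod p} (ha : a ≠ 0) : quadChar p a * quadChar p a = 1 := by
  have := quadraticChar_sq_one ha
  rw [quadChar, MulChar.ringHomComp_apply, ← map_mul, ← sq, this, map_one]

theorem quadChar_pow_odd {r : ℕ} (hr : Odd r) (a : ZMod p) : quadChar p a ^ r = quadChar p a := by
  obtain ⟨j, rfl⟩ := hr
  by_cases ha : a = 0
  · subst ha
    rw [MulChar.map_zero]; simp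
  · rw [pow_succ, pow_mul, sq, quadChar_mul_self ha, one_pow, one_mul]

theorem quadChar_ne_one (h2 : p ≠ 2) : quadChar p ≠ 1 := by
  rw [quadChar, Ne, MulChar.ringHomComp_eq_one_iff (RingHom.injective_int _)]
  exact quadraticChar_ne_one (ringChar_zmod_ne_two h2)

theorem sum_quadChar_mul_stdAddChar (h2 : p ≠ 2) (b : ZMod p) :
    ∑ y, quadChar p y * ZMod.stdAddChar (y * b) = quadChar p b * quadGauss p := by
  by_cases hb : b = 0
  · subst hb
    simp [MulChar.sum_eq_zero_of_ne_one (quadChar_ne_one h2), (quadChar p).map_zero]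
  · have h1 := gaussSum_mulShift (quadChar p) ZMod.stdAddChar (Units.mk0 b hb)
    rw [Units.val_mk0] at h1
    rw [quadGauss, ← h1, ← mul_assoc, quadChar_mul_self hb, one_mul, gaussSum]
    simp [AddChar.mulShift_apply, mul_comm]

/-- Group by the value y = x²: it has 1 + χ(y) square roots. The part from 1 is a full character
sum, which vanishes, and the part from χ is the Gauss sum. -/
theorem sum_stdAddChar_mul_sq (h2 : p ≠ 2) {b : ZMod p} (hb : b ≠ 0) :
    ∑ x, ZMod.stdAddChar (b * x ^ 2) = quadChar p b * quadGauss p := by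
  classical
  rw [← Finset.sum_fiberwise' Finset.univ (fun x : ZMod p => x ^ 2)
    (fun y => ZMod.stdAddChar (b * y))]
  have h : ∀ y : ZMod p, ∑ _x with _x ^ 2 = y, ZMod.stdAddChar (b * y) =
      quadChar p y * ZMod.stdAddChar (y * b) + ZMod.stdAddChar (y * b) := by
    intro y
    have h1 := quadraticChar_card_sqrts (ringChar_zmod_ne_two h2) y
    rw [Set.toFinset_ofPred] at h1
    rw [Finset.sum_const, nsmul_eq_mul, mul_comm b]
    have h3 : ((Finset.univ.filter fun x : ZMod p => x ^ 2 = y).card : ℂ) = quadChar p y + 1 := by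
      have := congrArg (Int.cast : ℤ → ℂ) h1
      push_cast at this
      exact this
    rw [h3, add_mul, one_mul]
  rw [Finset.sum_congr rfl fun y _ => h y, Finset.sum_add_distrib, sum_quadChar_mul_stdAddChar h2,
    AddChar.sum_mulShift _ (ZMod.isPrimitive_stdAddChar p), if_neg hb]
  simp

theorem quadGauss_sq (h2 : p ≠ 2) : quadGauss p ^ 2 = (legendreSym p (-1) : ℂ) * p := by
  have hq : (quadChar p).IsQuadratic := (quadraticChar_isQuadratic _).comp _
  have h := gaussSum_sq (χ := quadChar p) (quadChar_ne_one h2) hq (ZMod.isPrimitive_stdAddChar p)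
  rw [quadGauss, h, ZMod.card, ← quadChar_intCast]
  simp

theorem legendreSym_neg_one_eq_chi4 (h2 : p ≠ 2) : (legendreSym p (-1) : ℂ) = chi4 p := by
  rw [legendreSym.at_neg_one h2, chi4]; simp

theorem odd_natCast_of_prime (h2 : p ≠ 2) : Odd (p : ℤ) := by
  exact_mod_cast hp.out.odd_of_ne_two h2

theorem natCast_two_pow_ne_zero (h2 : p ≠ 2) (j : ℕ) : ((2 ^ j : ℕ) : ZMod p) ≠ 0 := by
  rw [Ne, ZMod.natCast_eq_zero_iff]
  exact fun h => h2 ((Nat.prime_dvd_prime_iff_eq hp.out Nat.prime_two).mp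
    (hp.out.dvd_of_dvd_pow h))

theorem quadGauss_ne_zero (h2 : p ≠ 2) : quadGauss p ≠ 0 := by
  intro h
  have h1 := quadGauss_sq h2
  rw [h, legendreSym_neg_one_eq_chi4 h2] at h1
  have := chi4_ne_zero (odd_natCast_of_prime h2)
  have := hp.out.ne_zero
  simp_all

end Gauss

/-! ### Averages over torsion translates -/

section Average

variable {p : ℕ} [hp : Fact p.Prime]

/-- The average of `F` over the `p`-torsion translates by `2 λ τ + 2 u μ`. -/
def torsionAverage (p : ℕ) [Fact p.Prime] (u : ℤ) (τ : ℂ) (F : ℂ → ℂ) (z : ℂ) : ℂ :=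
  ∑ l : ZMod p, ∑ m : ZMod p, F (z + 2 * (l.val : ℂ) * τ + 2 * u * (m.val : ℂ)) *
    e (2 * (l.val : ℂ) ^ 2 * τ + 2 * (l.val : ℂ) * z)

/-- Torsion averages are compatible with the action of `S`. -/
theorem torsionAverage_S {τ : ℍ} {F F' : ℂ → ℂ} {c t t' : ℂ} (hodd : ∀ z, F (-z) = -F z)
    (h : ∀ w, F (w / τ) * e (-w ^ 2 / (2 * τ)) = c * F' w)
    (hF : ∀ z, torsionAverage p (-1) (-1 / τ) F z = t * oddTheta (-1 / τ) z)
    (hF' : ∀ z, torsionAverage p 1 τ F' z = t' * oddTheta τ z) : t * nuS τ = c * t' := by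
  obtain ⟨w, hw⟩ := exists_oddTheta_ne_zero τ
  have hτ := τ.ne_zero
  refine mul_right_cancel₀ hw ?_
  rw [mul_assoc, mul_assoc, ← hF', ← oddTheta_S τ.im_pos w]
  -- At z = -w/τ, the inversion interchanges the two torsion indices; hence u = -1 on this side and
  -- the exchange of summations below.
  have h1 := hF (-w / τ)
  rw [neg_div (τ : ℂ) w, oddTheta_neg, mul_neg] at h1
  rw [← mul_assoc, ← neg_eq_iff_eq_neg.mpr h1, torsionAverage, torsionAverage, Finset.sum_comm,
    Finset.mul_sum, ← Finset.sum_neg_distrib, Finset.sum_mul]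
  refine Finset.sum_congr rfl fun l _ => ?_
  rw [Finset.mul_sum, ← Finset.sum_neg_distrib, Finset.sum_mul]
  refine Finset.sum_congr rfl fun m _ => ?_
  rw [← mul_assoc, ← h]
  set x : ℂ := (l.val : ℂ)
  set y : ℂ := (m.val : ℂ)
  have h3 : (w + 2 * x * τ + 2 * (1 : ℤ) * y) / τ =
      -(-(w / τ) + 2 * y * (-1 / τ) + 2 * (-1 : ℤ) * x) := by
    push_cast; field_simp; ring
  rw [h3, hodd, ← neg_mul]
  set G := -F (-(w / τ) + 2 * y * (-1 / τ) + 2 * (-1 : ℤ) * x)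
  rw [mul_assoc G, mul_assoc G, ← e_add, ← e_add]
  congr 1
  -- The cross term in the square of w + 2lτ + 2m, divided by 2τ, is the integer 4lm.
  refine e_eq_of_sub_int (4 * l.val * m.val) ?_
  push_cast
  field_simp
  ring

theorem oddTheta_add_two_mul (τ z : ℂ) (m : ℤ) : oddTheta τ (z + 2 * m) = oddTheta τ z := by
  have := oddTheta_add_lattice τ z 0 (2 * m)
  simpa [e_zero, zpow_mul] using this

theorem oddTheta_add_two_mul_lattice (τ z : ℂ) (l : ℤ) :
    oddTheta τ (z + 2 * l * τ) * e (2 * l ^ 2 * τ + 2 * l * z) = oddTheta τ z := by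
  have := oddTheta_add_lattice τ z (2 * l) 0
  rw [add_zero, zpow_mul] at this
  simp only [Int.cast_zero, add_zero, Int.cast_mul, Int.cast_ofNat] at this
  rw [show (2 * (l : ℂ)) ^ 2 / 2 * τ = 2 * l ^ 2 * τ by ring] at this
  simpa using this

/-- Orthogonality of characters mod p keeps only the frequencies n = pn', and χ₄(pn') = χ₄(p)χ₄(n').
The shift by 2l is invisible at these frequencies. -/
theorem sum_oddTheta_translates {τ' z : ℂ} (hτ' : 0 < τ'.im) {u : ℤ}
    (hu : (u : ZMod p) ≠ 0) (l : ℤ) :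
    ∑ m : ZMod p, oddTheta τ' ((z + 2 * u * (m.val : ℂ) + 2 * l) / p) =
      p * chi4 p * oddTheta (p ^ 2 * τ') z := by
  have hp0 : (p : ℂ) ≠ 0 := Nat.cast_ne_zero.mpr hp.out.ne_zero
  have h1 := hasSum_sum (s := Finset.univ) (f := fun (m : ZMod p) (n : ℤ) =>
    oddThetaTerm τ' ((z + 2 * u * (m.val : ℂ) + 2 * l) / p) n)
    fun m _ => hasSum_oddTheta hτ' ((z + 2 * u * (m.val : ℂ) + 2 * l) / p)
  have hτ2 : 0 < ((p : ℂ) ^ 2 * τ').im := by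
    rw [show (p : ℂ) ^ 2 = ((p ^ 2 : ℝ) : ℂ) by push_cast; rfl, Complex.im_ofReal_mul]
    have : (0 : ℝ) < p := Nat.cast_pos.mpr hp.out.pos
    positivity
  refine h1.unique ?_
  have hinj : Function.Injective (fun n : ℤ => (p : ℤ) * n) :=
    mul_right_injective₀ (by exact_mod_cast hp.out.ne_zero)
  have key : ∀ n : ℤ, ∑ m : ZMod p, oddThetaTerm τ' ((z + 2 * u * (m.val : ℂ) + 2 * l) / p) n =
      if (n : ZMod p) = 0 then p * oddThetaTerm τ' (z / p) n else 0 := by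
    intro n
    have h3 : ∀ m : ZMod p, oddThetaTerm τ' ((z + 2 * u * (m.val : ℂ) + 2 * l) / p) n =
        oddThetaTerm τ' (z / p) n * ZMod.stdAddChar ((n * l : ℤ) : ZMod p) *
          ZMod.stdAddChar (m * ((n * u : ℤ) : ZMod p)) := by
      intro m
      have h4 : m * ((n * u : ℤ) : ZMod p) = ((m.val * (n * u) : ℤ) : ZMod p) := by
        push_cast; simp
      rw [h4, stdAddChar_intCast, stdAddChar_intCast, oddThetaTerm, oddThetaTerm,
        mul_assoc (chi4 n), mul_assoc (chi4 n), ← e_add, ← e_add]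
      congr 2
      push_cast
      field_simp
      ring
    rw [Finset.sum_congr rfl fun m _ => h3 m, ← Finset.mul_sum,
      AddChar.sum_mulShift _ (ZMod.isPrimitive_stdAddChar p), ZMod.card]
    by_cases hn : (n : ZMod p) = 0
    · simp [hn, mul_comm]
    · simp [hn, hu]
  refine (HasSum.congr_fun ?_ key)
  refine (hinj.hasSum_iff ?_).mp ?_
  · intro n hn
    rw [if_neg]
    intro h
    rw [ZMod.intCast_zmod_eq_zero_iff_dvd] at h
    obtain ⟨j, rfl⟩ := h
    exact hn ⟨j, rfl⟩
  · refine ((hasSum_oddTheta hτ2 z).mul_left ((p : ℂ) * chi4 p)).congr_fun fun n => ?_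
    simp only [Function.comp_apply]
    rw [if_pos (by simp), oddThetaTerm, oddThetaTerm, chi4_mul]
    simp only [mul_assoc]
    congr 4
    push_cast
    field_simp

/-- After division by p, the translation by 2lτ is the period 2lpτ' plus a p-torsion shift, so each
l contributes the same sum over m, giving p² in all. The shift of τ by 8b is harmless because of the
denominator 8 in q^{n²/8}. -/
theorem torsionAverage_isogeny {τ τ' : ℂ} (hτ' : 0 < τ'.im) {u b : ℤ}
    (hu : (u : ZMod p) ≠ 0) (h : p ^ 2 * τ' = τ + 8 * b) (z : ℂ) :
    torsionAverage p u τ (fun w => oddTheta τ' (w / p)) z = p ^ 2 * chi4 p * oddTheta τ z := by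
  have hp0 : (p : ℂ) ≠ 0 := Nat.cast_ne_zero.mpr hp.out.ne_zero
  have hτ : τ = p ^ 2 * τ' - 8 * b := by rw [h]; ring
  have h1 : oddTheta (p ^ 2 * τ') z = oddTheta τ z := by
    rw [h, oddTheta, oddTheta]
    congr 1; ext n
    rcases Int.even_or_odd n with hn | hn
    · simp [oddThetaTerm, chi4_even hn]
    · rw [oddThetaTerm, oddThetaTerm]
      congr 1
      exact e_eq_of_sub_int (n ^ 2 * b) (by push_cast; ring)
  have key : ∀ l m : ZMod p, oddTheta τ' ((z + 2 * (l.val : ℂ) * τ + 2 * u * (m.val : ℂ)) / p) *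
      e (2 * (l.val : ℂ) ^ 2 * τ + 2 * (l.val : ℂ) * z) =
      oddTheta τ' ((z + 2 * u * (m.val : ℂ) + 2 * (-8 * l.val * b : ℤ)) / p) := by
    intro l m
    set w := (z + 2 * u * (m.val : ℂ) + 2 * (-8 * l.val * b : ℤ)) / p with hw
    rw [← oddTheta_add_two_mul_lattice τ' w (l.val * p)]
    have hw' : w + 2 * ((l.val * p : ℤ) : ℂ) * τ' =
        (z + 2 * (l.val : ℂ) * τ + 2 * u * (m.val : ℂ)) / p := by
      rw [hw, hτ]; push_cast; field_simp; ring
    rw [hw']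
    congr 1
    refine e_eq_of_sub_int (16 * l.val ^ 2 * b - 16 * l.val ^ 2 * b - 4 * l.val * u * m.val + 16 * l.val ^ 2 * b) ?_
    rw [hw, hτ]
    push_cast
    field_simp
    ring
  simp only [torsionAverage, key, sum_oddTheta_translates hτ' hu, h1]
  simp; ring

/-- The sum over m is p times one term, by periodicity. In the sum over l, completing the square in
the n-th term gives b(n - 4l)² mod p, a quadratic Gauss sum independent of n. -/
theorem torsionAverage_translate (h2 : p ≠ 2) {τ : ℂ} (hτ : 0 < τ.im) (u b : ℤ)
    (hb : (b : ZMod p) ≠ 0) (z : ℂ) :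
    torsionAverage p u τ (fun w => oddTheta (τ + 8 * b / p) w) z =
      p * quadChar p b * quadGauss p * oddTheta τ z := by
  have hp0 : (p : ℂ) ≠ 0 := Nat.cast_ne_zero.mpr hp.out.ne_zero
  have h4 : (4 : ZMod p) ≠ 0 := natCast_two_pow_ne_zero h2 2
  set τ' := τ + 8 * b / p with hτ'
  have him : 0 < τ'.im := by
    rw [hτ', show (8 * b / p : ℂ) = ((8 * b / p : ℝ) : ℂ) by push_cast; rfl, Complex.add_im,
      Complex.ofReal_im, add_zero]
    exact hτ
  have key : ∀ l m : ZMod p, oddTheta τ' (z + 2 * (l.val : ℂ) * τ + 2 * u * (m.val : ℂ)) *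
      e (2 * (l.val : ℂ) ^ 2 * τ + 2 * (l.val : ℂ) * z) =
      oddTheta τ' (z - 16 * l.val * b / p) * ZMod.stdAddChar ((16 * l.val ^ 2 * b : ℤ) : ZMod p) := by
    intro l m
    set w := z - 16 * l.val * b / p with hw
    have h1 := oddTheta_add_two_mul τ' (z + 2 * (l.val : ℂ) * τ) (u * m.val)
    rw [show 2 * ((u * m.val : ℤ) : ℂ) = 2 * u * (m.val : ℂ) by push_cast; ring] at h1
    rw [h1, ← oddTheta_add_two_mul_lattice τ' w l.val, stdAddChar_intCast, mul_assoc (oddTheta _ _), ← e_add]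
    have h5 : w + 2 * ((l.val : ℤ) : ℂ) * τ' = z + 2 * (l.val : ℂ) * τ := by
      rw [hw, hτ']; push_cast; field_simp; ring
    rw [h5, hw, hτ']
    congr 2
    push_cast
    field_simp
    ring
  simp only [torsionAverage, key]
  simp only [Finset.sum_const, Finset.card_univ, ZMod.card, nsmul_eq_mul, ← Finset.mul_sum]
  rw [show (p : ℂ) * quadChar p b * quadGauss p * oddTheta τ z =
    p * (quadChar p b * quadGauss p * oddTheta τ z) by ring]
  congr 1
  have h6 := hasSum_sum (s := Finset.univ) (f := fun (l : ZMod p) (n : ℤ) =>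
    oddThetaTerm τ' (z - 16 * l.val * b / p) n * ZMod.stdAddChar ((16 * l.val ^ 2 * b : ℤ) : ZMod p))
    fun l _ => (hasSum_oddTheta him (z - 16 * l.val * b / p)).mul_right _
  refine h6.unique (((hasSum_oddTheta hτ z).mul_left (quadChar p b * quadGauss p)).congr_fun
    fun n => ?_)
  have h7 : ∀ l : ZMod p, oddThetaTerm τ' (z - 16 * l.val * b / p) n *
      ZMod.stdAddChar ((16 * l.val ^ 2 * b : ℤ) : ZMod p) =
      oddThetaTerm τ z n * ZMod.stdAddChar ((b : ZMod p) * ((n : ZMod p) - 4 * l) ^ 2) := by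
    intro l
    have : (b : ZMod p) * ((n : ZMod p) - 4 * l) ^ 2 = ((b * (n - 4 * l.val) ^ 2 : ℤ) : ZMod p) := by
      push_cast; simp
    rw [this, stdAddChar_intCast, stdAddChar_intCast, oddThetaTerm, oddThetaTerm,
      mul_assoc (chi4 n), mul_assoc (chi4 n), ← e_add, ← e_add, hτ']
    congr 2
    push_cast
    field_simp
    ring
  rw [Finset.sum_congr rfl fun l _ => h7 l, ← Finset.mul_sum, mul_comm, ← sum_stdAddChar_mul_sq h2 hb]
  congr 1
  let E : ZMod p ≃ ZMod p := (Equiv.mulLeft₀ (4 : ZMod p) h4).trans (Equiv.subLeft (n : ZMod p))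
  exact E.sum_comp (fun x => ZMod.stdAddChar ((b : ZMod p) * x ^ 2))

end Average

/-! ### Transformation of theta dual functions under isogenies -/

open scoped MatrixGroups

theorem im_affine_pos {a : ℝ} (ha : 0 < a) (t : ℝ) (τ : ℍ) : 0 < ((a : ℂ) * τ + t).im := by
  rw [Complex.add_im, Complex.im_ofReal_mul, Complex.ofReal_im, add_zero]
  exact mul_pos ha τ.im_pos

theorem coe_ofComplex {z : ℂ} (hz : 0 < z.im) : ((ofComplex z : ℍ) : ℂ) = z := by
  rw [ofComplex_apply_of_im_pos hz]

theorem im_translate_pos (p : ℕ) (b : ℤ) (τ : ℍ) : 0 < ((τ : ℂ) + 8 * b / p).im := by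
  have := im_affine_pos one_pos (8 * b / (p : ℝ)) τ
  refine this.trans_eq (congrArg Complex.im ?_)
  push_cast; ring

/-- Applying S twice sends z to -z, and ϑ is odd. -/
theorem nuS_S_mul (τ : ℍ) : nuS (-1 / τ) * nuS τ = -1 := by
  obtain ⟨z, hz⟩ := exists_oddTheta_ne_zero τ
  have hτ := τ.ne_zero
  have h1 := oddTheta_S τ.im_pos z
  have h2 := oddTheta_S (ModularGroup.S • τ).im_pos (z / τ)
  rw [coe_S_smul] at h2
  rw [show -1 / (-1 / (τ : ℂ)) = τ by field_simp, show z / τ / (-1 / (τ : ℂ)) = -z by field_simp,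
    oddTheta_neg] at h2
  refine mul_right_cancel₀ hz ?_
  rw [mul_assoc, ← h1, ← mul_assoc, ← h2, mul_assoc, ← e_add]
  rw [show -(z / τ) ^ 2 / (2 * (-1 / (τ : ℂ))) + -z ^ 2 / (2 * τ) = 0 by field_simp; ring, e_zero]
  ring

theorem nuS_sq_mul {p : ℕ} (hp : 0 < p) {τ : ℂ} (hτ : τ ≠ 0) :
    nuS ((p : ℂ) ^ 2 * τ) = p * nuS τ := by
  have hp' : (0 : ℝ) < p := Nat.cast_pos.mpr hp
  have hne : -Complex.I * τ ≠ 0 := mul_ne_zero (neg_ne_zero.mpr Complex.I_ne_zero) hτ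
  have hne' : ((p ^ 2 : ℝ) : ℂ) * (-Complex.I * τ) ≠ 0 :=
    mul_ne_zero (Complex.ofReal_ne_zero.mpr (pow_ne_zero 2 hp'.ne')) hne
  rw [nuS, nuS, show -Complex.I * ((p : ℂ) ^ 2 * τ) = ((p ^ 2 : ℝ) : ℂ) * (-Complex.I * τ) by
    push_cast; ring, Complex.cpow_def_of_ne_zero hne', Complex.cpow_def_of_ne_zero hne,
    Complex.log_ofReal_mul (by positivity) hne, Real.log_pow, add_mul, Complex.exp_add]
  have h : Complex.exp (((2 : ℕ) * Real.log p : ℝ) * (1 / 2)) = p := by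
    rw [show (((2 : ℕ) * Real.log p : ℝ) : ℂ) * (1 / 2) = (Real.log p : ℝ) by push_cast; ring,
      ← Complex.ofReal_exp, Real.exp_log hp']
    simp
  rw [h]; ring

section

variable {p : ℕ} [hp : Fact p.Prime] {r : ℕ} {κ : ℤ} {f : ℍ → ℂ}

theorem natCast_pos_of_prime : (0 : ℝ) < p := Nat.cast_pos.mpr hp.out.pos

theorem im_isogeny_pos (b : ℤ) (τ : ℍ) : 0 < (((τ : ℂ) + 8 * b) / (p : ℂ) ^ 2).im := by
  have h : (0 : ℝ) < 1 / (p : ℝ) ^ 2 := by have := natCast_pos_of_prime (p := p); positivity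
  have := im_affine_pos h (8 * b / (p : ℝ) ^ 2) τ
  refine this.trans_eq (congrArg Complex.im ?_)
  push_cast; ring

theorem im_sq_mul_pos (τ : ℍ) : 0 < ((p : ℂ) ^ 2 * τ).im := by
  have h : (0 : ℝ) < (p : ℝ) ^ 2 := by have := natCast_pos_of_prime (p := p); positivity
  have := im_affine_pos h 0 τ
  refine this.trans_eq (congrArg Complex.im ?_)
  push_cast; ring

/-- The matrix γ below, of lower row (p², -8b'), sends (τ + 8b')/p² to (-1/τ + 8b)/p² with cτ' + d =
τ. Both torsion averages have the scalar p²χ₄(p), so the multiplier of ϑ under γ is exactly ν_S(τ).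
-/
theorem IsThetaDual.map_isogeny (hf : IsThetaDual r κ f) (h2 : p ≠ 2) {b b' : ℤ}
    (hb : (p : ℤ) ^ 2 ∣ 64 * b * b' + 1) (τ : ℍ) :
    f (ofComplex ((-1 / τ + 8 * b) / p ^ 2)) * nuS τ ^ r =
      (τ : ℂ) ^ κ * f (ofComplex ((τ + 8 * b') / p ^ 2)) := by
  obtain ⟨x, hx⟩ := hb
  have hp0 : (p : ℂ) ≠ 0 := Nat.cast_ne_zero.mpr hp.out.ne_zero
  have hτ := τ.ne_zero
  have hx' : 64 * (b : ℂ) * b' + 1 = p ^ 2 * x := by exact_mod_cast hx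
  let γ : SL(2, ℤ) := ⟨!![8 * b, -x; (p : ℤ) ^ 2, -8 * b'], by
    rw [Matrix.det_fin_two_of]; linear_combination -hx⟩
  set τ' : ℍ := ofComplex ((τ + 8 * b') / p ^ 2) with hτ'
  have hcoe : (τ' : ℂ) = (τ + 8 * b') / p ^ 2 := coe_ofComplex (im_isogeny_pos b' τ)
  have haut : aut γ τ' = τ := by
    simp only [aut, γ, hcoe]; simp; field_simp; ring
  have hγ : ((γ • τ' : ℍ) : ℂ) = (-1 / τ + 8 * b) / p ^ 2 := by
    rw [coe_smul_eq, haut, hcoe]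
    simp [γ]
    field_simp
    linear_combination hx'
  obtain ⟨ν, hν⟩ := hf.exists_factor γ
  obtain ⟨-, h3, h4⟩ := hν τ'
  rw [haut] at h3 h4
  have hlead : (p : ℂ) ^ 2 * chi4 p ≠ 0 :=
    mul_ne_zero (pow_ne_zero 2 hp0) (chi4_ne_zero (odd_natCast_of_prime h2))
  have key := torsionAverage_S (p := p) (τ := τ) (F := fun w => oddTheta (γ • τ' : ℍ) (w / p))
    (F' := fun w => oddTheta τ' (w / p)) (c := ν τ') (t := p ^ 2 * chi4 p) (t' := p ^ 2 * chi4 p)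
    (fun z => by rw [neg_div, oddTheta_neg]) (fun w => ?_)
    (torsionAverage_isogeny (b := b) (γ • τ').im_pos (by simp) (by rw [hγ]; field_simp))
    (torsionAverage_isogeny (b := b') τ'.im_pos (by simp) (by rw [hcoe]; field_simp))
  · have hnu : nuS τ = ν τ' := mul_left_cancel₀ hlead (key.trans (mul_comm _ _))
    rw [hnu, ← h4, ← hγ, ofComplex_apply]
  · rw [← h3, div_right_comm]
    congr 1
    simp only [autExp, haut, γ]
    congr 1
    simp
    field_simp

/-- Now γ has lower row (p, -8b') and cτ' + d = pτ. One average is of isogeny type, the other of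
translation type, and comparing them brings in the Gauss sum. Oddness of r reduces the r-th powers
of the quadratic characters to first powers. -/
theorem IsThetaDual.map_translate (hf : IsThetaDual r κ f) (hr : Odd r) (h2 : p ≠ 2) {b b' : ℤ}
    (hb : (p : ℤ) ∣ 64 * b * b' + 1) (τ : ℍ) :
    f (ofComplex ((-1 / τ + 8 * (p * b : ℤ)) / p ^ 2)) * nuS τ ^ r =
      (p : ℂ) ^ (κ - r) * chi4 p * quadGauss p ^ r * (τ : ℂ) ^ κ *
        (quadChar p b' * f (ofComplex (τ + 8 * b' / p))) := by
  obtain ⟨x, hx⟩ := hb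
  have hp0 : (p : ℂ) ≠ 0 := Nat.cast_ne_zero.mpr hp.out.ne_zero
  have hτ := τ.ne_zero
  have hx' : 64 * (b : ℂ) * b' + 1 = p * x := by exact_mod_cast hx
  have hb' : (b' : ZMod p) ≠ 0 := by
    intro h
    have := congrArg (Int.cast : ℤ → ZMod p) hx
    simp [h] at this
  let γ : SL(2, ℤ) := ⟨!![8 * b, -x; (p : ℤ), -8 * b'], by
    rw [Matrix.det_fin_two_of]; linear_combination -hx⟩
  set τ' : ℍ := ofComplex (τ + 8 * b' / p) with hτ'
  have hcoe : (τ' : ℂ) = τ + 8 * b' / p := coe_ofComplex (im_translate_pos p b' τ)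
  have haut : aut γ τ' = p * τ := by
    simp only [aut, γ, hcoe]; simp; field_simp; ring
  have hγ : ((γ • τ' : ℍ) : ℂ) = (-1 / τ + 8 * (p * b : ℤ)) / p ^ 2 := by
    rw [coe_smul_eq, haut, hcoe]
    simp [γ]
    field_simp
    linear_combination hx'
  obtain ⟨ν, hν⟩ := hf.exists_factor γ
  obtain ⟨hν0, h3, h4⟩ := hν τ'
  rw [haut] at h3 h4
  have hχ := chi4_sq_of_odd (odd_natCast_of_prime h2)
  have key := torsionAverage_S (p := p) (τ := τ) (F := fun w => oddTheta (γ • τ' : ℍ) (w / p))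
    (F' := fun w => oddTheta τ' w) (c := ν τ') (t := p ^ 2 * chi4 p)
    (t' := p * quadChar p b' * quadGauss p)
    (fun z => by rw [neg_div, oddTheta_neg]) (fun w => ?_)
    (torsionAverage_isogeny (b := p * b) (γ • τ').im_pos (by simp) (by rw [hγ]; field_simp))
    (fun z => by rw [hcoe]; exact torsionAverage_translate h2 τ.im_pos 1 b' hb' z)
  · have hnu : p * nuS τ = chi4 p * quadChar p b' * quadGauss p * ν τ' := by
      refine mul_left_cancel₀ hp0 ?_
      linear_combination chi4 p * key - p ^ 2 * nuS τ * hχ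
    have hchi : chi4 p ^ r = chi4 p := by
      obtain ⟨j, rfl⟩ := hr
      rw [pow_succ, pow_mul, sq, hχ, one_pow, one_mul]
    have hnu' := congrArg (· ^ r) hnu
    simp only [mul_pow, hchi, quadChar_pow_odd hr] at hnu'
    rw [hτ', mul_zpow] at h4
    rw [← hγ, ofComplex_apply, zpow_sub₀ hp0, zpow_natCast]
    field_simp
    linear_combination f (γ • τ') * hnu' + chi4 p * quadChar p b' * quadGauss p ^ r * h4
  · rw [div_right_comm, div_div, ← h3]
    congr 1
    simp only [autExp, haut, γ]
    congr 1
    simp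
    field_simp

theorem IsThetaDual.map_sq_mul (hf : IsThetaDual r κ f) (τ : ℍ) :
    f (ofComplex (-1 / τ / p ^ 2)) * nuS τ ^ r =
      (p : ℂ) ^ (2 * κ - r) * (τ : ℂ) ^ κ * f (ofComplex (p ^ 2 * τ)) := by
  have hp0 : (p : ℂ) ≠ 0 := Nat.cast_ne_zero.mpr hp.out.ne_zero
  have h := hf.map_S (ofComplex (p ^ 2 * τ))
  rw [coe_ofComplex (im_sq_mul_pos τ), nuS_sq_mul hp.out.pos τ.ne_zero] at h
  have h1 : ModularGroup.S • ofComplex (p ^ 2 * τ) = ofComplex (-1 / τ / p ^ 2) := by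
    rw [← ofComplex_apply (ModularGroup.S • _), coe_S_smul, coe_ofComplex (im_sq_mul_pos τ)]
    congr 1
    field_simp
  have h2 : ((p : ℂ) ^ 2) ^ κ = (p : ℂ) ^ (2 * κ) := by rw [zpow_mul]; rfl
  rw [h1, mul_zpow, mul_pow, h2] at h
  rw [zpow_sub₀ hp0, zpow_natCast]
  have hpr : (p : ℂ) ^ r ≠ 0 := pow_ne_zero r hp0
  refine mul_left_cancel₀ hpr ?_
  rw [mul_assoc _ _ (f _), ← mul_assoc _ (_ / _), mul_div_cancel₀ _ hpr]
  linear_combination h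

/-- Inverting a transformation formula under `S`. -/
theorem S_symm (hr : Odd r) (hκ : Odd κ) {F G : ℂ → ℂ} {c : ℂ} (hc : c ≠ 0)
    (h : ∀ τ : ℍ, F (-1 / τ) * nuS τ ^ r = c * (τ : ℂ) ^ κ * G τ) (τ : ℍ) :
    G (-1 / τ) * nuS τ ^ r = c⁻¹ * (τ : ℂ) ^ κ * F τ := by
  have hτ := τ.ne_zero
  have h1 := h (ModularGroup.S • τ)
  rw [coe_S_smul, show -1 / (-1 / (τ : ℂ)) = τ by field_simp] at h1
  have h2 := congrArg (· ^ r) (nuS_S_mul τ)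
  simp only [mul_pow, hr.neg_one_pow] at h2
  have h3 : (-1 / (τ : ℂ)) ^ κ * (τ : ℂ) ^ κ = -1 := by
    rw [← mul_zpow, div_mul_cancel₀ _ hτ, hκ.neg_one_zpow]
  rw [mul_assoc, eq_inv_mul_iff_mul_eq₀ hc]
  linear_combination (c * G (-1 / τ) * nuS τ ^ r) * h3 + (τ : ℂ) ^ κ * nuS τ ^ r * h1 -
    (τ : ℂ) ^ κ * F τ * h2

end

/-! ### The Hecke operator on theta dual functions -/

section

variable {p : ℕ} [hp : Fact p.Prime] {r : ℕ} {κ : ℤ} {f : ℍ → ℂ}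

/-- The sum of `f((τ + 8 b) / p²)` over the residue classes `b` modulo `p²`. -/
def isogenySum (p : ℕ) [Fact p.Prime] (f : ℍ → ℂ) (τ : ℂ) : ℂ :=
  ∑ b : ZMod (p ^ 2), f (ofComplex ((τ + 8 * (b.val : ℤ)) / p ^ 2))

/-- The part of `isogenySum` over the invertible residue classes. -/
def unitSum (p : ℕ) [Fact p.Prime] (f : ℍ → ℂ) (τ : ℂ) : ℂ :=
  ∑ b : (ZMod (p ^ 2))ˣ, f (ofComplex ((τ + 8 * ((b : ZMod (p ^ 2)).val : ℤ)) / p ^ 2))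

/-- The part of `isogenySum` over the nonzero residue classes divisible by `p`. -/
def middleSum (p : ℕ) [Fact p.Prime] (f : ℍ → ℂ) (τ : ℂ) : ℂ :=
  ∑ b : ZMod p, quadChar p b ^ 2 * f (ofComplex ((τ + 8 * (p * b.val : ℤ)) / p ^ 2))

/-- The sum of the translates `f(τ + 8 b / p)`, twisted by the quadratic character. -/
def twistedSum (p : ℕ) [Fact p.Prime] (f : ℍ → ℂ) (τ : ℂ) : ℂ :=
  ∑ b : ZMod p, quadChar p b * f (ofComplex (τ + 8 * (b.val : ℤ) / p))

/-- Residues mod p² are units, nonzero multiples of p, or 0. The squared quadratic character is the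
indicator of b ≠ 0 in the middle part. -/
theorem sum_zmod_sq (G : ZMod (p ^ 2) → ℂ) : ∑ b, G b = ∑ u : (ZMod (p ^ 2))ˣ, G u +
    (∑ b : ZMod p, quadChar p b ^ 2 * G ((p * b.val : ℕ) : ZMod (p ^ 2)) + G 0) := by
  classical
  have hp0 := hp.out.pos
  have h0 : ∑ b : ZMod p, quadChar p b ^ 2 * G ((p * b.val : ℕ) : ZMod (p ^ 2)) + G 0 =
      ∑ b : ZMod p, G ((p * b.val : ℕ) : ZMod (p ^ 2)) := by
    rw [← Finset.add_sum_erase _ _ (Finset.mem_univ (0 : ZMod p)),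
      ← Finset.add_sum_erase _ (fun b : ZMod p => G ((p * b.val : ℕ) : ZMod (p ^ 2)))
        (Finset.mem_univ (0 : ZMod p))]
    rw [Finset.sum_congr rfl fun b hb => by
      rw [sq, quadChar_mul_self (Finset.ne_of_mem_erase hb), one_mul]]
    simp [(quadChar p).map_zero, add_comm]
  rw [h0, ← Finset.sum_filter_add_sum_filter_not Finset.univ (fun b => IsUnit b)]
  congr 1
  · symm
    refine Finset.sum_nbij (fun u : (ZMod (p ^ 2))ˣ => (u : ZMod (p ^ 2))) ?_ ?_ ?_ ?_
    · intro u _; simp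
    · intro u _ v _ h; exact Units.ext h
    · intro b hb
      obtain ⟨u, hu⟩ := (Finset.mem_filter.mp hb).2
      exact ⟨u, by simp, hu⟩
    · intro u _; rfl
  · symm
    have hval : ∀ b : ZMod p, p * b.val < p ^ 2 := fun b => by
      rw [sq]; exact Nat.mul_lt_mul_of_pos_left (ZMod.val_lt b) hp0
    have hunit : ∀ n : ℕ, IsUnit (n : ZMod (p ^ 2)) ↔ ¬ p ∣ n := fun n => by
      rw [ZMod.isUnit_iff_coprime, Nat.coprime_pow_right_iff two_pos, Nat.coprime_comm,
        hp.out.coprime_iff_not_dvd]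
    refine Finset.sum_nbij (fun b : ZMod p => ((p * b.val : ℕ) : ZMod (p ^ 2))) ?_ ?_ ?_ ?_
    · intro b _
      rw [Finset.mem_filter, hunit]
      simp
    · intro b _ c _ h
      have h1 := congrArg ZMod.val h
      simp only [ZMod.val_natCast, Nat.mod_eq_of_lt (hval _)] at h1
      exact ZMod.val_injective p (Nat.eq_of_mul_eq_mul_left hp0 h1)
    · intro b hb
      have h1 := (Finset.mem_filter.mp hb).2
      rw [← ZMod.natCast_zmod_val b, hunit, not_not] at h1
      obtain ⟨m, hm⟩ := h1
      have hlt : m < p := by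
        have := ZMod.val_lt b
        rw [hm, sq] at this
        exact Nat.lt_of_mul_lt_mul_left this
      refine ⟨(m : ZMod p), by simp, ?_⟩
      simp only
      rw [ZMod.val_natCast, Nat.mod_eq_of_lt hlt, ← hm, ZMod.natCast_zmod_val]
    · intro b _; rfl

theorem isogenySum_eq (p : ℕ) [hp : Fact p.Prime] (f : ℍ → ℂ) (τ : ℂ) :
    isogenySum p f τ = unitSum p f τ + (middleSum p f τ + f (ofComplex (τ / p ^ 2))) := by
  rw [isogenySum, sum_zmod_sq, unitSum, middleSum]
  have hval : ∀ b : ZMod p, p * b.val < p ^ 2 := fun b => by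
    rw [sq]; exact Nat.mul_lt_mul_of_pos_left (ZMod.val_lt b) hp.out.pos
  simp only [ZMod.val_natCast, Nat.mod_eq_of_lt (hval _)]
  simp

theorem dvd_sixtyFour_mul_val_add_one {N : ℕ} [NeZero N] {b b' : ZMod N} (h : 64 * b * b' + 1 = 0) :
    (N : ℤ) ∣ 64 * b.val * b'.val + 1 := by
  rw [← ZMod.intCast_zmod_eq_zero_iff_dvd]
  push_cast
  simpa using h

/-- S permutes the units mod p² by b ↦ -(64b)⁻¹, the relation required by `map_isogeny`. -/
theorem unitSum_S (hf : IsThetaDual r κ f) (h2 : p ≠ 2) (τ : ℍ) :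
    unitSum p f (-1 / τ) * nuS τ ^ r = (τ : ℂ) ^ κ * unitSum p f τ := by
  have h64 : Nat.Coprime (2 ^ 6) (p ^ 2) :=
    ((Nat.coprime_primes Nat.prime_two hp.out).mpr h2.symm).pow 6 2
  norm_num only at h64
  set w : (ZMod (p ^ 2))ˣ := -(ZMod.unitOfCoprime 64 h64)⁻¹ with hw
  have hw' : (64 : ZMod (p ^ 2)) * w = -1 := by
    have : ((ZMod.unitOfCoprime 64 h64 : (ZMod (p ^ 2))ˣ) : ZMod (p ^ 2)) = 64 := by
      rw [ZMod.coe_unitOfCoprime]; rfl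
    rw [hw, ← this, ← Units.val_mul]; simp
  let E : (ZMod (p ^ 2))ˣ ≃ (ZMod (p ^ 2))ˣ := (Equiv.inv _).trans (Equiv.mulLeft w)
  rw [unitSum, unitSum, Finset.sum_mul, Finset.mul_sum]
  refine Fintype.sum_equiv E _ _ fun b => ?_
  refine hf.map_isogeny h2 ?_ τ
  have : ((p ^ 2 : ℕ) : ℤ) = (p : ℤ) ^ 2 := by push_cast; rfl
  rw [← this]
  refine dvd_sixtyFour_mul_val_add_one ?_
  simp only [E, Equiv.trans_apply, Equiv.inv_apply, Equiv.coe_mulLeft, Units.val_mul]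
  rw [show (64 : ZMod (p ^ 2)) * b * (w * (b⁻¹ : (ZMod (p ^ 2))ˣ)) = 64 * w * (b * (b⁻¹ : (ZMod (p ^ 2))ˣ)) by ring,
    hw', Units.mul_inv]
  ring

theorem middleSum_S (hf : IsThetaDual r κ f) (hr : Odd r) (h2 : p ≠ 2) (τ : ℍ) :
    middleSum p f (-1 / τ) * nuS τ ^ r =
      (p : ℂ) ^ (κ - r) * chi4 p * quadGauss p ^ r * (τ : ℂ) ^ κ * twistedSum p f τ := by
  have h64 : (64 : ZMod p) ≠ 0 := natCast_two_pow_ne_zero h2 6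
  have hinv : Function.Involutive fun b : ZMod p => -(64 * b)⁻¹ := by
    intro b
    by_cases hb : b = 0
    · simp [hb]
    · field_simp
  let E := hinv.toPerm
  rw [middleSum, twistedSum, Finset.sum_mul, Finset.mul_sum]
  refine Fintype.sum_equiv E _ _ fun b => ?_
  have hE : E b = -(64 * b)⁻¹ := rfl
  by_cases hb : b = 0
  · rw [hE, hb]; simp [(quadChar p).map_zero]
  · have h := hf.map_translate (p := p) hr h2 (b := b.val) (b' := (E b).val)
      (dvd_sixtyFour_mul_val_add_one (by rw [hE]; field_simp; ring)) τ
    rw [sq, quadChar_mul_self hb, one_mul, h]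
    simp

/-- The Hecke operator on theta dual functions, as a sum over matrices of determinant `p²`. -/
def heckeSum (r : ℕ) (κ : ℤ) (p : ℕ) [Fact p.Prime] (f : ℍ → ℂ) (τ : ℂ) : ℂ :=
  chi4 p * ((p : ℂ) ^ (-2 : ℤ) * isogenySum p f τ +
    chi4 p * (p : ℂ) ^ (κ - r - 2) * quadGauss p ^ r * twistedSum p f τ +
    (p : ℂ) ^ (2 * κ - r - 2) * f (ofComplex (p ^ 2 * τ)))

/-- S fixes the unit part, exchanges the middle part with the twisted sum, and exchanges b = 0 with
f(p²τ). The coefficients in `heckeSum` are exactly the constants of these exchanges; `S_symm`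
supplies the reverse directions. -/
theorem heckeSum_S (hf : IsThetaDual r κ f) (hr : Odd r) (hκ : Odd κ) (h2 : p ≠ 2) (τ : ℍ) :
    heckeSum r κ p f (-1 / τ) * nuS τ ^ r = (τ : ℂ) ^ κ * heckeSum r κ p f τ := by
  have hp0 : (p : ℂ) ≠ 0 := Nat.cast_ne_zero.mpr hp.out.ne_zero
  have hg := pow_ne_zero r (quadGauss_ne_zero h2)
  have hχ := chi4_sq_of_odd (odd_natCast_of_prime h2)
  have hχ0 := chi4_ne_zero (odd_natCast_of_prime h2)
  have h1 := unitSum_S hf h2 τ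
  have h3 := middleSum_S hf hr h2 τ
  have h4 := S_symm hr hκ (F := middleSum p f) (G := twistedSum p f)
    (c := (p : ℂ) ^ (κ - r) * chi4 p * quadGauss p ^ r)
    (mul_ne_zero (mul_ne_zero (zpow_ne_zero _ hp0) hχ0) hg) (fun τ => middleSum_S hf hr h2 τ) τ
  have h5 := hf.map_sq_mul (p := p) τ
  have h6 := S_symm hr hκ (F := fun z => f (ofComplex (z / p ^ 2)))
    (G := fun z => f (ofComplex (p ^ 2 * z))) (c := (p : ℂ) ^ (2 * κ - r))
    (zpow_ne_zero _ hp0) (fun τ => hf.map_sq_mul τ) τ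
  have e1 : (p : ℂ) ^ (κ - r - 2) = (p : ℂ) ^ (κ - r) * (p : ℂ) ^ (-2 : ℤ) := by
    rw [← zpow_add₀ hp0]; rfl
  have e2 : (p : ℂ) ^ (2 * κ - r - 2) = (p : ℂ) ^ (2 * κ - r) * (p : ℂ) ^ (-2 : ℤ) := by
    rw [← zpow_add₀ hp0]; rfl
  have h4' : (p : ℂ) ^ (κ - r) * chi4 p * quadGauss p ^ r * (twistedSum p f (-1 / τ) * nuS τ ^ r) =
      (τ : ℂ) ^ κ * middleSum p f τ := by
    rw [h4, mul_assoc (_⁻¹), mul_inv_cancel_left₀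
      (mul_ne_zero (mul_ne_zero (zpow_ne_zero _ hp0) hχ0) hg)]
  have h6' : (p : ℂ) ^ (2 * κ - r) * (f (ofComplex (p ^ 2 * (-1 / τ))) * nuS τ ^ r) =
      (τ : ℂ) ^ κ * f (ofComplex (τ / p ^ 2)) := by
    rw [h6, mul_assoc (_⁻¹), mul_inv_cancel_left₀ (zpow_ne_zero _ hp0)]
  rw [heckeSum, heckeSum, isogenySum_eq, isogenySum_eq, e1, e2]
  linear_combination chi4 p * (p : ℂ) ^ (-2 : ℤ) * (h1 + h3 + h4' + h5 + h6')

end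

/-! ### Fourier expansion of the Hecke sum. -/

section

variable {p : ℕ} [hp : Fact p.Prime] {r : ℕ} {κ k : ℤ} {f : ℍ → ℂ}

theorem sum_stdAddChar_mul_natCast {n : ℕ} :
    ∑ b : ZMod (p ^ 2), ZMod.stdAddChar (b * (n : ZMod (p ^ 2))) =
      if p ^ 2 ∣ n then (p : ℂ) ^ 2 else 0 := by
  rw [AddChar.sum_mulShift _ (ZMod.isPrimitive_stdAddChar (p ^ 2)), ZMod.card]
  simp only [ZMod.natCast_eq_zero_iff]
  split_ifs <;> simp

theorem IsThetaDual.hasSum_isogenySum (hf : IsThetaDual r κ f) (τ : ℍ) :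
    HasSum (fun n : ℕ => (p : ℂ) ^ 2 * coeff8 f (p ^ 2 * n) * e ((n : ℂ) / 8 * τ))
      (isogenySum p f τ) := by
  have hp0 : (p : ℂ) ≠ 0 := Nat.cast_ne_zero.mpr hp.out.ne_zero
  have h1 := hasSum_sum (s := Finset.univ) (f := fun (b : ZMod (p ^ 2)) (n : ℕ) => coeff8 f n *
      e ((n : ℂ) / 8 * (ofComplex ((τ + 8 * (b.val : ℤ)) / p ^ 2) : ℍ)))
    fun b _ => hf.hasSum (ofComplex ((τ + 8 * (b.val : ℤ)) / p ^ 2))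
  have hinj : Function.Injective fun n : ℕ => p ^ 2 * n :=
    mul_right_injective₀ (pow_ne_zero 2 hp.out.ne_zero)
  have key : ∀ n : ℕ, ∑ b : ZMod (p ^ 2), coeff8 f n *
      e ((n : ℂ) / 8 * (ofComplex ((τ + 8 * (b.val : ℤ)) / p ^ 2) : ℍ)) =
      coeff8 f n * e ((n : ℂ) / 8 * (τ / p ^ 2)) * if p ^ 2 ∣ n then (p : ℂ) ^ 2 else 0 := by
    intro n
    rw [← sum_stdAddChar_mul_natCast, Finset.mul_sum]
    refine Finset.sum_congr rfl fun b _ => ?_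
    have h2 : b * (n : ZMod (p ^ 2)) = ((b.val * n : ℤ) : ZMod (p ^ 2)) := by push_cast; simp
    rw [coe_ofComplex (im_isogeny_pos _ τ), h2, stdAddChar_intCast, mul_assoc, ← e_add]
    congr 2
    push_cast
    field_simp
  simp only [key] at h1
  have h3 := (hinj.hasSum_iff (fun n hn => ?_)).mpr h1
  · refine h3.congr_fun fun n => ?_
    simp only [Function.comp_apply, dvd_mul_right, if_true]
    rw [show ((p ^ 2 * n : ℕ) : ℂ) / 8 * (τ / p ^ 2) = (n : ℂ) / 8 * τ by push_cast; field_simp]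
    ring
  · rw [if_neg fun ⟨j, hj⟩ => hn ⟨j, hj.symm⟩, mul_zero]

theorem IsThetaDual.hasSum_twistedSum (hf : IsThetaDual r κ f) (h2 : p ≠ 2) (τ : ℍ) :
    HasSum (fun n : ℕ => quadGauss p * quadChar p n * coeff8 f n * e ((n : ℂ) / 8 * τ))
      (twistedSum p f τ) := by
  have hp0 : (p : ℂ) ≠ 0 := Nat.cast_ne_zero.mpr hp.out.ne_zero
  have h1 := hasSum_sum (s := Finset.univ) (f := fun (b : ZMod p) (n : ℕ) => quadChar p b *
      (coeff8 f n * e ((n : ℂ) / 8 * (ofComplex (τ + 8 * (b.val : ℤ) / p) : ℍ))))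
    fun b _ => (hf.hasSum (ofComplex (τ + 8 * (b.val : ℤ) / p))).mul_left (quadChar p b)
  refine h1.congr_fun fun n => ?_
  have h3 : ∀ b : ZMod p, quadChar p b *
      (coeff8 f n * e ((n : ℂ) / 8 * (ofComplex (τ + 8 * (b.val : ℤ) / p) : ℍ))) =
      coeff8 f n * e ((n : ℂ) / 8 * τ) * (quadChar p b * ZMod.stdAddChar (b * (n : ZMod p))) := by
    intro b
    have h4 : b * (n : ZMod p) = ((b.val * n : ℤ) : ZMod p) := by push_cast; simp
    rw [coe_ofComplex (im_translate_pos p _ τ), h4, stdAddChar_intCast,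
      show (n : ℂ) / 8 * (τ + 8 * ((b.val : ℤ) : ℂ) / p) =
        (n : ℂ) / 8 * τ + ((b.val * n : ℤ) : ℂ) / p by push_cast; field_simp, e_add]
    ring
  rw [Finset.sum_congr rfl fun b _ => h3 b, ← Finset.mul_sum, sum_quadChar_mul_stdAddChar h2]
  ring

theorem IsThetaDual.hasSum_sq_mul (hf : IsThetaDual r κ f) (τ : ℍ) :
    HasSum (fun n : ℕ => (if p ^ 2 ∣ n then coeff8 f (n / p ^ 2) else 0) * e ((n : ℂ) / 8 * τ))
      (f (ofComplex (p ^ 2 * τ))) := by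
  have hinj : Function.Injective fun n : ℕ => p ^ 2 * n :=
    mul_right_injective₀ (pow_ne_zero 2 hp.out.ne_zero)
  refine (hinj.hasSum_iff (fun n hn => ?_)).mp ?_
  · rw [if_neg fun ⟨j, hj⟩ => hn ⟨j, hj.symm⟩, zero_mul]
  · refine (hf.hasSum (ofComplex (p ^ 2 * τ))).congr_fun fun n => ?_
    simp only [Function.comp_apply, dvd_mul_right, if_true]
    rw [Nat.mul_div_cancel_left _ (pow_pos hp.out.pos 2), coe_ofComplex (im_sq_mul_pos τ)]
    congr 2
    push_cast; ring

theorem weight_eq {s : ℕ} (k : ℤ) : k + (((2 * s + 1 : ℕ) : ℤ) + 1) / 2 = k + s + 1 := by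
  push_cast; omega

/-- The power of `p` and the sign in the middle coefficient of the Hecke operators. -/
theorem middle_constant (h2 : p ≠ 2) (hr : Odd r) (hk : κ = k + ((r : ℤ) + 1) / 2) (hκ : Odd κ) :
    (p : ℂ) ^ (κ - r - 2) * ((legendreSym p (-1) : ℂ) * p) ^ ((r + 1) / 2) =
      chi4 p * (legendreSym p (-1) : ℂ) ^ k.natAbs * (p : ℂ) ^ (k - 1) := by
  have hp0 : (p : ℂ) ≠ 0 := Nat.cast_ne_zero.mpr hp.out.ne_zero
  have hχ := chi4_sq_of_odd (odd_natCast_of_prime h2)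
  obtain ⟨s, rfl⟩ := hr
  rw [weight_eq] at hk
  subst hk
  rw [legendreSym_neg_one_eq_chi4 h2, show (2 * s + 1 + 1) / 2 = s + 1 by omega, mul_pow]
  have h3 : (p : ℂ) ^ (k + s + 1 - ((2 * s + 1 : ℕ) : ℤ) - 2) * (p : ℂ) ^ (s + 1) =
      (p : ℂ) ^ (k - 1) := by
    rw [← zpow_natCast, ← zpow_add₀ hp0]
    congr 1; push_cast; ring
  have h4 : chi4 p ^ (s + 1) = chi4 p * chi4 p ^ k.natAbs := by
    rw [← pow_succ']
    -- The weight k + s + 1 is odd, so s and k have equal parity and the powers of χ₄(p) = ±1 agree.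
    have hpar : Even (s + k.natAbs) := by
      obtain ⟨j, hj⟩ := hκ
      rcases Int.natAbs_eq k with h | h <;> rw [Nat.even_iff] <;> omega
    obtain ⟨j, hj⟩ := hpar
    have h5 : ∀ n : ℕ, chi4 p ^ (2 * n) = 1 := fun n => by rw [pow_mul, sq, hχ, one_pow]
    rcases Nat.even_or_odd' s with ⟨a, rfl | rfl⟩ <;>
      rcases Nat.even_or_odd' k.natAbs with ⟨b, hb | hb⟩ <;> rw [hb] <;>
      first
        | omega
        | (rw [pow_succ, h5, pow_succ, h5])
        | (rw [show 2 * a + 1 + 1 = 2 * (a + 1) by ring, show 2 * b + 1 + 1 = 2 * (b + 1) by ring,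
            h5, h5])
  rw [h4, ← h3]; ring

theorem legendreSym_neg_four (h2 : p ≠ 2) : (legendreSym p (-4) : ℂ) = chi4 p := by
  have h : ((2 : ℤ) : ZMod p) ≠ 0 := by exact_mod_cast natCast_two_pow_ne_zero h2 1
  rw [show (-4 : ℤ) = -1 * 2 ^ 2 by norm_num, legendreSym.mul, legendreSym.sq_one' p h, mul_one,
    legendreSym_neg_one_eq_chi4 h2]

theorem twistedHeckeCoeff_eq (h2 : p ≠ 2) (f : ℍ → ℂ) (m : ℕ) : twistedHeckeCoeff k p f m =
    chi4 p * (coeff8 f (p ^ 2 * m) +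
      (legendreSym p (-1) : ℂ) ^ k.natAbs * (p : ℂ) ^ (k - 1) * quadChar p m * coeff8 f m +
      (p : ℂ) ^ (2 * k - 1) * (if p ^ 2 ∣ m then coeff8 f (m / p ^ 2) else 0)) := by
  have h3 : (legendreSym p ((-1) ^ k.natAbs * (m : ℤ)) : ℂ) =
      (legendreSym p (-1) : ℂ) ^ k.natAbs * quadChar p m := by
    rw [legendreSym.mul, Int.cast_mul, ← quadChar_intCast p (m : ℤ), Int.cast_natCast]
    congr 1
    exact_mod_cast congrArg (Int.cast : ℤ → ℂ) (map_pow (legendreSym.hom p) (-1) k.natAbs)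
  rw [twistedHeckeCoeff, legendreSym_neg_four h2, h3]
  ring

/-- The twisted sum itself yields one more Gauss sum, so the middle term contains its (r+1)-st
power, that is ((-1/p)p)^{(r+1)/2}, evaluated by `middle_constant`. -/
theorem IsThetaDual.hasSum_heckeSum (hf : IsThetaDual r κ f) (h2 : p ≠ 2) (hr : Odd r)
    (hk : κ = k + ((r : ℤ) + 1) / 2) (hκ : Odd κ) (τ : ℍ) :
    HasSum (fun n : ℕ => twistedHeckeCoeff k p f n * e ((n : ℂ) / 8 * τ))
      (heckeSum r κ p f τ) := by
  have hp0 : (p : ℂ) ≠ 0 := Nat.cast_ne_zero.mpr hp.out.ne_zero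
  have hχ := chi4_sq_of_odd (odd_natCast_of_prime h2)
  have h := ((((hf.hasSum_isogenySum (p := p) τ).mul_left ((p : ℂ) ^ (-2 : ℤ))).add
    ((hf.hasSum_twistedSum h2 τ).mul_left
      (chi4 p * (p : ℂ) ^ (κ - r - 2) * quadGauss p ^ r))).add
    ((hf.hasSum_sq_mul (p := p) τ).mul_left ((p : ℂ) ^ (2 * κ - r - 2)))).mul_left (chi4 p)
  refine h.congr_fun fun n => ?_
  have e1 : (p : ℂ) ^ (-2 : ℤ) * (p : ℂ) ^ 2 = 1 := by
    rw [zpow_neg]; exact inv_mul_cancel₀ (pow_ne_zero 2 hp0)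
  have e2 : (p : ℂ) ^ (κ - r - 2) * quadGauss p ^ (r + 1) =
      chi4 p * (legendreSym p (-1) : ℂ) ^ k.natAbs * (p : ℂ) ^ (k - 1) := by
    rw [← middle_constant h2 hr hk hκ, ← quadGauss_sq h2, ← pow_mul]
    congr 2
    obtain ⟨s, rfl⟩ := hr
    omega
  have e3 : (2 * κ - r - 2 : ℤ) = 2 * k - 1 := by
    obtain ⟨s, rfl⟩ := hr
    rw [hk, weight_eq]; push_cast; ring
  rw [twistedHeckeCoeff_eq h2, e3]
  rw [pow_succ] at e2
  linear_combination (-chi4 p * coeff8 f (p ^ 2 * n) * e ((n : ℂ) / 8 * τ)) * e1 -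
    chi4 p * chi4 p * quadChar p n * coeff8 f n * e ((n : ℂ) / 8 * τ) * e2 -
    chi4 p * (legendreSym p (-1) : ℂ) ^ k.natAbs * (p : ℂ) ^ (k - 1) * quadChar p n *
      coeff8 f n * e ((n : ℂ) / 8 * τ) * hχ

/-- Since p² ≡ 1 mod 8, multiplying or dividing an exponent by p² keeps its class mod 8. -/
theorem dvd_of_twistedHeckeCoeff_ne_zero (h2 : p ≠ 2)
    (hf : ∀ n, coeff8 f n ≠ 0 → 8 ∣ n + r) (n : ℕ) (h : twistedHeckeCoeff k p f n ≠ 0) :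
    8 ∣ n + r := by
  have hp8 : ∃ l, p ^ 2 = 8 * l + 1 := by
    obtain ⟨l, hl⟩ := odd_sq_sub_one (odd_natCast_of_prime (p := p) h2)
    refine ⟨l.toNat, ?_⟩
    have : 0 ≤ l := by nlinarith [sq_nonneg (p : ℤ)]
    zify
    rw [Int.toNat_of_nonneg this, hl]
  obtain ⟨l, hl⟩ := hp8
  by_contra hn
  have h0 : coeff8 f n = 0 := by
    by_contra h0; exact hn (hf n h0)
  have h1 : coeff8 f (p ^ 2 * n) = 0 := by
    by_contra h1
    refine hn ?_
    have := hf _ h1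
    rw [hl, add_mul, one_mul, add_assoc, mul_assoc] at this
    exact (Nat.dvd_add_right (dvd_mul_right 8 _)).mp this
  refine h ?_
  rw [twistedHeckeCoeff, h0, h1]
  split_ifs with hd
  · obtain ⟨j, rfl⟩ := hd
    have h3 : coeff8 f (p ^ 2 * j / p ^ 2) = 0 := by
      rw [Nat.mul_div_cancel_left _ (pow_pos hp.out.pos 2)]
      by_contra h3
      refine hn ?_
      rw [hl, add_mul, one_mul, add_assoc, mul_assoc]
      exact (Nat.dvd_add_right (dvd_mul_right 8 _)).mpr (hf _ h3)
    rw [h3]; simp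
  · simp

theorem hasSum_twistedHecke {F : ℂ} {τ : ℍ} (h0 : twistedHeckeCoeff k p f 0 = 0)
    (h : HasSum (fun n : ℕ => twistedHeckeCoeff k p f n * e ((n : ℂ) / 8 * τ)) F) :
    HasSum (twistedHeckeTerm k p f τ) F := by
  refine (hasSum_nat_add_iff (f := fun n : ℕ =>
    twistedHeckeCoeff k p f n * e ((n : ℂ) / 8 * τ)) 1).mpr ?_
  simpa [h0] using h

theorem IsThetaDual.heckeSum (hf : IsThetaDual r κ f) (h2 : p ≠ 2) (hr : Odd r)
    (hk : κ = k + ((r : ℤ) + 1) / 2) (hκ : Odd κ) :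
    IsThetaDual r κ fun τ => heckeSum r κ p f τ :=
  isThetaDual_of_hasSum (dvd_of_twistedHeckeCoeff_ne_zero h2 fun _ => hf.dvd_of_coeff8_ne_zero)
    (hf.hasSum_heckeSum h2 hr hk hκ) fun τ => by
      rw [coe_S_smul]; exact heckeSum_S hf hr hκ h2 τ

end

/-! ### Hecke operators on Fourier coefficients -/

theorem half_add_intCast {r : ℕ} (n m : Fin r → ℤ) :
    half n + (fun i => (m i : ℚ)) = half fun i => n i + 2 * m i := by
  ext i; simp [half]; ring

theorem chiVec_add_two_mul {r : ℕ} (n : Fin r → ℤ) {m : Fin r → ℤ} (hm : Even (∑ i, m i)) :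
    chiVec (fun i => n i + 2 * m i) = chiVec n := by
  have h := chiVec_two_mul_add_one m
  simp only [chiVec, chi4_two_mul_add_one] at h
  simp only [chiVec, chi4_add_two_mul]
  rw [Finset.prod_mul_distrib, h, hm.neg_one_zpow, one_mul]

theorem chiQ_half_add {r : ℕ} (n : Fin r → ℤ) {l : Fin r → ℚ} (hl : l ∈ latticeD r) :
    chiQ (half n + l) = chiQ (half n) := by
  obtain ⟨m, hm, hme⟩ := hl
  rw [show l = fun i => (m i : ℚ) from funext hm, half_add_intCast, chiQ_half, chiQ_half,
    chiVec_add_two_mul n hme]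

theorem chiQ_add {r : ℕ} (x : Fin r → ℚ) {l : Fin r → ℚ} (hl : l ∈ latticeD r) :
    chiQ (x + l) = chiQ x := by
  by_cases h : chiQ (x + l) = 0
  · by_cases h0 : chiQ x = 0
    · rw [h, h0]
    · obtain ⟨n, rfl, -⟩ := exists_of_chiQ_ne_zero h0
      exact chiQ_half_add n hl
  · obtain ⟨n, hn, -⟩ := exists_of_chiQ_ne_zero h
    rw [hn, ← chiQ_half_add n (neg_mem hl), ← hn, add_neg_cancel_right]

theorem mul_half {r : ℕ} (p : ℤ) (n : Fin r → ℤ) : (p : ℚ) • half n = half fun i => p * n i := by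
  ext i; simp [half]; ring

theorem qf_smul {r : ℕ} (a : ℚ) (x : Fin r → ℚ) : qf (a • x) = a ^ 2 * qf x := by
  simp [qf]; ring

theorem chiQ_mul_half {r : ℕ} (p : ℤ) (n : Fin r → ℤ) :
    chiQ ((p : ℚ) • half n) = chi4 p ^ r * chiQ (half n) := by
  rw [mul_half, chiQ_half, chiQ_half, chiVec, chiVec]
  simp only [chi4_mul]
  rw [Finset.prod_mul_distrib]; simp

/-- The discriminant group of `D_r` has order `4` for odd `r`. -/
theorem relIndex_latticeD {r : ℕ} (hr : Odd r) : (latticeD r).relIndex (dual (latticeD r)) = 4 := by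
  have hsum : ∀ n : Fin r → ℤ, 2 * ∑ i, half n i = ((∑ i, n i : ℤ) : ℚ) := fun n => by
    rw [Finset.mul_sum]; push_cast
    exact Finset.sum_congr rfl fun i _ => by rw [half]; ring
  have hfloor : ∀ n : Fin r → ℤ, ⌊2 * ∑ i, half n i⌋ = ∑ i, n i := fun n => by
    rw [hsum, Int.floor_intCast]
  -- Twice the coordinate sum, mod 4, is a homomorphism with kernel D_r; it takes the unit r at v₁,
  -- hence is onto. The floor only extracts an integer.
  let ψ : dual (latticeD r) →+ ZMod 4 := AddMonoidHom.mk'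
    (fun x => ((⌊2 * ∑ i, (x : Fin r → ℚ) i⌋ : ℤ) : ZMod 4)) fun x y => by
      obtain ⟨n, hn⟩ := exists_half_of_mem_dual x.2
      obtain ⟨m, hm⟩ := exists_half_of_mem_dual y.2
      have h1 : half n + half m = half (n + m) := by ext i; simp [half]; ring
      rw [AddSubgroup.coe_add, hn, hm, h1, hfloor, hfloor, hfloor]
      simp [Finset.sum_add_distrib]
  have hker : ψ.ker = (latticeD r).addSubgroupOf (dual (latticeD r)) := by
    ext ⟨x, hx⟩
    rw [AddMonoidHom.mem_ker, AddSubgroup.mem_addSubgroupOf]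
    change ((⌊2 * ∑ i, x i⌋ : ℤ) : ZMod 4) = 0 ↔ x ∈ latticeD r
    constructor
    · intro h
      rcases dual_cases hx with ⟨n, rfl, hn⟩ | ⟨n, rfl⟩
      · rw [hfloor, ZMod.intCast_zmod_eq_zero_iff_dvd] at h
        obtain ⟨m, rfl⟩ := exists_of_odd hn
        obtain ⟨s, rfl⟩ := hr
        simp only [Finset.sum_add_distrib, ← Finset.mul_sum, Finset.sum_const, Finset.card_univ,
          Fintype.card_fin, nsmul_eq_mul] at h
        push_cast at h
        omega
      · have h1 : (2 : ℚ) * ∑ i, (n i : ℚ) = ((2 * ∑ i, n i : ℤ) : ℚ) := by push_cast; rfl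
        rw [h1, Int.floor_intCast, ZMod.intCast_zmod_eq_zero_iff_dvd] at h
        push_cast at h
        exact ⟨n, fun _ => rfl, by rw [Int.even_iff]; omega⟩
    · rintro ⟨n, hn, j, hj⟩
      have h1 : (2 : ℚ) * ∑ i, x i = ((2 * ∑ i, n i : ℤ) : ℚ) := by push_cast; simp [hn]
      rw [h1, Int.floor_intCast, ZMod.intCast_zmod_eq_zero_iff_dvd, hj]
      exact ⟨j, by push_cast; ring⟩
  have hsurj : Function.Surjective ψ := by
    have h1 : ψ ⟨v1 r, v1_mem_dual r⟩ = (r : ZMod 4) := by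
      have : (2 : ℚ) * ∑ i, v1 r i = (r : ℤ) := by simp [v1]; ring
      change ((⌊2 * ∑ i, v1 r i⌋ : ℤ) : ZMod 4) = r
      rw [this, Int.floor_intCast]; simp
    have h2 : (r : ZMod 4) * r = 1 := by
      obtain ⟨s, rfl⟩ := hr
      push_cast
      generalize (s : ZMod 4) = s
      revert s; decide
    intro a
    refine ⟨(a * r).val • ⟨v1 r, v1_mem_dual r⟩, ?_⟩
    rw [map_nsmul, h1, nsmul_eq_mul, ZMod.natCast_zmod_val, mul_assoc, h2, mul_one]
  rw [AddSubgroup.relIndex, ← hker, AddSubgroup.index_ker, AddMonoidHom.range_eq_top.mpr hsurj]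
  simp

/-! ### Legendre symbols of discriminants and the sum over D_r/pD_r. -/

section

variable {p : ℕ} [hp : Fact p.Prime] {r : ℕ}

/-- The fraction D/8 need not be reduced, but its denominator divides 8 and is prime to p. The
symbol (8/p) produced here cancels against (2·4/p) from the index of D_r. -/
theorem legendreQ_div_eight (h2 : p ≠ 2) (D : ℤ) :
    legendreQ p ((D : ℚ) / 8) = legendreSym p 8 * legendreSym p D := by
  obtain ⟨q, hq⟩ : ∃ q : ℚ, q = (D : ℚ) / 8 := ⟨_, rfl⟩
  rw [← hq]
  have h8 : ((8 : ℤ) : ZMod p) ≠ 0 := by exact_mod_cast natCast_two_pow_ne_zero h2 3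
  have h1 : q.num * 8 = D * q.den := by
    have := Rat.num_div_den q
    rw [hq, div_eq_div_iff (by exact_mod_cast (Rat.den_ne_zero _)) (by norm_num), ← hq] at this
    exact_mod_cast this
  have hden : ((q.den : ℤ) : ZMod p) ≠ 0 := by
    intro h
    rw [ZMod.intCast_zmod_eq_zero_iff_dvd] at h
    have h3 : (q.den : ℤ) ∣ 8 := by
      have : (q.den : ℤ) ∣ q.num * 8 := ⟨D, by rw [h1]; ring⟩
      exact (Int.isCoprime_iff_gcd_eq_one.mpr (by
        have := q.reduced; rw [Nat.coprime_comm] at this; simpa [Int.gcd] using this)).dvd_of_dvd_mul_left this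
    rw [Ne, ZMod.intCast_zmod_eq_zero_iff_dvd] at h8
    exact h8 (h.trans h3)
  have h3 := congrArg (legendreSym p) h1
  rw [legendreSym.mul, legendreSym.mul] at h3
  have h4 := legendreSym.sq_one p h8
  have h5 := legendreSym.sq_one p hden
  rw [legendreQ]
  linear_combination (legendreSym p 8 * legendreSym p q.den) * h3 -
    (legendreSym p q.num * legendreSym p q.den) * h4 + legendreSym p 8 * legendreSym p D * h5

theorem chi4_prime_pow_odd (h2 : p ≠ 2) (hr : Odd r) : chi4 p ^ r = chi4 p := by
  obtain ⟨j, rfl⟩ := hr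
  rw [pow_succ, pow_mul, sq, chi4_sq_of_odd (odd_natCast_of_prime h2), one_pow, one_mul]

theorem chiQ_inv_smul (h2 : p ≠ 2) (hr : Odd r) {y : Fin r → ℚ} (hy : chiQ y ≠ 0) {x l : Fin r → ℚ}
    (hl : l ∈ latticeD r) (h : (p : ℚ) • y = x - l) : chiQ y = chi4 p * chiQ x := by
  obtain ⟨n, rfl, -⟩ := exists_of_chiQ_ne_zero hy
  have h1 := chiQ_mul_half (p : ℤ) n
  rw [Int.cast_natCast, h, sub_eq_add_neg, chiQ_add x (neg_mem hl), chi4_prime_pow_odd h2 hr] at h1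
  rw [h1, ← mul_assoc, chi4_sq_of_odd (odd_natCast_of_prime h2), one_mul]

/-- For a vector `x` with odd doubled coordinates there is a lattice vector `l`, unique modulo `p`,
such that `(x - l) / p` has odd doubled coordinates. -/
theorem exists_chiQ_ne_zero (h2 : p ≠ 2) {n : Fin r → ℤ} (hn : ∀ i, Odd (n i)) :
    ∃ l ∈ latticeD r, chiQ ((p : ℚ)⁻¹ • (half n - l)) ≠ 0 := by
  have hp0 : (p : ℚ) ≠ 0 := Nat.cast_ne_zero.mpr hp.out.ne_zero
  have hcop : IsCoprime (4 : ℤ) p := by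
    have := ((Nat.coprime_primes Nat.prime_two hp.out).mpr h2.symm).pow_left 2
    exact_mod_cast Nat.isCoprime_iff_coprime.mpr this
  -- With 4c + tp = 1 and l = 2cn one gets n/2 - l = p · (tn/2). The factor 2 puts l in D_r, and t
  -- is odd.
  obtain ⟨c, t, hct⟩ := hcop
  have ht : Odd t := by
    by_contra h
    obtain ⟨j, hj⟩ := Int.not_odd_iff_even.mp h
    have : (c * 4 + (j + j) * p : ℤ) = 1 := by rw [← hj]; exact hct
    have h3 : (2 : ℤ) ∣ 1 := ⟨2 * c + j * p, by linear_combination -this⟩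
    norm_num at h3
  have hct' : (c : ℚ) * 4 + t * p = 1 := by exact_mod_cast hct
  refine ⟨fun i => ((2 * (c * n i) : ℤ) : ℚ), ⟨_, fun _ => rfl, ?_⟩, ?_⟩
  · rw [← Finset.mul_sum]; exact even_two_mul _
  · have h3 : (p : ℚ)⁻¹ • (half n - fun i => ((2 * (c * n i) : ℤ) : ℚ)) = half fun i => t * n i := by
      ext i
      simp only [Pi.smul_apply, Pi.sub_apply, half, smul_eq_mul]
      push_cast
      field_simp
      linear_combination (n i : ℚ) * (-hct')
    rw [h3, chiQ_half]
    exact Finset.prod_ne_zero_iff.mpr fun i _ => chi4_ne_zero (ht.mul (hn i))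

theorem sub_mem_of_chiQ_ne_zero (h2 : p ≠ 2) {x l l' : Fin r → ℚ} (hl : l ∈ latticeD r)
    (hl' : l' ∈ latticeD r) (h : chiQ ((p : ℚ)⁻¹ • (x - l)) ≠ 0)
    (h' : chiQ ((p : ℚ)⁻¹ • (x - l')) ≠ 0) : ∃ d ∈ latticeD r, (p : ℚ) • d = l - l' := by
  have hp0 : (p : ℚ) ≠ 0 := Nat.cast_ne_zero.mpr hp.out.ne_zero
  obtain ⟨n, hn, hno⟩ := exists_of_chiQ_ne_zero h
  obtain ⟨n', hn', hno'⟩ := exists_of_chiQ_ne_zero h'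
  obtain ⟨m, hm, hme⟩ := hl
  obtain ⟨m', hm', hme'⟩ := hl'
  have hev : ∀ i, ∃ j, n' i - n i = 2 * j := fun i => by
    obtain ⟨j, hj⟩ := (hno' i).sub_odd (hno i)
    exact ⟨j, by rw [hj]; ring⟩
  choose j hj using hev
  have hd : ∀ i, p * j i = m i - m' i := by
    intro i
    have h1 := congrFun hn i
    have h3 := congrFun hn' i
    simp only [Pi.smul_apply, Pi.sub_apply, smul_eq_mul, half, hm, hm'] at h1 h3
    have h4 : ((n' i : ℚ) - n i) = 2 * j i := by exact_mod_cast hj i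
    have h5 : (p : ℚ) * j i = m i - m' i := by
      field_simp at h1 h3
      linear_combination (-p / 2 : ℚ) * h4 - h3 / 2 + h1 / 2
    exact_mod_cast h5
  refine ⟨fun i => (j i : ℚ), ⟨j, fun _ => rfl, ?_⟩, ?_⟩
  · have h1 : (p : ℤ) * ∑ i, j i = ∑ i, m i - ∑ i, m' i := by
      rw [Finset.mul_sum, ← Finset.sum_sub_distrib]
      exact Finset.sum_congr rfl fun i _ => hd i
    have h3 : Even ((p : ℤ) * ∑ i, j i) := h1 ▸ hme.sub hme'
    rcases Int.even_mul.mp h3 with h4 | h4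
    · exact absurd (odd_natCast_of_prime h2) (Int.not_odd_iff_even.mpr h4)
    · exact h4
  · ext i
    have : (p : ℚ) * j i = m i - m' i := by exact_mod_cast hd i
    simp [this, hm, hm']

/-- The sum over `L / p L` in the Hecke operator has at most one nonzero term. -/
theorem finsum_thetaCoefficients (h2 : p ≠ 2) (hr : Odd r) (a : ℕ → ℂ) (m : ℚ) (x : Fin r → ℚ) :
    ∑ᶠ l : latticeD r ⧸ (zsmulAddGroupHom (p : ℤ) : latticeD r →+ latticeD r).range,
      thetaCoefficients r a ((m - x ⬝ᵥ (l.out : Fin r → ℚ) + qf (l.out : Fin r → ℚ)) / (p : ℚ) ^ 2)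
        ((p : ℚ)⁻¹ • (x - (l.out : Fin r → ℚ))) =
    chi4 p * chiQ x * ratExt a (8 * (m - qf x) / (p : ℚ) ^ 2) := by
  have hp0 : (p : ℚ) ≠ 0 := Nat.cast_ne_zero.mpr hp.out.ne_zero
  -- The discriminant is the same for every l, so the sum only concerns the characters.
  have hterm : ∀ l : Fin r → ℚ, 8 * ((m - x ⬝ᵥ l + qf l) / (p : ℚ) ^ 2 -
      qf ((p : ℚ)⁻¹ • (x - l))) = 8 * (m - qf x) / (p : ℚ) ^ 2 := by
    intro l
    rw [qf_smul, sub_eq_add_neg x, qf_add, qf_neg, dotProduct_neg]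
    field_simp
    ring
  simp only [thetaCoefficients, hterm]
  have hval : ∀ l ∈ latticeD r, chiQ ((p : ℚ)⁻¹ • (x - l)) ≠ 0 →
      chiQ ((p : ℚ)⁻¹ • (x - l)) = chi4 p * chiQ x := fun l hl h =>
    chiQ_inv_smul h2 hr h hl (smul_inv_smul₀ hp0 _)
  by_cases hx : chiQ x = 0
  · have : ∀ l ∈ latticeD r, chiQ ((p : ℚ)⁻¹ • (x - l)) = 0 := fun l hl => by
      by_contra h
      exact h (by rw [hval l hl h, hx, mul_zero])
    rw [hx]
    simp [this _ (Subtype.prop _)]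
  · obtain ⟨n, rfl, hn⟩ := exists_of_chiQ_ne_zero hx
    obtain ⟨l, hl, hne⟩ := exists_chiQ_ne_zero h2 hn
    have hmk : ∀ d d' : latticeD r, (p : ℚ) • (d : Fin r → ℚ) = d' →
        d' ∈ (zsmulAddGroupHom (p : ℤ) : latticeD r →+ latticeD r).range := fun d d' h =>
      ⟨d, Subtype.ext (by rw [← h]; ext i; simp)⟩
    let Q : latticeD r ⧸ (zsmulAddGroupHom (p : ℤ) : latticeD r →+ latticeD r).range :=
      QuotientAddGroup.mk ⟨l, hl⟩
    have hout : chiQ ((p : ℚ)⁻¹ • (half n - (Q.out : Fin r → ℚ))) ≠ 0 := by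
      have h1 : (QuotientAddGroup.mk Q.out : latticeD r ⧸ _) = QuotientAddGroup.mk ⟨l, hl⟩ :=
        Quotient.out_eq' Q
      rw [QuotientAddGroup.eq] at h1
      obtain ⟨d, hd⟩ := h1
      have h3 : (p : ℚ) • (d : Fin r → ℚ) = -(Q.out : Fin r → ℚ) + l := by
        have := congrArg Subtype.val hd
        rw [← show (⟨l, hl⟩ : latticeD r).1 = l from rfl, ← AddSubgroup.coe_neg,
          ← AddSubgroup.coe_add, ← this]
        ext i; simp
      rw [show (p : ℚ)⁻¹ • (half n - (Q.out : Fin r → ℚ)) = (p : ℚ)⁻¹ • (half n - l) + d by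
        rw [← inv_smul_smul₀ hp0 (d : Fin r → ℚ), ← smul_add, h3]
        congr 1; abel, chiQ_add _ d.2]
      exact hne
    rw [finsum_eq_single _ Q, hval _ Q.out.2 hout]
    intro q hq
    have : chiQ ((p : ℚ)⁻¹ • (half n - (q.out : Fin r → ℚ))) = 0 := by
      by_contra h
      obtain ⟨d, hd, hdq⟩ := sub_mem_of_chiQ_ne_zero h2 Q.out.2 q.out.2 hout h
      refine hq ?_
      rw [← Quotient.out_eq' q, ← Quotient.out_eq' Q]
      exact QuotientAddGroup.eq.mpr (hmk ⟨d, hd⟩ _ (by rw [hdq]; simp; abel))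
    rw [this, zero_mul]

end

/-! ### Agreement of the two Hecke operators on coefficients. -/

section

variable {p : ℕ} [hp : Fact p.Prime] {r : ℕ} {κ k : ℤ} {f : ℍ → ℂ}

theorem ratExt_eq_zero {a : ℕ → ℂ} {D : ℚ} (h : D < 0) : ratExt a D = 0 := by
  by_contra h0
  obtain ⟨n, rfl, -⟩ := exists_of_ratExt_ne_zero h0
  exact absurd h (not_lt.mpr (Nat.cast_nonneg n))

theorem ratExt_div_sq (a : ℕ → ℂ) (N : ℕ) : ratExt a ((N : ℚ) / (p : ℚ) ^ 2) =
    if p ^ 2 ∣ N then a (N / p ^ 2) else 0 := by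
  have hp0 : (p : ℚ) ≠ 0 := Nat.cast_ne_zero.mpr hp.out.ne_zero
  split_ifs with h
  · obtain ⟨j, rfl⟩ := h
    rw [Nat.mul_div_cancel_left _ (pow_pos hp.out.pos 2), ← ratExt_natCast a j]
    congr 1
    push_cast
    field_simp
  · by_contra h0
    obtain ⟨j, hj, -⟩ := exists_of_ratExt_ne_zero h0
    refine h ⟨j, ?_⟩
    rw [div_eq_iff (pow_ne_zero 2 hp0)] at hj
    have : (N : ℚ) = ((p ^ 2 * j : ℕ) : ℚ) := by rw [hj]; push_cast; ring
    exact_mod_cast this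

theorem heckeCoeff_mul_prodTheta (h2 : p ≠ 2) (hr : Odd r) (hk : κ = k + ((r : ℤ) + 1) / 2)
    (hκ : Odd κ) {φ : ℍ → (Fin r → ℂ) → ℂ}
    (hφ : HasFourierExpansion (latticeD r) φ (thetaCoefficients r (coeff8 f)))
    (m : ℤ) {x : Fin r → ℚ} (hx : x ∈ dual (latticeD r)) :
    heckeCoeff κ (latticeD r) p φ m x = thetaCoefficients r (twistedHeckeCoeff k p f) m x := by
  have hp0 : (p : ℚ) ≠ 0 := Nat.cast_ne_zero.mpr hp.out.ne_zero
  have hχ := chi4_sq_of_odd (odd_natCast_of_prime h2)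
  rw [heckeCoeff, coeff_eq hφ, finsum_thetaCoefficients h2 hr, relIndex_latticeD hr]
  simp only [thetaCoefficients]
  obtain ⟨n, hn⟩ := exists_half_of_mem_dual hx
  have hpx : chiQ ((p : ℚ) • x) = chi4 p * chiQ x := by
    rw [hn, ← chi4_prime_pow_odd h2 hr]
    exact_mod_cast chiQ_mul_half (p : ℤ) n
  have hqx : 8 * ((p : ℚ) ^ 2 * m - qf ((p : ℚ) • x)) = (p : ℚ) ^ 2 * (8 * (m - qf x)) := by
    rw [qf_smul]; ring
  rw [hpx, hqx]
  by_cases hx0 : chiQ x = 0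
  · simp [hx0]
  obtain ⟨n, rfl, hno⟩ := exists_of_chiQ_ne_zero hx0
  obtain ⟨D, hD⟩ : ∃ D : ℤ, 8 * ((m : ℚ) - qf (half n)) = D := by
    obtain ⟨l, hl⟩ := qf_half_odd hno
    exact ⟨8 * (m - l) - r, by rw [hl]; push_cast; ring⟩
  have hD' : (m : ℚ) - qf (half n) = (D : ℚ) / 8 := by rw [← hD]; ring
  rw [hD', mul_div_cancel₀ _ (by norm_num : (8 : ℚ) ≠ 0), legendreQ_div_eight h2]
  -- For negative D all coefficients involved are zero by extension, since the series has only
  -- nonnegative exponents.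
  rcases lt_or_ge D 0 with hneg | hnn
  · have hDq : (D : ℚ) < 0 := by exact_mod_cast hneg
    have hp2 : (0 : ℚ) < (p : ℚ) ^ 2 := by positivity
    rw [ratExt_eq_zero hDq, ratExt_eq_zero (mul_neg_of_pos_of_neg hp2 hDq),
      ratExt_eq_zero (div_neg_of_neg_of_pos hDq hp2), ratExt_eq_zero hDq]
    ring
  · obtain ⟨N, rfl⟩ := Int.eq_ofNat_of_zero_le hnn
    have h8 : (legendreSym p 8 : ℂ) * legendreSym p 8 = 1 := by
      have : ((8 : ℤ) : ZMod p) ≠ 0 := by exact_mod_cast natCast_two_pow_ne_zero h2 3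
      exact_mod_cast (sq (legendreSym p 8)) ▸ legendreSym.sq_one p this
    have hmid := middle_constant h2 hr hk hκ
    have hpow : (2 * κ - r - 2 : ℤ) = 2 * k - 1 := by
      obtain ⟨s, rfl⟩ := hr
      rw [hk, weight_eq]; push_cast; ring
    have hN : (legendreSym p N : ℂ) = quadChar p N := by
      rw [← quadChar_intCast, Int.cast_natCast]
    simp only [Int.cast_natCast]
    rw [← Nat.cast_pow, ← Nat.cast_mul, Nat.cast_pow, ratExt_natCast, ratExt_natCast,
      ratExt_natCast, ratExt_div_sq, twistedHeckeCoeff_eq h2, hpow]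
    push_cast
    rw [hN]
    linear_combination (chiQ (half n) * coeff8 f N * quadChar p N *
      (legendreSym p 8 * legendreSym p 8)) * hmid +
      chiQ (half n) * coeff8 f N * quadChar p N * chi4 p * (legendreSym p (-1) : ℂ) ^ k.natAbs *
        (p : ℂ) ^ (k - 1) * h8

theorem heckeCoeffZ_mul_prodTheta (h2 : p ≠ 2) (hr : Odd r) (hk : κ = k + ((r : ℤ) + 1) / 2)
    (hκ : Odd κ) (hf : ∀ n, coeff8 f n ≠ 0 → 8 ∣ n + r) {φ : ℍ → (Fin r → ℂ) → ℂ}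
    (hφ : HasFourierExpansion (latticeD r) φ (thetaCoefficients r (coeff8 f))) :
    heckeCoeffZ κ (latticeD r) p φ = thetaCoefficients r (twistedHeckeCoeff k p f) := by
  ext m x
  rw [heckeCoeffZ]
  split_ifs with h
  · obtain ⟨⟨l, rfl⟩, hx⟩ := h
    exact heckeCoeff_mul_prodTheta h2 hr hk hκ hφ l hx
  · by_contra h0
    exact h (thetaCoefficients_support (dvd_of_twistedHeckeCoeff_ne_zero h2 hf) (Ne.symm h0))

end

end LatticeJacobi

end

open LatticeJacobi
theorem proposition5p2 (r : ℕ) (hr : r = 1 ∨ r = 3 ∨ r = 5 ∨ r = 7) (k : ℤ)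
    (hk : Odd (k + ((r : ℤ) + 1) / 2)) :
    ∃ J : jacobiCusp (k + ((r : ℤ) + 1) / 2) (latticeD r) ≃ₗ[ℂ]
        etaModularForms (3 * (8 - r)) (k - 12 + (3 * (r : ℤ) + 1) / 2),
      -- `J` is the map `φ ↦ h_1`
      (∀ φ : jacobiCusp (k + ((r : ℤ) + 1) / 2) (latticeD r),
        (J φ : ℍ → ℂ) = thetaCoeff (latticeD r) φ (v1 r)) ∧
      (∀ (φ : jacobiCusp (k + ((r : ℤ) + 1) / 2) (latticeD r)) (τ : ℍ) (z : Fin r → ℂ),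
        (φ : ℍ → (Fin r → ℂ) → ℂ) τ z =
        (J φ : ℍ → ℂ) τ *
          (theta (latticeD r) (v1 r) τ z - theta (latticeD r) (v1 r) τ (-z))) ∧
      -- `J` is compatible with the Hecke operators
      ∀ (p : ℕ) [Fact p.Prime], p ≠ 2 →
        ∀ φ : jacobiCusp (k + ((r : ℤ) + 1) / 2) (latticeD r),
          HasFourierExpansion (latticeD r)
            (heckeJ (k + ((r : ℤ) + 1) / 2) (latticeD r) p φ)
            (heckeCoeffZ (k + ((r : ℤ) + 1) / 2) (latticeD r) p φ) ∧
          (∀ τ : ℍ, Summable (twistedHeckeTerm k p (J φ) τ)) ∧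
          ∃ h : heckeJ (k + ((r : ℤ) + 1) / 2) (latticeD r) p φ ∈
              jacobiCusp (k + ((r : ℤ) + 1) / 2) (latticeD r),
            (J ⟨_, h⟩ : ℍ → ℂ) = twistedHecke k p (J φ) := by
  have hrodd : Odd r := by rcases hr with rfl | rfl | rfl | rfl <;> decide
  have hr8 : r < 8 := by omega
  have hw : k - 12 + (3 * (r : ℤ) + 1) / 2 = (k + ((r : ℤ) + 1) / 2) + r - 12 := by omega
  generalize hκ : k + ((r : ℤ) + 1) / 2 = κ at hk hw ⊢
  generalize k - 12 + (3 * (r : ℤ) + 1) / 2 = w at hw ⊢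
  have hκ' := hκ.symm
  let J := thetaEquiv hrodd hr8 hk hw
  have hJ : ∀ φ, IsThetaDual r κ (J φ) := fun φ => isThetaDual_of_mem hr8 hw (J φ).2
  have hφ : ∀ φ : jacobiCusp κ (latticeD r), (φ : ℍ → (Fin r → ℂ) → ℂ) = fun τ z => (J φ : ℍ → ℂ) τ * prodTheta τ z :=
    thetaEquiv_mul_prodTheta hrodd hr8 hk hw
  refine ⟨J, fun φ => ?_, fun φ τ z => ?_, fun p hp h2 φ => ?_⟩
  · rw [hφ φ]
    exact (thetaCoeff_mul_prodTheta (fun _ => (hJ φ).dvd_of_coeff8_ne_zero) (hJ φ).hasSum).symm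
  · rw [theta_sub_theta_neg hrodd]
    exact congrFun (congrFun (hφ φ) τ) z
  · have hd : ∀ n, coeff8 (J φ) n ≠ 0 → 8 ∣ n + r := fun _ => (hJ φ).dvd_of_coeff8_ne_zero
    have hd' := dvd_of_twistedHeckeCoeff_ne_zero (k := k) h2 hd
    have hF := hasFourierExpansion_mul_prodTheta hd (hJ φ).hasSum
    rw [← hφ φ] at hF
    have hc := heckeCoeffZ_mul_prodTheta h2 hrodd hκ' hk hd hF
    have hs := (hJ φ).hasSum_heckeSum h2 hrodd hκ' hk
    have hF' := hasFourierExpansion_mul_prodTheta hd' hs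
    -- The function defined by the new coefficients factors as the Hecke sum of h₁ times
    -- `prodTheta`; membership and the value of J on it follow.
    have hheck : heckeJ κ (latticeD r) p φ =
        fun (τ : ℍ) (z : Fin r → ℂ) => heckeSum r κ p (J φ) τ * prodTheta τ z := by
      ext τ z
      rw [heckeJ, hc]
      exact (hF'.hasSum τ z).tsum_eq
    -- `twistedHecke` sums from index 1; the omitted term vanishes because 8 does not divide r.
    have h0 : twistedHeckeCoeff k p (J φ) 0 = 0 := by
      by_contra h
      have := hd' 0 h
      have := hrodd.pos
      omega
    have hts := fun τ => hasSum_twistedHecke h0 (hs τ)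
    have hmem : heckeJ κ (latticeD r) p φ ∈ jacobiCusp κ (latticeD r) := by
      rw [hheck]
      exact ((hJ φ).heckeSum h2 hrodd hκ' hk).isJacobiCuspForm hrodd.pos hr8
    refine ⟨by rw [hc, hheck]; exact hF', fun τ => (hts τ).summable, hmem, ?_⟩
    ext τ
    obtain ⟨z, hz⟩ := exists_prodTheta_ne_zero (r := r) τ
    have h1 := congrFun (congrFun (hφ ⟨_, hmem⟩) τ) z
    rw [show ((⟨_, hmem⟩ : jacobiCusp κ (latticeD r)) : ℍ → (Fin r → ℂ) → ℂ) = _ from hheck] at h1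
    rw [twistedHecke, (hts τ).tsum_eq]
    exact (mul_right_cancel₀ hz h1).symm
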